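/- **Setting.** Let $\mathcal M$ be an infinite-horizon Markov decision process with measurable state and action spaces $\mathcal S,\mathcal A$ (for instance Borel subsets of Euclidean spaces), initial distribution $\nu_0$, transition law $P$, discount rate $\gamma\in(0,1)$, and a measurable (e.g. continuous) feature map $\phi:\mathcal S\times\mathcal A\to\mathbb R^d$ with $\|\phi(s,a)\|\le L$. Let $H_\gamma=1/(1-\gamma)$. For $\theta\in\mathbb R^d$ let $r_\theta(s,a)=\langle\theta,\phi(s,a)\rangle$; for a stationary Markov policy $\pi$ with trajectory law $\mathbb P_\pi$ on $(\mathcal S\times\mathcal A)^\infty$ let $V_\theta^\pi=\mathbb E_{\tau\sim\mathbb P_\pi}\big[\sum_{h\ge0}\gamma^h r_\theta(s_h,a_h)\big]$, and let $V_\theta^*=\sup_\pi V_\theta^\pi$. For a trajectory $\tau$ put $\phi(\tau)=\sum_{h\ge0}\gamma^h\phi(s_h,a_h)$. The true reward parameter $\theta^*$ satisfies $\|\theta^*\|\le B$, and a pair of trajectories is labelled according to the Bradley–Terry model $\Pr[\tau\succ\tau']=\sigma(\langle\theta^*,\phi(\tau)-\phi(\tau')\rangle)$ with $\sigma(x)=1/(1+e^{-x})$.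 We are given a PAC-RL oracle $\mathtt A$: for all $\varepsilon>0$, $\delta\in(0,1)$ and $\theta\in\mathbb R^d$ it returns a random policy $\pi=\mathtt A(\theta,\varepsilon,\delta)$ with $V_\theta^*-V_\theta^\pi\le\varepsilon$ with probability at least $1-\delta$. Let $$\kappa=\max_{\|\theta\|\le B,\ \|x\|\le 2LH_\gamma}\frac1{\dot\sigma(\langle\theta,x\rangle)},\qquad \beta_t(\delta)^2=\kappa\Big[\log\tfrac1\delta+d\log\max\Big\{e,\tfrac{4eBLH_\gamma(t-1)}{d}\Big\}\Big]+4\lambda B^2 .$$ **Algorithm RPO-Regret** (input $T\in\mathbb N$, $\delta\in(0,1)$, $\lambda>0$). Put $\varepsilon=1/\sqrt T$, $\delta'=\delta/5$, $V_1=\lambda I$, $\hat\theta_1=0$, and choose any initial policy $\pi_0$. For $t=1,\dots,T$: sample $\tilde\theta_t\sim\mathcal N(\hat\theta_t,\beta_t(\delta')^2V_t^{-1})$; set $\pi_t=\mathtt A(\tilde\theta_t,\varepsilon,\delta'/T)$ and $\pi_t'=\pi_{t-1}$; execute both to obtain independent $\tau_t\sim\mathbb P_{\pi_t}$, $\tau'_t\sim\mathbb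 P_{\pi'_t}$; set $x_t=\phi(\tau_t)-\phi(\tau'_t)$ and $V_{t+1}=V_t+x_tx_t^\top$; observe the preference label $y_t=\mathbb 1(\tau_t\succ\tau'_t)$; and let $\hat\theta_{t+1}$ be any minimizer over $\{\|\theta\|\le B\}$ of the negative log-likelihood $-\sum_{k\le t}\big[y_k\log\sigma(\langle\theta,x_k\rangle)+(1-y_k)\log\sigma(-\langle\theta,x_k\rangle)\big]$. Each random draw (Gaussian sample, oracle output, trajectories, label) follows the stated law conditionally on the whole past. The cumulative regret is $$R(T)=\frac12\sum_{t=1}^T\big(2V^*_{\theta^*}-V^{\pi_t}_{\theta^*}-V^{\pi'_t}_{\theta^*}\big).$$ **Theorem 1.** For all $d,T\ge1$ and $\delta\in(0,1)$ with $dT/\delta\ge2$ (that is, except when $d=T=1$ and $\delta>1/2$), RPO-Regret satisfies, with probability at least $1-\delta$, $$R(T)=\mathcal O\Big(\sqrt{\kappa\,d^3\,T\,\log(dT/\delta)^3}\Big),$$ where $\mathcal O(\cdot)$ hides only a factor polynomial in $B,L,H_\gamma,\lambda,\lambda^{-1}$: there are absolute constants $C>0$ and $k\in\mathbb N$ such that,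 for every instance of the setting and every $\lambda>0$, with probability at least $1-\delta$, $$R(T)\le C\,(1+B+L+H_\gamma+\lambda+\lambda^{-1})^k\sqrt{\kappa\,d^3\,T\,\log(dT/\delta)^3}.$$ -/

import Mathlib

open MeasureTheory ProbabilityTheory
open scoped ENNReal RealInnerProductSpace

noncomputable section

namespace RPO

/-- A discounted infinite-horizon Markov decision process with state space `S`, action space `A`,
initial distribution `init`, transition law `trans`, discount rate `disc`, and a feature map into
`ℝ^d`. The spaces are arbitrary measurable spaces and the feature map is only asked to be
measurable; this contains the case of Borel spaces `S ⊆ ℝ^n`, `A ⊆ ℝ^m` with continuous features. -/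
structure MDP (S A : Type*) [MeasurableSpace S] [MeasurableSpace A] (d : ℕ) where
  init : Measure S
  init_prob : IsProbabilityMeasure init
  trans : Kernel (S × A) S
  trans_markov : IsMarkovKernel trans
  disc : ℝ
  disc_pos : 0 < disc
  disc_lt_one : disc < 1
  feat : S × A → EuclideanSpace ℝ (Fin d)
  feat_meas : Measurable feat

attribute [instance] MDP.init_prob MDP.trans_markov

/-- A stationary (randomized) Markov policy. -/
structure Policy {S A : Type*} [MeasurableSpace S] [MeasurableSpace A] {d : ℕ}
    (M : MDP S A d) where
  ker : Kernel S A
  markov : IsMarkovKernel ker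

attribute [instance] Policy.markov

section

variable {S A : Type*} [MeasurableSpace S] [MeasurableSpace A] {d : ℕ} (M : MDP S A d)

/-- One step of the state-action chain under a policy: `s' ∼ P(· | s, a)`, then `a' ∼ π(· | s')`. -/
def stepKernel (π : Policy M) : Kernel (S × A) (S × A) :=
  M.trans ⊗ₖ Kernel.prodMkLeft (S × A) π.ker

instance (π : Policy M) : IsMarkovKernel (stepKernel M π) := by
  unfold stepKernel; infer_instance

/-- The step from the history of state-action pairs up to time `n` to the pair at time `n + 1`. -/
def historyKernel (π : Policy M) (n : ℕ) :
    Kernel ((i : Finset.Iic n) → S × A) (S × A) :=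
  (stepKernel M π).comap (fun h => h ⟨n, Finset.mem_Iic.2 le_rfl⟩) (measurable_pi_apply _)

instance (π : Policy M) (n : ℕ) : IsMarkovKernel (historyKernel M π n) := by
  unfold historyKernel; infer_instance

/-- The law `ℙ_π` on the trajectory space `(S × A)^∞` induced by the policy `π`. -/
def trajLaw (π : Policy M) : Measure (ℕ → S × A) :=
  Kernel.trajMeasure (X := fun _ => S × A) (M.init ⊗ₘ π.ker) (historyKernel M π)

instance (π : Policy M) : IsProbabilityMeasure (trajLaw M π) := by
  unfold trajLaw; infer_instance

/-- The σ-algebra on policies: the smallest one that makes `π ↦ ℙ_π(E)` measurable for every event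
`E` of trajectories, so that random policies can be executed. -/
instance : MeasurableSpace (Policy M) :=
  MeasurableSpace.comap (trajLaw M) inferInstance

/-- The effective horizon `H_γ = 1 / (1 - γ)`. -/
def horizon : ℝ := (1 - M.disc)⁻¹

/-- The linear reward `r_θ(s, a) = ⟨θ, φ(s, a)⟩`. -/
def reward (θ : EuclideanSpace ℝ (Fin d)) (z : S × A) : ℝ := ⟪θ, M.feat z⟫

/-- The discounted feature sum `φ(τ)` of a trajectory. -/
def trajFeat (τ : ℕ → S × A) : EuclideanSpace ℝ (Fin d) := ∑' h, M.disc ^ h • M.feat (τ h)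

/-- The value `V_θ^π`. -/
def value (θ : EuclideanSpace ℝ (Fin d)) (π : Policy M) : ℝ :=
  ∫ τ, (∑' h, M.disc ^ h * reward M θ (τ h)) ∂(trajLaw M π)

/-- The optimal value `V_θ^*`, over all stationary Markov policies. -/
def optValue (θ : EuclideanSpace ℝ (Fin d)) : ℝ := ⨆ π : Policy M, value M θ π

/-- A PAC-RL oracle: for each accuracy `ε > 0`, failure probability `δ ∈ (0, 1)` and reward
parameter `θ` it returns a random policy (with law `O ε δ θ`) which is `ε`-optimal for `θ` with
probability at least `1 - δ`. -/
def IsPACOracle (O : ℝ → ℝ → Kernel (EuclideanSpace ℝ (Fin d)) (Policy M)) : Prop :=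
  ∀ ε δ : ℝ, 0 < ε → 0 < δ → δ < 1 → IsMarkovKernel (O ε δ) ∧
    ∀ θ, ENNReal.ofReal (1 - δ) ≤ O ε δ θ {π | optValue M θ - value M θ π ≤ ε}

/-- The Bradley–Terry law of the label `𝟙(τ ≻ τ')`: it is `true` with probability
`σ(⟨θ*, φ(τ) - φ(τ')⟩)`. -/
def prefLaw (θs : EuclideanSpace ℝ (Fin d)) (p : (ℕ → S × A) × (ℕ → S × A)) : Measure Bool :=
  bernoulliMeasure true false
    (unitInterval.sigmoid ⟪θs, trajFeat M p.1 - trajFeat M p.2⟫)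

/-- `κ`, the maximum of `1 / σ'(⟨θ, x⟩)` over `‖θ‖ ≤ B` and `‖x‖ ≤ 2 L H_γ`. -/
def kappa (B L : ℝ) : ℝ :=
  sSup ((fun q : EuclideanSpace ℝ (Fin d) × EuclideanSpace ℝ (Fin d) =>
      1 / deriv Real.sigmoid ⟪q.1, q.2⟫) ''
    (Metric.closedBall 0 B ×ˢ Metric.closedBall 0 (2 * L * horizon M)))

/-- The confidence radius `β_t(δ)`. -/
def beta (B L lam δ : ℝ) (t : ℕ) : ℝ :=
  √(kappa M B L * (Real.log (1 / δ) + d * Real.log (max (Real.exp 1)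
      (4 * Real.exp 1 * B * L * horizon M * ((t : ℝ) - 1) / d))) + 4 * lam * B ^ 2)

/-- The (deterministic function giving the) cumulative regret of the policy sequence `π_0, …, π_T`
when round `t` compares `π_t` with `π'_t = π_{t-1}`. -/
def regret (θs : EuclideanSpace ℝ (Fin d)) (T : ℕ) (π : ℕ → Policy M) : ℝ :=
  (1 / 2) * ∑ t ∈ Finset.Icc 1 T,
    (2 * optValue M θs - value M θs (π t) - value M θs (π (t - 1)))

end

/-- The design matrix `V_t = λ I + ∑_{k < t} x_k x_kᵀ` (rounds are numbered from `1`). -/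
def designMatrix {d : ℕ} (lam : ℝ) (x : ℕ → EuclideanSpace ℝ (Fin d)) (t : ℕ) :
    Matrix (Fin d) (Fin d) ℝ :=
  lam • (1 : Matrix (Fin d) (Fin d) ℝ) +
    ∑ k ∈ Finset.Ico 1 t, Matrix.vecMulVec (x k).ofLp (x k).ofLp

/-- The negative log-likelihood of the data `(x_k, y_k)`, `1 ≤ k < t`. -/
def negLogLik {d : ℕ} (x : ℕ → EuclideanSpace ℝ (Fin d)) (y : ℕ → Bool) (t : ℕ)
    (θ : EuclideanSpace ℝ (Fin d)) : ℝ :=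
  -∑ k ∈ Finset.Ico 1 t,
    (if y k then Real.log (Real.sigmoid ⟪θ, x k⟫) else Real.log (Real.sigmoid (-⟪θ, x k⟫)))

/-- `κ` is (a regular version of) the conditional law of `Y` given the σ-algebra `m`. -/
def HasCondLaw {Ω X : Type*} [MeasurableSpace Ω] [MeasurableSpace X] (μ : Measure Ω)
    (m : MeasurableSpace Ω) (Y : Ω → X) (κ : Ω → Measure X) : Prop :=
  Measurable[m] κ ∧ ∀ s, MeasurableSet[m] s → ∀ E, MeasurableSet E →
    μ (s ∩ Y ⁻¹' E) = ∫⁻ ω in s, κ ω E ∂μ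

/-- The random variables produced by running `RPO-Regret` for `T` rounds on a probability space:
MLE `θhat t`, sampled parameter `θtil t`, policy `pol t` (with `pol 0` the chosen initial policy),
executed trajectories `traj t = (τ_t, τ'_t)`, and preference label `lab t`, for rounds
`t = 1, …, T`. The σ-algebra `ℱ t` is the information available after round `t`. Entries with
index above `T` play no role. -/
structure RegretRun {S A : Type*} [MeasurableSpace S] [MeasurableSpace A] {d : ℕ}
    (M : MDP S A d) (θs : EuclideanSpace ℝ (Fin d)) (B L : ℝ)
    (O : ℝ → ℝ → Kernel (EuclideanSpace ℝ (Fin d)) (Policy M))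
    (T : ℕ) (δ lam : ℝ) {Ω : Type*} [mΩ : MeasurableSpace Ω] (μ : Measure Ω) where
  ℱ : Filtration ℕ mΩ
  θhat : ℕ → Ω → EuclideanSpace ℝ (Fin d)
  θtil : ℕ → Ω → EuclideanSpace ℝ (Fin d)
  pol : ℕ → Ω → Policy M
  traj : ℕ → Ω → (ℕ → S × A) × (ℕ → S × A)
  lab : ℕ → Ω → Bool
  pol_zero_meas : Measurable[ℱ 0] (pol 0)
  θtil_meas : ∀ t ∈ Finset.Icc 1 T, Measurable[ℱ t] (θtil t)
  pol_meas : ∀ t ∈ Finset.Icc 1 T, Measurable[ℱ t] (pol t)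
  traj_meas : ∀ t ∈ Finset.Icc 1 T, Measurable[ℱ t] (traj t)
  lab_meas : ∀ t ∈ Finset.Icc 1 T, Measurable[ℱ t] (lab t)
  /-- `θhat_1 = 0`. -/
  θhat_one : ∀ ω, θhat 1 ω = 0
  /-- The MLE is computed from the information of the earlier rounds. -/
  θhat_meas : ∀ t ∈ Finset.Icc 1 T, Measurable[ℱ (t - 1)] (θhat t)
  /-- The MLE minimizes the negative log-likelihood over the ball of radius `B`. -/
  θhat_mle : ∀ t ∈ Finset.Icc 2 T, ∀ ω, θhat t ω ∈ Metric.closedBall 0 B ∧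
    IsMinOn (negLogLik (fun k => trajFeat M (traj k ω).1 - trajFeat M (traj k ω).2)
      (fun k => lab k ω) t) (Metric.closedBall 0 B) (θhat t ω)
  /-- Reward sampling: `θtil_t ∼ N(θhat_t, β_t(δ')² V_t⁻¹)` with `δ' = δ / 5`. -/
  θtil_law : ∀ t ∈ Finset.Icc 1 T, HasCondLaw μ (ℱ (t - 1)) (θtil t) (fun ω =>
    multivariateGaussian (θhat t ω) (beta M B L lam (δ / 5) t ^ 2 •
      (designMatrix lam (fun k => trajFeat M (traj k ω).1 - trajFeat M (traj k ω).2) t)⁻¹))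
  /-- RL update: `π_t` is the oracle's answer to `(θtil_t, 1 / √T, δ' / T)`. -/
  pol_law : ∀ t ∈ Finset.Icc 1 T,
    HasCondLaw μ (ℱ (t - 1) ⊔ MeasurableSpace.comap (θtil t) inferInstance) (pol t)
      (fun ω => O (1 / √(T : ℝ)) (δ / 5 / T) (θtil t ω))
  /-- Execution: `τ_t ∼ ℙ_{π_t}` and `τ'_t ∼ ℙ_{π_{t-1}}`, drawn independently. -/
  traj_law : ∀ t ∈ Finset.Icc 1 T,
    HasCondLaw μ (ℱ (t - 1) ⊔ MeasurableSpace.comap (θtil t) inferInstance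
        ⊔ MeasurableSpace.comap (pol t) inferInstance) (traj t)
      (fun ω => (trajLaw M (pol t ω)).prod (trajLaw M (pol (t - 1) ω)))
  /-- Preference feedback: the label follows the Bradley–Terry model. -/
  lab_law : ∀ t ∈ Finset.Icc 1 T,
    HasCondLaw μ (ℱ (t - 1) ⊔ MeasurableSpace.comap (θtil t) inferInstance
        ⊔ MeasurableSpace.comap (pol t) inferInstance
        ⊔ MeasurableSpace.comap (traj t) inferInstance) (lab t)
      (fun ω => prefLaw M θs (traj t ω))

end RPO

end

/-! The argument is Thompson sampling with a logistic confidence set. Since V_θ^π = ⟨θ, φ(π)⟩ with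
φ(π) = E φ(τ) (`value_eq_inner`), the regret is governed by the widths of φ(π_t) - φ(π_{t-1}) in the
norm of V_t⁻¹, with π_{t-1} as the comparison policy.

Confidence: the likelihood ratio of a fixed θ against θ* is a mean-one martingale, and so is its
mixture over the uniform prior on the B-ball. Ville's inequality keeps the mixture below 1/δ' in all
rounds at once. A shrunken copy of the ball around the MLE, on which the likelihood barely moves,
has prior mass η^d, so the mixture bound caps the excess loss of θ*. Strong convexity of the
logistic loss with modulus 1/κ turns this into ‖θ* - θ̂_t‖_{V_t} ≤ 2β_t
(`measure_not_confident_le`).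

Optimism: with probability at least `antiProb` a Gaussian sample moves two standard deviations along
φ(π*) - φ(π_{t-1}), π* being nearly optimal for θ*, and this beats the confidence error. The actual
sample θ̃_t is compared with a fresh resample. Averaging over optimistic resamples bounds the gap of
π_{t-1} under θ* minus its gap under θ̃_t by a constant times the sampling radius times the
conditional mean width (`optimism_le_integral`). Near-optimality of π_t for θ̃_t then bounds its
instantaneous regret by mean width and width (`instant_regret_le`).

Summation: a one-sided multiplicative concentration inequality (`measure_sum_condExp_le`) passes
from mean widths to widths and, after Jensen, from widths to ‖x_t‖ in the norm of V_t⁻¹, at the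
price of factors 2 and terms log(1/δ). Cauchy–Schwarz and the elliptical potential lemma bound the
last sum by order √(dTℓ), where ℓ = log(dT/δ). The confidence radius is of order √(κdℓ) and Gaussian
sampling costs another √(dℓ); the product is √(κ d³ T ℓ³). -/

noncomputable section

namespace RPO

/-! ### Matrix norms, the design matrix and the elliptical potential. -/

section LinearAlgebra

variable {d : ℕ}

/-- The seminorm `‖u‖_A = √(uᵀ A u)` of a matrix. -/
def qnorm (A : Matrix (Fin d) (Fin d) ℝ) (u : EuclideanSpace ℝ (Fin d)) : ℝ :=
  √⟪u, Matrix.toEuclideanCLM (𝕜 := ℝ) A u⟫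

lemma qnorm_nonneg (A : Matrix (Fin d) (Fin d) ℝ) (u : EuclideanSpace ℝ (Fin d)) :
    0 ≤ qnorm A u := Real.sqrt_nonneg _

open scoped MatrixOrder in
lemma exists_symm_sqrt {A : Matrix (Fin d) (Fin d) ℝ} (hA : A.PosDef) :
    ∃ R : Matrix (Fin d) (Fin d) ℝ, star R = R ∧ R * R = A ∧ IsUnit R.det := by
  have h1 : CFC.sqrt A * CFC.sqrt A = A := CFC.sqrt_mul_sqrt_self A hA.posSemidef.nonneg
  refine ⟨CFC.sqrt A, (CFC.sqrt_nonneg A).isSelfAdjoint, h1, ?_⟩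
  have h2 := hA.det_pos
  rw [← h1, Matrix.det_mul] at h2
  exact isUnit_iff_ne_zero.2 fun h => by simp [h] at h2

lemma inner_toEuclideanCLM_of_symm {R : Matrix (Fin d) (Fin d) ℝ} (hR : star R = R)
    (u v : EuclideanSpace ℝ (Fin d)) :
    ⟪u, Matrix.toEuclideanCLM (𝕜 := ℝ) R v⟫ = ⟪Matrix.toEuclideanCLM (𝕜 := ℝ) R u, v⟫ := by
  have h : IsSelfAdjoint (Matrix.toEuclideanCLM (𝕜 := ℝ) R) := by
    rw [isSelfAdjoint_iff, ← map_star, hR]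
  rw [← ContinuousLinearMap.adjoint_inner_left, ← ContinuousLinearMap.star_eq_adjoint, h.star_eq]

lemma toEuclideanCLM_mul_apply (A R : Matrix (Fin d) (Fin d) ℝ) (v : EuclideanSpace ℝ (Fin d)) :
    Matrix.toEuclideanCLM (𝕜 := ℝ) (A * R) v
      = Matrix.toEuclideanCLM (𝕜 := ℝ) A (Matrix.toEuclideanCLM (𝕜 := ℝ) R v) := by
  rw [map_mul]; rfl

lemma qnorm_mul_self_eq {R : Matrix (Fin d) (Fin d) ℝ} (hR : star R = R)
    (u : EuclideanSpace ℝ (Fin d)) :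
    qnorm (R * R) u = ‖Matrix.toEuclideanCLM (𝕜 := ℝ) R u‖ := by
  rw [qnorm, toEuclideanCLM_mul_apply, inner_toEuclideanCLM_of_symm hR, real_inner_self_eq_norm_sq,
    Real.sqrt_sq (norm_nonneg _)]

lemma exists_qnorm_eq_norm {A : Matrix (Fin d) (Fin d) ℝ} (hA : A.PosDef) :
    ∃ R : EuclideanSpace ℝ (Fin d) →L[ℝ] EuclideanSpace ℝ (Fin d),
      ∀ u, qnorm A u = ‖R u‖ := by
  obtain ⟨R, hR, rfl, -⟩ := exists_symm_sqrt hA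
  exact ⟨_, fun u => qnorm_mul_self_eq hR u⟩

/-- Cauchy–Schwarz for dual norms: with A = R² and R symmetric, the pairing equals ⟨Ru, R⁻¹v⟩. -/
lemma inner_le_qnorm_mul {A : Matrix (Fin d) (Fin d) ℝ} (hA : A.PosDef)
    (u v : EuclideanSpace ℝ (Fin d)) : ⟪u, v⟫ ≤ qnorm A u * qnorm A⁻¹ v := by
  obtain ⟨R, hR, rfl, hdet⟩ := exists_symm_sqrt hA
  have hR' : star R⁻¹ = R⁻¹ := by
    rw [Matrix.star_eq_conjTranspose, Matrix.conjTranspose_nonsing_inv,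
      ← Matrix.star_eq_conjTranspose, hR]
  rw [Matrix.mul_inv_rev, qnorm_mul_self_eq hR, qnorm_mul_self_eq hR']
  refine le_trans (le_of_eq ?_) (real_inner_le_norm _ _)
  rw [← inner_toEuclideanCLM_of_symm hR, ← toEuclideanCLM_mul_apply, Matrix.mul_nonsing_inv _ hdet]
  simp

/-- Positivity undoes the square root in `qnorm`. The lemma serves both design matrices and their
inverses. -/
lemma qnorm_inv_sq {A : Matrix (Fin d) (Fin d) ℝ} (hA : A.PosDef)
    (v : EuclideanSpace ℝ (Fin d)) :
    qnorm A v ^ 2 = ⟪v, Matrix.toEuclideanCLM (𝕜 := ℝ) A v⟫ := by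
  rw [qnorm, Real.sq_sqrt]
  rw [Matrix.inner_toEuclideanCLM]
  exact hA.posSemidef.dotProduct_mulVec_nonneg _

lemma qnorm_sub_le {A : Matrix (Fin d) (Fin d) ℝ} (hA : A.PosDef)
    (u v : EuclideanSpace ℝ (Fin d)) : qnorm A (u - v) ≤ qnorm A u + qnorm A v := by
  obtain ⟨R, hR⟩ := exists_qnorm_eq_norm hA
  simpa [hR] using norm_sub_le (R u) (R v)

lemma designMatrix_posDef {lam : ℝ} (hlam : 0 < lam) (x : ℕ → EuclideanSpace ℝ (Fin d)) (t : ℕ) :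
    (designMatrix lam x t).PosDef := by
  refine Matrix.PosDef.add_posSemidef (Matrix.PosDef.one.smul hlam) ?_
  refine Matrix.posSemidef_sum _ fun k _ => ?_
  simpa using Matrix.posSemidef_vecMulVec_self_star (x k).ofLp

lemma qnorm_designMatrix_sq {lam : ℝ} (hlam : 0 < lam) (x : ℕ → EuclideanSpace ℝ (Fin d)) (t : ℕ)
    (u : EuclideanSpace ℝ (Fin d)) :
    qnorm (designMatrix lam x t) u ^ 2
      = lam * ‖u‖ ^ 2 + ∑ k ∈ Finset.Ico 1 t, ⟪u, x k⟫ ^ 2 := by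
  rw [qnorm_inv_sq (designMatrix_posDef hlam x t), Matrix.inner_toEuclideanCLM, designMatrix,
    Matrix.add_mulVec, dotProduct_add, Matrix.sum_mulVec, dotProduct_sum]
  congr 1
  · rw [Matrix.smul_mulVec, Matrix.one_mulVec, dotProduct_smul, EuclideanSpace.real_norm_sq_eq]
    simp [dotProduct, sq]
  · refine Finset.sum_congr rfl fun k _ => ?_
    rw [Matrix.vecMulVec_mulVec]
    simp [EuclideanSpace.inner_eq_star_dotProduct, dotProduct_comm, sq]

lemma qnorm_inv_designMatrix_sq_le {lam : ℝ} (hlam : 0 < lam) (x : ℕ → EuclideanSpace ℝ (Fin d))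
    (t : ℕ) (u : EuclideanSpace ℝ (Fin d)) :
    qnorm (designMatrix lam x t)⁻¹ u ^ 2 ≤ ‖u‖ ^ 2 / lam := by
  set V := designMatrix lam x t with hVdef
  have hV : V.PosDef := designMatrix_posDef hlam x t
  set w := Matrix.toEuclideanCLM (𝕜 := ℝ) V⁻¹ u with hw
  have hVw : Matrix.toEuclideanCLM (𝕜 := ℝ) V w = u := by
    rw [hw, ← toEuclideanCLM_mul_apply, Matrix.mul_nonsing_inv _ (isUnit_iff_ne_zero.2 hV.det_pos.ne')]
    simp
  have h1 : qnorm V⁻¹ u ^ 2 = ⟪u, w⟫ := qnorm_inv_sq hV.inv u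
  have h2 : lam * ‖w‖ ^ 2 ≤ ⟪u, w⟫ := by
    have h3 := qnorm_inv_sq hV w
    rw [hVw, real_inner_comm, hVdef, qnorm_designMatrix_sq hlam] at h3
    rw [← h3]
    have : 0 ≤ ∑ k ∈ Finset.Ico 1 t, ⟪w, x k⟫ ^ 2 := Finset.sum_nonneg fun _ _ => sq_nonneg _
    linarith
  have h4 : ⟪u, w⟫ ≤ ‖u‖ * ‖w‖ := real_inner_le_norm _ _
  rw [h1, le_div_iff₀ hlam]
  -- ‖u‖² ≥ 2λ‖u‖‖w‖ - λ²‖w‖² ≥ 2λ⟨u, w⟩ - λ⟨u, w⟩.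
  nlinarith [sq_nonneg (‖u‖ - lam * ‖w‖), norm_nonneg u, norm_nonneg w]

lemma qnorm_inv_designMatrix_le {lam : ℝ} (hlam : 0 < lam) (x : ℕ → EuclideanSpace ℝ (Fin d))
    (t : ℕ) {u : EuclideanSpace ℝ (Fin d)} {b : ℝ} (hu : ‖u‖ ≤ b) :
    qnorm (designMatrix lam x t)⁻¹ u ≤ b / √lam := by
  have h := qnorm_inv_designMatrix_sq_le hlam x t u
  have hb : 0 ≤ b := (norm_nonneg u).trans hu
  refine abs_le_of_sq_le_sq' (h.trans ?_) (by positivity) |>.2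
  rw [div_pow, Real.sq_sqrt hlam.le]
  gcongr

/-- The matrix determinant lemma for a rank-one update; it makes log det telescope. -/
lemma det_designMatrix_succ {lam : ℝ} (hlam : 0 < lam) (x : ℕ → EuclideanSpace ℝ (Fin d))
    {t : ℕ} (ht : 1 ≤ t) :
    (designMatrix lam x (t + 1)).det
      = (designMatrix lam x t).det * (1 + qnorm (designMatrix lam x t)⁻¹ (x t) ^ 2) := by
  have hV := designMatrix_posDef hlam x t
  have h1 : designMatrix lam x (t + 1) = designMatrix lam x t +
      Matrix.replicateCol Unit (x t).ofLp * Matrix.replicateRow Unit (x t).ofLp := by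
    rw [designMatrix, designMatrix, Finset.sum_Ico_succ_top ht, add_assoc, ← Matrix.vecMulVec_eq]
  rw [h1, Matrix.det_add_replicateCol_mul_replicateRow (isUnit_iff_ne_zero.2 hV.det_pos.ne'),
    qnorm_inv_sq hV.inv, Matrix.inner_toEuclideanCLM]
  congr 1
  rw [Matrix.det_unique, Matrix.add_apply, Matrix.one_apply_eq, Matrix.mul_assoc,
    ← Matrix.replicateCol_mulVec, Matrix.replicateRow_mul_replicateCol_apply]

/-- Each eigenvalue is at most the trace. This is cruder than AM–GM, but only the logarithm matters
later. -/
lemma det_designMatrix_le {lam : ℝ} (hlam : 0 < lam) {x : ℕ → EuclideanSpace ℝ (Fin d)}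
    {b : ℝ} {T : ℕ} (hx : ∀ t ∈ Finset.Icc 1 T, ‖x t‖ ≤ b) :
    (designMatrix lam x (T + 1)).det ≤ (d * lam + T * b ^ 2) ^ d := by
  have hV := designMatrix_posDef hlam x (T + 1)
  have htr : (designMatrix lam x (T + 1)).trace ≤ d * lam + T * b ^ 2 := by
    rw [designMatrix, Matrix.trace_add, Matrix.trace_smul, Matrix.trace_one, Matrix.trace_sum]
    refine add_le_add (by simp [mul_comm]) ?_
    calc _ ≤ ∑ k ∈ Finset.Ico 1 (T + 1), b ^ 2 := by
          refine Finset.sum_le_sum fun k hk => ?_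
          rw [Matrix.trace_vecMulVec]
          have h1 := hx k (by simp at hk ⊢; omega)
          have h2 : (x k).ofLp ⬝ᵥ (x k).ofLp = ‖x k‖ ^ 2 := by
            rw [EuclideanSpace.real_norm_sq_eq]; simp [dotProduct, sq]
          rw [h2]
          gcongr
      _ = _ := by simp
  rw [hV.1.det_eq_prod_eigenvalues]
  have htr2 := hV.1.trace_eq_sum_eigenvalues
  simp only [RCLike.ofReal_real_eq_id, id] at htr2 ⊢
  calc _ ≤ ∏ i : Fin d, (d * lam + T * b ^ 2) := by
        refine Finset.prod_le_prod (fun i _ => (hV.eigenvalues_pos i).le) fun i _ => ?_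
        refine le_trans ?_ htr
        rw [htr2]
        exact Finset.single_le_sum (f := hV.1.eigenvalues)
          (fun i _ => (hV.eigenvalues_pos i).le) (Finset.mem_univ i)
    _ = _ := by simp

/-- The elliptical potential lemma. -/
lemma sum_qnorm_inv_sq_le {lam : ℝ} (hlam : 0 < lam) (hd : 1 ≤ d)
    {x : ℕ → EuclideanSpace ℝ (Fin d)}
    {b : ℝ} {T : ℕ} (hx : ∀ t ∈ Finset.Icc 1 T, ‖x t‖ ≤ b) :
    ∑ t ∈ Finset.Icc 1 T, qnorm (designMatrix lam x t)⁻¹ (x t) ^ 2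
      ≤ (1 + b ^ 2 / lam) * (d * Real.log (d + T * b ^ 2 / lam)) := by
  have hlog : ∀ n : ℕ, ∑ t ∈ Finset.Icc 1 n, Real.log (1 + qnorm (designMatrix lam x t)⁻¹ (x t) ^ 2)
      = Real.log (designMatrix lam x (n + 1)).det - d * Real.log lam := by
    intro n
    induction n with
    | zero => simp [designMatrix, Real.log_pow]
    | succ n ih =>
      rw [Finset.sum_Icc_succ_top (by omega), ih, det_designMatrix_succ hlam x (t := n + 1) (by omega),
        Real.log_mul (designMatrix_posDef hlam x _).det_pos.ne' (by positivity)]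
      ring
  have hdet : Real.log (designMatrix lam x (T + 1)).det - d * Real.log lam
      ≤ d * Real.log (d + T * b ^ 2 / lam) := by
    have hpos : (0 : ℝ) < d * lam + T * b ^ 2 := by
      have : (0 : ℝ) < d := by exact_mod_cast hd
      positivity
    have h1 := Real.log_le_log (designMatrix_posDef hlam x _).det_pos (det_designMatrix_le hlam hx)
    rw [Real.log_pow] at h1
    have h2 : (d : ℝ) + T * b ^ 2 / lam = (d * lam + T * b ^ 2) / lam := by field_simp
    rw [h2, Real.log_div hpos.ne' hlam.ne']
    linarith
  calc _ ≤ ∑ t ∈ Finset.Icc 1 T, (1 + b ^ 2 / lam) *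
        Real.log (1 + qnorm (designMatrix lam x t)⁻¹ (x t) ^ 2) := by
        refine Finset.sum_le_sum fun t ht => ?_
        set z := qnorm (designMatrix lam x t)⁻¹ (x t) ^ 2 with hz
        have hz0 : 0 ≤ z := sq_nonneg _
        have hzb : z ≤ b ^ 2 / lam := (qnorm_inv_designMatrix_sq_le hlam x t _).trans (by
          have := hx t ht
          gcongr)
        -- Since 0 ≤ z ≤ b²/λ, the bound z/(1+z) ≤ log(1+z) yields z ≤ (1 + b²/λ) log(1+z), so z
        -- need not be truncated at 1.
        have h1 := Real.one_sub_inv_le_log_of_pos (x := 1 + z) (by positivity)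
        have h2 : 1 - (1 + z)⁻¹ = z / (1 + z) := by field_simp; ring
        rw [h2, div_le_iff₀ (by positivity)] at h1
        have h3 : 0 ≤ Real.log (1 + z) := Real.log_nonneg (by linarith)
        nlinarith
    _ = (1 + b ^ 2 / lam) * (Real.log (designMatrix lam x (T + 1)).det - d * Real.log lam) := by
        rw [← Finset.mul_sum, hlog]
    _ ≤ _ := by
        have : 0 ≤ b ^ 2 / lam := by positivity
        gcongr

lemma measurable_matrix_det {Ω : Type*} [MeasurableSpace Ω] {A : Ω → Matrix (Fin d) (Fin d) ℝ}
    (hA : ∀ i j, Measurable fun ω => A ω i j) : Measurable fun ω => (A ω).det := by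
  simp only [Matrix.det_apply]
  refine Finset.measurable_sum _ fun σ _ => Measurable.const_smul ?_ _
  exact Finset.measurable_prod _ fun i _ => hA _ _

/-- By Cramer's rule each entry is a quotient of determinants; singular matrices do no harm because
real inversion with 0⁻¹ = 0 is measurable. -/
lemma measurable_matrix_inv {Ω : Type*} [MeasurableSpace Ω] {A : Ω → Matrix (Fin d) (Fin d) ℝ}
    (hA : ∀ i j, Measurable fun ω => A ω i j) (i j : Fin d) :
    Measurable fun ω => (A ω)⁻¹ i j := by
  simp only [Matrix.inv_def, Ring.inverse_eq_inv', Matrix.smul_apply, Matrix.adjugate_apply]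
  refine (measurable_matrix_det hA).inv.smul (measurable_matrix_det fun k l => ?_)
  by_cases h : k = j
  · subst h; simp
  · simpa [Matrix.updateRow_ne h] using hA k l

lemma measurable_qnorm {Ω : Type*} [MeasurableSpace Ω] {A : Ω → Matrix (Fin d) (Fin d) ℝ}
    {u : Ω → EuclideanSpace ℝ (Fin d)}
    (hA : ∀ i j, Measurable fun ω => A ω i j) (hu : Measurable u) :
    Measurable fun ω => qnorm (A ω) (u ω) := by
  simp only [qnorm, Matrix.inner_toEuclideanCLM, dotProduct, Matrix.mulVec]
  have hu' : ∀ i, Measurable fun ω => u ω i := fun i => by fun_prop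
  refine Measurable.sqrt ?_
  refine Finset.measurable_sum _ fun i _ => (hu' i).mul ?_
  exact Finset.measurable_sum _ fun j _ => (hA i j).mul (hu' j)

lemma measurable_designMatrix {Ω : Type*} [MeasurableSpace Ω] (lam : ℝ)
    {x : Ω → ℕ → EuclideanSpace ℝ (Fin d)} {t : ℕ}
    (hx : ∀ k ∈ Finset.Ico 1 t, Measurable fun ω => x ω k) (i j : Fin d) :
    Measurable fun ω => designMatrix lam (x ω) t i j := by
  simp only [designMatrix, Matrix.add_apply, Matrix.sum_apply, Matrix.vecMulVec_apply]
  refine measurable_const.add (Finset.measurable_sum _ fun k hk => ?_)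
  have := hx k hk
  exact Measurable.mul (by fun_prop) (by fun_prop)

end LinearAlgebra

/-! ### Logistic loss and growth of the likelihood around the MLE. -/

section Logistic

/-- The logistic loss of the label `b` at the logit `z`. -/
def logLoss (b : Bool) (z : ℝ) : ℝ :=
  -(if b then Real.log (Real.sigmoid z) else Real.log (Real.sigmoid (-z)))

lemma negLogLik_eq_sum {d : ℕ} (x : ℕ → EuclideanSpace ℝ (Fin d)) (y : ℕ → Bool) (t : ℕ)
    (θ : EuclideanSpace ℝ (Fin d)) :
    negLogLik x y t θ = ∑ k ∈ Finset.Ico 1 t, logLoss (y k) ⟪θ, x k⟫ := by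
  simp [negLogLik, logLoss]

lemma hasDerivAt_logLoss (b : Bool) (z : ℝ) :
    HasDerivAt (logLoss b) (Real.sigmoid z - if b then 1 else 0) z := by
  cases b
  · have h1 : HasDerivAt (fun z => Real.sigmoid (-z))
        (Real.sigmoid (-z) * (1 - Real.sigmoid (-z)) * (-1)) z :=
      (Real.hasDerivAt_sigmoid (-z)).comp z (hasDerivAt_neg z)
    have h2 := (h1.log (Real.sigmoid_pos (-z)).ne').neg
    refine (h2.congr_deriv ?_).congr_of_eventuallyEq ?_
    · have := (Real.sigmoid_pos (-z)).ne'
      field_simp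
      rw [Real.sigmoid_neg]; simp
    · filter_upwards with w; simp [logLoss]
  · have h2 := ((Real.hasDerivAt_sigmoid z).log (Real.sigmoid_pos z).ne').neg
    refine (h2.congr_deriv ?_).congr_of_eventuallyEq ?_
    · have := (Real.sigmoid_pos z).ne'
      field_simp
      simp
    · filter_upwards with w; simp [logLoss]

lemma continuous_logLoss (b : Bool) : Continuous (logLoss b) :=
  continuous_iff_continuousAt.2 fun z => (hasDerivAt_logLoss b z).continuousAt

lemma abs_logLoss_sub_le (b : Bool) (z w : ℝ) : |logLoss b z - logLoss b w| ≤ |z - w| := by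
  have h := Convex.norm_image_sub_le_of_norm_hasDerivWithin_le (f := logLoss b)
    (f' := fun z => Real.sigmoid z - if b then 1 else 0) (C := 1) (s := Set.univ) (x := w) (y := z)
    (fun z _ => (hasDerivAt_logLoss b z).hasDerivWithinAt) (fun z _ => ?_) convex_univ
    (Set.mem_univ _) (Set.mem_univ _)
  · simpa using h
  · have h0 := Real.sigmoid_pos z
    have h1 := Real.sigmoid_lt_one z
    rw [Real.norm_eq_abs, abs_le]
    cases b <;> simp <;> constructor <;> linarith

/-- For either label the second derivative of the loss is σ' ≥ m on the interval, so subtracting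
(m/2)s² leaves a convex function; the claim is its midpoint inequality. -/
lemma logLoss_midpoint_le (b : Bool) {m R z w : ℝ}
    (hm : ∀ s ∈ Set.Icc (-R) R, m ≤ deriv Real.sigmoid s)
    (hz : z ∈ Set.Icc (-R) R) (hw : w ∈ Set.Icc (-R) R) :
    logLoss b ((z + w) / 2) ≤ (logLoss b z + logLoss b w) / 2 - m * (z - w) ^ 2 / 8 := by
  have hd1 : ∀ s, HasDerivAt (fun s => logLoss b s - m / 2 * s ^ 2)
      ((Real.sigmoid s - if b then 1 else 0) - m * s) s := fun s => by
    refine ((hasDerivAt_logLoss b s).sub ((hasDerivAt_pow 2 s).const_mul (m / 2))).congr_deriv ?_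
    ring
  have hderiv : deriv (fun s => logLoss b s - m / 2 * s ^ 2)
      = fun s => (Real.sigmoid s - if b then 1 else 0) - m * s := funext fun s => (hd1 s).deriv
  have hd2 : ∀ s, HasDerivAt (fun s => (Real.sigmoid s - if b then (1 : ℝ) else 0) - m * s)
      (deriv Real.sigmoid s - m) s := fun s => by
    have h := (differentiableAt_sigmoid (x := s)).hasDerivAt
    refine ((h.sub_const _).sub ((hasDerivAt_id s).const_mul m)).congr_deriv (by ring)
  have hconv : ConvexOn ℝ (Set.Icc (-R) R) (fun s => logLoss b s - m / 2 * s ^ 2) := by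
    refine convexOn_of_deriv2_nonneg (convex_Icc _ _)
      (fun s _ => (hd1 s).continuousAt.continuousWithinAt)
      (fun s _ => (hd1 s).differentiableAt.differentiableWithinAt) ?_ ?_
    · rw [hderiv]
      exact fun s _ => (hd2 s).differentiableAt.differentiableWithinAt
    · intro s hs
      have : deriv^[2] (fun s => logLoss b s - m / 2 * s ^ 2) s = deriv Real.sigmoid s - m := by
        rw [Function.iterate_succ, Function.comp_apply, Function.iterate_one, hderiv, (hd2 s).deriv]
      rw [this]
      linarith [hm s (interior_subset hs)]
  have h := hconv.2 hz hw (by norm_num : (0 : ℝ) ≤ 1 / 2) (by norm_num : (0 : ℝ) ≤ 1 / 2)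
    (by norm_num)
  simp only [smul_eq_mul] at h
  have e : (1 / 2 : ℝ) * z + 1 / 2 * w = (z + w) / 2 := by ring
  rw [e] at h
  nlinarith

/-- A constrained minimizer of the negative log-likelihood has a quadratic excess-risk bound. -/
lemma mle_quadratic_growth {d : ℕ} {x : ℕ → EuclideanSpace ℝ (Fin d)} {y : ℕ → Bool} {t : ℕ}
    {B b m : ℝ} (hx : ∀ k ∈ Finset.Ico 1 t, ‖x k‖ ≤ b)
    (hm : ∀ s ∈ Set.Icc (-(B * b)) (B * b), m ≤ deriv Real.sigmoid s)
    {θ θh : EuclideanSpace ℝ (Fin d)} (hθ : θ ∈ Metric.closedBall 0 B)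
    (hθh : θh ∈ Metric.closedBall 0 B) (hmin : IsMinOn (negLogLik x y t) (Metric.closedBall 0 B) θh) :
    m / 4 * ∑ k ∈ Finset.Ico 1 t, ⟪θ - θh, x k⟫ ^ 2 ≤ negLogLik x y t θ - negLogLik x y t θh := by
  -- The midpoint is feasible, so comparing θh with it replaces a first-order optimality condition;
  -- the price is m/4 instead of m/2.
  have hmid : (1 / 2 : ℝ) • θ + (1 / 2 : ℝ) • θh ∈ Metric.closedBall 0 B :=
    (convex_closedBall 0 B) hθ hθh (by norm_num) (by norm_num) (by norm_num)
  have h1 := hmin hmid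
  have hb : ∀ θ' ∈ Metric.closedBall (0 : EuclideanSpace ℝ (Fin d)) B, ∀ k ∈ Finset.Ico 1 t,
      ⟪θ', x k⟫ ∈ Set.Icc (-(B * b)) (B * b) := fun θ' hθ' k hk => by
    rw [Set.mem_Icc, ← abs_le]
    rw [mem_closedBall_zero_iff] at hθ'
    exact (abs_real_inner_le_norm _ _).trans
      (mul_le_mul hθ' (hx k hk) (norm_nonneg _) ((norm_nonneg _).trans hθ'))
  have h2 : negLogLik x y t ((1 / 2 : ℝ) • θ + (1 / 2 : ℝ) • θh)
      ≤ (negLogLik x y t θ + negLogLik x y t θh) / 2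
        - m / 8 * ∑ k ∈ Finset.Ico 1 t, ⟪θ - θh, x k⟫ ^ 2 := by
    rw [negLogLik_eq_sum, negLogLik_eq_sum, negLogLik_eq_sum, ← Finset.sum_add_distrib,
      Finset.sum_div, Finset.mul_sum, ← Finset.sum_sub_distrib]
    refine Finset.sum_le_sum fun k hk => ?_
    have h3 := logLoss_midpoint_le (y k) hm (hb θ hθ k hk) (hb θh hθh k hk)
    have e1 : ⟪(1 / 2 : ℝ) • θ + (1 / 2 : ℝ) • θh, x k⟫ = (⟪θ, x k⟫ + ⟪θh, x k⟫) / 2 := by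
      rw [inner_add_left, real_inner_smul_left, real_inner_smul_left]; ring
    rw [e1, inner_sub_left]
    linarith
  have h3 : negLogLik x y t θh ≤ negLogLik x y t ((1 / 2 : ℝ) • θ + (1 / 2 : ℝ) • θh) := h1
  linarith

lemma abs_negLogLik_sub_le {d : ℕ} {x : ℕ → EuclideanSpace ℝ (Fin d)} {y : ℕ → Bool} {t : ℕ}
    {b : ℝ} (hx : ∀ k ∈ Finset.Ico 1 t, ‖x k‖ ≤ b) (θ θ' : EuclideanSpace ℝ (Fin d)) :
    |negLogLik x y t θ - negLogLik x y t θ'| ≤ ((t - 1 : ℕ) : ℝ) * b * ‖θ - θ'‖ := by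
  rw [negLogLik_eq_sum, negLogLik_eq_sum, ← Finset.sum_sub_distrib]
  refine (Finset.abs_sum_le_sum_abs _ _).trans ?_
  calc _ ≤ ∑ k ∈ Finset.Ico 1 t, b * ‖θ - θ'‖ := by
        refine Finset.sum_le_sum fun k hk => (abs_logLoss_sub_le _ _ _).trans ?_
        rw [← inner_sub_left, mul_comm]
        refine (abs_real_inner_le_norm _ _).trans ?_
        gcongr
        exact hx k hk
    _ = _ := by simp; ring

end Logistic

/-! ### The curvature constant κ. -/

section Kappa

variable {S A : Type*} [MeasurableSpace S] [MeasurableSpace A] {d : ℕ} (M : MDP S A d)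

lemma one_le_horizon : 1 ≤ horizon M := by
  have h1 := M.disc_pos
  have h2 := M.disc_lt_one
  exact (one_le_inv₀ (by linarith)).2 (by linarith)

lemma deriv_sigmoid_pos (z : ℝ) : 0 < deriv Real.sigmoid z := by
  rw [Real.deriv_sigmoid]
  exact mul_pos (Real.sigmoid_pos z) (by linarith [Real.sigmoid_lt_one z])

/-- Continuity on a compact set. Without boundedness the `sSup` in `kappa` would take its default
value 0. -/
lemma bddAbove_kappa (B L : ℝ) :
    BddAbove ((fun q : EuclideanSpace ℝ (Fin d) × EuclideanSpace ℝ (Fin d) =>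
      1 / deriv Real.sigmoid ⟪q.1, q.2⟫) ''
    (Metric.closedBall 0 B ×ˢ Metric.closedBall 0 (2 * L * horizon M))) := by
  refine IsCompact.bddAbove (IsCompact.image
    ((isCompact_closedBall _ _).prod (isCompact_closedBall _ _)) ?_)
  refine Continuous.div continuous_const ?_ fun q => (deriv_sigmoid_pos _).ne'
  rw [Real.deriv_sigmoid]
  have : Continuous Real.sigmoid := continuous_sigmoid
  fun_prop

lemma le_kappa {B L : ℝ} {θ x : EuclideanSpace ℝ (Fin d)} (hθ : ‖θ‖ ≤ B)
    (hx : ‖x‖ ≤ 2 * L * horizon M) : 1 / deriv Real.sigmoid ⟪θ, x⟫ ≤ kappa M B L :=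
  le_csSup (bddAbove_kappa M B L) ⟨(θ, x), by simpa using ⟨hθ, hx⟩, rfl⟩

lemma four_le_kappa {B L : ℝ} (hB : 0 ≤ B) (hL : 0 ≤ L) : 4 ≤ kappa M B L := by
  have hH := one_le_horizon M
  have h := le_kappa M (B := B) (L := L) (θ := 0) (x := 0) (by simpa) (by simp; positivity)
  refine le_trans (le_of_eq ?_) h
  rw [Real.deriv_sigmoid]
  norm_num [Real.sigmoid_zero]

/-- Every z in the interval is ⟨θ, x⟩ for admissible θ and x on one coordinate line, which exists
because d ≥ 1. For B = 0 only z = 0 occurs, and it is treated apart to avoid dividing by B. -/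
lemma inv_kappa_le_deriv_sigmoid {B L : ℝ} (hd : 1 ≤ d) (hB : 0 ≤ B) (hL : 0 ≤ L) {z : ℝ}
    (hz : z ∈ Set.Icc (-(B * (2 * L * horizon M))) (B * (2 * L * horizon M))) :
    (kappa M B L)⁻¹ ≤ deriv Real.sigmoid z := by
  have hH := one_le_horizon M
  have : NeZero d := ⟨by omega⟩
  set e : EuclideanSpace ℝ (Fin d) := EuclideanSpace.single 0 1 with he
  have hne : ‖e‖ = 1 := by simp [he]
  have key : ∃ θ x : EuclideanSpace ℝ (Fin d), ‖θ‖ ≤ B ∧ ‖x‖ ≤ 2 * L * horizon M ∧ ⟪θ, x⟫ = z := by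
    rw [Set.mem_Icc, ← abs_le] at hz
    rcases hB.eq_or_lt with rfl | hB
    · refine ⟨0, 0, by simp, by simp; positivity, ?_⟩
      rw [zero_mul, abs_nonpos_iff] at hz
      simp [hz]
    · refine ⟨B • e, (z / B) • e, ?_, ?_, ?_⟩
      · rw [norm_smul, hne, Real.norm_of_nonneg hB.le, mul_one]
      · rw [norm_smul, hne, Real.norm_eq_abs, abs_div, abs_of_pos hB, mul_one, div_le_iff₀ hB]
        linarith
      · rw [real_inner_smul_left, real_inner_smul_right, real_inner_self_eq_norm_sq, hne]
        field_simp
  obtain ⟨θ, x, h1, h2, rfl⟩ := key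
  have h3 := le_kappa M h1 h2
  rw [inv_le_comm₀ (by linarith [four_le_kappa M hB hL]) (deriv_sigmoid_pos _)]
  simpa using h3

end Kappa

/-! ### Disintegration along conditional laws. -/

section CondLaw

/-- On rectangles the hypothesis identifies the joint law of (p, Y) with the law of p followed by K,
and rectangles determine a finite measure. -/
lemma lintegral_eq_of_disintegration {Ω Ω' X : Type*} [MeasurableSpace Ω] [MeasurableSpace Ω']
    [MeasurableSpace X] {μ : Measure Ω} [IsProbabilityMeasure μ] {p : Ω → Ω'} (hp : Measurable p)
    {Y : Ω → X} (hY : Measurable Y) {K : Kernel Ω' X} [IsMarkovKernel K]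
    (h : ∀ s, MeasurableSet s → ∀ E, MeasurableSet E →
      μ (p ⁻¹' s ∩ Y ⁻¹' E) = ∫⁻ ω in p ⁻¹' s, K (p ω) E ∂μ)
    {f : Ω' → X → ℝ≥0∞} (hf : Measurable (Function.uncurry f)) :
    ∫⁻ ω, f (p ω) (Y ω) ∂μ = ∫⁻ ω, ∫⁻ y, f (p ω) y ∂(K (p ω)) ∂μ := by
  have hprob : IsProbabilityMeasure (μ.map p) := Measure.isProbabilityMeasure_map hp.aemeasurable
  have e1 : μ.map (fun ω => (p ω, Y ω)) = (μ.map p) ⊗ₘ K := by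
    refine Measure.ext_prod fun {s E} hs hE => ?_
    rw [Measure.map_apply (hp.prodMk hY) (hs.prod hE), Measure.compProd_apply_prod hs hE,
      setLIntegral_map hs (Kernel.measurable_coe K hE) hp, ← h s hs E hE]
    rfl
  calc ∫⁻ ω, f (p ω) (Y ω) ∂μ
      = ∫⁻ q, Function.uncurry f q ∂(μ.map (fun ω => (p ω, Y ω))) := by
        rw [lintegral_map hf (hp.prodMk hY)]; rfl
    _ = ∫⁻ ω, ∫⁻ y, f ω y ∂(K ω) ∂(μ.map p) := by
        rw [e1, Measure.lintegral_compProd hf]; rfl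
    _ = _ := lintegral_map hf.lintegral_kernel_prod_right hp

variable {Ω X : Type*} {m : MeasurableSpace Ω} [mΩ : MeasurableSpace Ω] [MeasurableSpace X]
  {μ : Measure Ω}

/-- The disintegration formula for a conditional law. -/
lemma HasCondLaw.lintegral_eq [IsProbabilityMeasure μ] (hm : m ≤ mΩ)
    {Y : Ω → X} (hY : Measurable Y) {κ : Ω → Measure X} (hκ : ∀ ω, IsProbabilityMeasure (κ ω))
    (h : HasCondLaw μ m Y κ) {f : Ω → X → ℝ≥0∞}
    (hf : Measurable[m.prod inferInstance] (Function.uncurry f)) :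
    ∫⁻ ω, f ω (Y ω) ∂μ = ∫⁻ ω, ∫⁻ y, f ω y ∂(κ ω) ∂μ :=
  -- The conditioning variable is the identity from Ω to Ω with the smaller σ-algebra m; over m, κ
  -- is a genuine kernel.
  @lintegral_eq_of_disintegration Ω Ω X mΩ m _ μ _ id (measurable_id'' hm) Y hY
    (@Kernel.mk Ω X m _ κ h.1) (@IsMarkovKernel.mk Ω X m _ (@Kernel.mk Ω X m _ κ h.1) hκ)
    (fun s hs E hE => h.2 s hs E hE) f hf

end CondLaw

/-! ### Ville's inequality and multiplicative concentration. -/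

section Supermartingale

variable {Ω : Type*} [mΩ : MeasurableSpace Ω] {μ : Measure Ω}

/-- Products of conditionally sub-unit factors have expectation at most one. -/
lemma lintegral_prod_le_one [IsProbabilityMeasure μ] (ℱ : Filtration ℕ mΩ) {h : ℕ → Ω → ℝ≥0∞}
    {T : ℕ} (hmeas : ∀ t ∈ Finset.Icc 1 T, Measurable[ℱ t] (h t))
    (hstep : ∀ t ∈ Finset.Icc 1 T, ∀ f : Ω → ℝ≥0∞, Measurable[ℱ (t - 1)] f →
      ∫⁻ ω, f ω * h t ω ∂μ ≤ ∫⁻ ω, f ω ∂μ) :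
    ∫⁻ ω, ∏ t ∈ Finset.Icc 1 T, h t ω ∂μ ≤ 1 := by
  have key : ∀ n ≤ T, Measurable[ℱ n] (fun ω => ∏ t ∈ Finset.Icc 1 n, h t ω) ∧
      ∫⁻ ω, ∏ t ∈ Finset.Icc 1 n, h t ω ∂μ ≤ 1 := by
    intro n
    induction n with
    | zero => intro _; simp
    | succ n ih =>
      intro hn
      obtain ⟨h1, h2⟩ := ih (by omega)
      have e : ∀ ω, ∏ t ∈ Finset.Icc 1 (n + 1), h t ω
          = (∏ t ∈ Finset.Icc 1 n, h t ω) * h (n + 1) ω :=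
        fun ω => Finset.prod_Icc_succ_top (by omega) _
      simp only [e]
      have hmem : n + 1 ∈ Finset.Icc 1 T := by simp; omega
      refine ⟨(h1.mono (ℱ.mono (Nat.le_succ n)) le_rfl).mul (hmeas _ hmem), ?_⟩
      exact (hstep _ hmem _ h1).trans h2
  exact (key T le_rfl).2

/-- Ville's inequality in finite time. -/
lemma ville_inequality [IsProbabilityMeasure μ] (ℱ : Filtration ℕ mΩ) {Z : ℕ → Ω → ℝ≥0∞}
    {N : ℕ} (hmeas : ∀ t ≤ N, Measurable[ℱ t] (Z t)) (h0 : ∫⁻ ω, Z 0 ω ∂μ ≤ 1)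
    (hstep : ∀ t < N, ∀ s, MeasurableSet[ℱ t] s → ∫⁻ ω in s, Z (t + 1) ω ∂μ ≤ ∫⁻ ω in s, Z t ω ∂μ)
    (a : ℝ≥0∞) : a * μ {ω | ∃ t ≤ N, a ≤ Z t ω} ≤ 1 := by
  -- The invariant is a bound on the stopped process: mass that has crossed the level a is frozen at
  -- a, the rest still carries Z n.
  have key : ∀ n ≤ N, MeasurableSet[ℱ n] {ω | ∃ t ≤ n, a ≤ Z t ω} ∧
      a * μ {ω | ∃ t ≤ n, a ≤ Z t ω} + ∫⁻ ω in {ω | ∃ t ≤ n, a ≤ Z t ω}ᶜ, Z n ω ∂μ ≤ 1 := by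
    intro n
    induction n with
    | zero =>
      intro _
      have e : {ω | ∃ t ≤ 0, a ≤ Z t ω} = {ω | a ≤ Z 0 ω} := by ext; simp
      have hm : MeasurableSet[ℱ 0] {ω | a ≤ Z 0 ω} :=
        @measurableSet_le _ _ _ _ _ (ℱ 0) _ _ _ _ _ measurable_const (hmeas 0 (by omega))
      rw [e]
      refine ⟨hm, le_trans ?_ h0⟩
      have hm' := ℱ.le 0 _ hm
      rw [← lintegral_add_compl (μ := μ) (Z 0) hm']
      refine add_le_add ?_ (le_refl (∫⁻ ω in {ω | a ≤ Z 0 ω}ᶜ, Z 0 ω ∂μ))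
      rw [← setLIntegral_const]
      exact setLIntegral_mono' hm' fun ω hω => hω
    | succ n ih =>
      intro hn
      obtain ⟨h1, h2⟩ := ih (by omega)
      set An := {ω | ∃ t ≤ n, a ≤ Z t ω} with hAn
      have e : {ω | ∃ t ≤ n + 1, a ≤ Z t ω} = An ∪ (Anᶜ ∩ {ω | a ≤ Z (n + 1) ω}) := by
        ext ω
        simp only [hAn, Set.mem_ofPred_eq, Set.mem_union, Set.mem_inter_iff, Set.mem_compl_iff]
        constructor
        · rintro ⟨t, ht, h⟩
          by_cases hc : ∃ t ≤ n, a ≤ Z t ω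
          · exact Or.inl hc
          · refine Or.inr ⟨hc, ?_⟩
            rcases Nat.lt_or_ge n t with h' | h'
            · obtain rfl : t = n + 1 := by omega
              exact h
            · exact absurd ⟨t, h', h⟩ hc
        · rintro (⟨t, ht, h⟩ | ⟨-, h⟩)
          · exact ⟨t, by omega, h⟩
          · exact ⟨n + 1, le_rfl, h⟩
      have h1' : MeasurableSet[ℱ (n + 1)] An := ℱ.mono (Nat.le_succ n) _ h1
      have hB : MeasurableSet[ℱ (n + 1)] {ω | a ≤ Z (n + 1) ω} :=
        @measurableSet_le _ _ _ _ _ (ℱ (n + 1)) _ _ _ _ _ measurable_const (hmeas _ hn)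
      have hAm := ℱ.le _ _ h1
      have hBm := ℱ.le _ _ hB
      rw [e]
      refine ⟨h1'.union (h1'.compl.inter hB), le_trans ?_ h2⟩
      have hs := hstep n (by omega) _ h1.compl
      have hcompl : (An ∪ (Anᶜ ∩ {ω | a ≤ Z (n + 1) ω}))ᶜ = Anᶜ ∩ {ω | a ≤ Z (n + 1) ω}ᶜ := by
        ext ω; simp only [Set.mem_compl_iff, Set.mem_union, Set.mem_inter_iff]; tauto
      rw [hcompl]
      calc _ ≤ a * (μ An + μ (Anᶜ ∩ {ω | a ≤ Z (n + 1) ω}))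
            + ∫⁻ ω in Anᶜ ∩ {ω | a ≤ Z (n + 1) ω}ᶜ, Z (n + 1) ω ∂μ := by
            gcongr; exact measure_union_le _ _
        _ = a * μ An + (a * μ (Anᶜ ∩ {ω | a ≤ Z (n + 1) ω})
            + ∫⁻ ω in Anᶜ ∩ {ω | a ≤ Z (n + 1) ω}ᶜ, Z (n + 1) ω ∂μ) := by ring
        _ ≤ a * μ An + (∫⁻ ω in Anᶜ ∩ {ω | a ≤ Z (n + 1) ω}, Z (n + 1) ω ∂μ
            + ∫⁻ ω in Anᶜ ∩ {ω | a ≤ Z (n + 1) ω}ᶜ, Z (n + 1) ω ∂μ) := by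
            gcongr
            rw [← setLIntegral_const]
            exact setLIntegral_mono' (hAm.compl.inter hBm) fun ω hω => hω.2
        _ = a * μ An + ∫⁻ ω in Anᶜ, Z (n + 1) ω ∂μ := by
            rw [← Set.sdiff_eq, lintegral_inter_add_sdiff _ _ hBm]
        _ ≤ _ := by gcongr
  exact le_self_add.trans (key N le_rfl).2

/-- On [-1, 0] the exponential lies below its chord, and e⁻¹ ≤ 1/2. -/
lemma exp_neg_le_one_sub_half {z : ℝ} (h0 : 0 ≤ z) (h1 : z ≤ 1) : Real.exp (-z) ≤ 1 - z / 2 := by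
  have h := convexOn_exp.2 (Set.mem_univ (0 : ℝ)) (Set.mem_univ (-1 : ℝ))
    (sub_nonneg.2 h1) h0 (by ring)
  simp only [smul_eq_mul, mul_zero, Real.exp_zero, mul_one, zero_add, mul_neg] at h
  have he : Real.exp (-1) ≤ 1 / 2 := by
    rw [Real.exp_neg, one_div]
    exact inv_anti₀ (by norm_num) (by linarith [Real.add_one_le_exp (1 : ℝ)])
  nlinarith

/-- If `W_t` is at most the conditional expectation of `g_t(ω, Y_t) ∈ [0, b]`, then with
probability `1 - δ` the sum of the `W_t` is at most twice the realized sum plus `2 b log (1 / δ)`. -/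
lemma measure_sum_condExp_le [IsProbabilityMeasure μ] (ℱ : Filtration ℕ mΩ) {T : ℕ}
    {X : Type*} [MeasurableSpace X] {m : ℕ → MeasurableSpace Ω} {Y : ℕ → Ω → X}
    {κ : ℕ → Ω → Measure X} {g : ℕ → Ω → X → ℝ} {W : ℕ → Ω → ℝ} {b δ : ℝ}
    (hle : ∀ t ∈ Finset.Icc 1 T, ℱ (t - 1) ≤ m t) (hle' : ∀ t ∈ Finset.Icc 1 T, m t ≤ ℱ t)
    (hY : ∀ t ∈ Finset.Icc 1 T, Measurable[ℱ t] (Y t))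
    (hκ : ∀ t ∈ Finset.Icc 1 T, ∀ ω, IsProbabilityMeasure (κ t ω))
    (hlaw : ∀ t ∈ Finset.Icc 1 T, HasCondLaw μ (m t) (Y t) (κ t))
    (hg : ∀ t ∈ Finset.Icc 1 T, Measurable[(m t).prod inferInstance] (Function.uncurry (g t)))
    (hg0 : ∀ t ∈ Finset.Icc 1 T, ∀ ω y, 0 ≤ g t ω y)
    (hgb : ∀ t ∈ Finset.Icc 1 T, ∀ ω y, g t ω y ≤ b)
    (hWm : ∀ t ∈ Finset.Icc 1 T, Measurable[m t] (W t))
    (hW : ∀ t ∈ Finset.Icc 1 T, ∀ ω, W t ω ≤ ∫ y, g t ω y ∂(κ t ω))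
    (hb : 0 < b) (hδ : 0 < δ) :
    μ {ω | 2 * ∑ t ∈ Finset.Icc 1 T, g t ω (Y t ω) + 2 * b * Real.log (1 / δ)
        < ∑ t ∈ Finset.Icc 1 T, W t ω} ≤ ENNReal.ofReal δ := by
  -- The factor exp(W/(2b) - g/b) has conditional mean at most 1: E e^{-g/b} ≤ 1 - E g/(2b) ≤ 1 -
  -- W/(2b) ≤ e^{-W/(2b)}. Markov's inequality for the product then costs only a factor 2 and a
  -- logarithm, with no √T term.
  set h : ℕ → Ω → ℝ≥0∞ := fun t ω =>
    ENNReal.ofReal (Real.exp (W t ω / (2 * b))) * ENNReal.ofReal (Real.exp (-(g t ω (Y t ω) / b)))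
    with hh
  have hgY : ∀ t ∈ Finset.Icc 1 T, Measurable[ℱ t] fun ω => g t ω (Y t ω) := fun t ht =>
    (hg t ht).comp ((measurable_id'' (hle' t ht)).prodMk (hY t ht))
  have hWt : ∀ t ∈ Finset.Icc 1 T, Measurable[ℱ t] (W t) := fun t ht =>
    (hWm t ht).mono (hle' t ht) le_rfl
  have hprod := lintegral_prod_le_one (μ := μ) ℱ (h := h) (T := T) (fun t ht => by
      have h1 := hgY t ht
      have h2 := hWt t ht
      exact ((h2.div_const _).exp.ennreal_ofReal).mul ((h1.div_const b).neg.exp.ennreal_ofReal))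
    (fun t ht f hf => by
      have hfm : Measurable[m t] f := hf.mono (hle t ht) le_rfl
      have hmΩ : m t ≤ mΩ := (hle' t ht).trans (ℱ.le t)
      set F : Ω → X → ℝ≥0∞ := fun ω y => (f ω * ENNReal.ofReal (Real.exp (W t ω / (2 * b)))) *
        ENNReal.ofReal (Real.exp (-(g t ω y / b))) with hF
      have hFm : Measurable[(m t).prod inferInstance] (Function.uncurry F) := by
        refine Measurable.mul ?_ (((hg t ht).div_const b).neg.exp.ennreal_ofReal)
        exact (hfm.mul (((hWm t ht).div_const _).exp.ennreal_ofReal)).comp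
          (@measurable_fst _ _ (m t) _)
      calc ∫⁻ ω, f ω * h t ω ∂μ = ∫⁻ ω, F ω (Y t ω) ∂μ := by
            simp only [hh, hF, mul_assoc]
        _ = ∫⁻ ω, ∫⁻ y, F ω y ∂(κ t ω) ∂μ :=
            (hlaw t ht).lintegral_eq hmΩ ((hY t ht).mono (ℱ.le t) le_rfl) (hκ t ht) hFm
        _ ≤ ∫⁻ ω, f ω ∂μ := by
            refine lintegral_mono fun ω => ?_
            have := hκ t ht ω
            have hgω : Measurable (g t ω) :=
              (hg t ht).comp (@measurable_prodMk_left Ω X (m t) _ ω)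
            have hint : Integrable (g t ω) (κ t ω) :=
              Integrable.of_bound hgω.aestronglyMeasurable b (Filter.Eventually.of_forall fun y => by
                rw [Real.norm_of_nonneg (hg0 t ht ω y)]; exact hgb t ht ω y)
            have e1 : ∫⁻ y, ENNReal.ofReal (Real.exp (-(g t ω y / b))) ∂(κ t ω)
                ≤ ENNReal.ofReal (Real.exp (-(W t ω / (2 * b)))) := by
              calc _ ≤ ∫⁻ y, ENNReal.ofReal (1 - g t ω y / b / 2) ∂(κ t ω) := by
                    refine lintegral_mono fun y => ENNReal.ofReal_le_ofReal ?_
                    exact exp_neg_le_one_sub_half (div_nonneg (hg0 t ht ω y) hb.le)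
                      ((div_le_one hb).2 (hgb t ht ω y))
                _ = ENNReal.ofReal (∫ y, (1 - g t ω y / b / 2) ∂(κ t ω)) := by
                    refine (ofReal_integral_eq_lintegral_ofReal ?_ ?_).symm
                    · exact (integrable_const _).sub ((hint.div_const _).div_const _)
                    · refine Filter.Eventually.of_forall fun y => ?_
                      have : g t ω y / b ≤ 1 := (div_le_one hb).2 (hgb t ht ω y)
                      simp only [Pi.zero_apply]; linarith
                _ ≤ _ := by
                    refine ENNReal.ofReal_le_ofReal ?_
                    rw [integral_sub (integrable_const _) ((hint.div_const _).div_const _),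
                      integral_div, integral_div]
                    simp only [integral_const, probReal_univ, smul_eq_mul, mul_one]
                    have h1 := Real.one_sub_le_exp_neg (W t ω / (2 * b))
                    refine le_trans ?_ h1
                    have h2 := hW t ht ω
                    have h3 : (∫ y, g t ω y ∂(κ t ω)) / b / 2 = (∫ y, g t ω y ∂(κ t ω)) / (2 * b) := by
                      rw [div_div, mul_comm]
                    rw [h3]
                    gcongr
            calc ∫⁻ y, F ω y ∂(κ t ω)
                = (f ω * ENNReal.ofReal (Real.exp (W t ω / (2 * b)))) *
                  ∫⁻ y, ENNReal.ofReal (Real.exp (-(g t ω y / b))) ∂(κ t ω) := by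
                  rw [lintegral_const_mul]
                  exact ((hgω.div_const b).neg.exp.ennreal_ofReal)
              _ ≤ (f ω * ENNReal.ofReal (Real.exp (W t ω / (2 * b)))) *
                  ENNReal.ofReal (Real.exp (-(W t ω / (2 * b)))) := by gcongr
              _ = f ω := by
                  rw [mul_assoc, ← ENNReal.ofReal_mul (Real.exp_nonneg _), ← Real.exp_add]
                  simp)
  have hprod_eq : ∀ ω, ∏ t ∈ Finset.Icc 1 T, h t ω = ENNReal.ofReal
      (Real.exp ((∑ t ∈ Finset.Icc 1 T, W t ω) / (2 * b)
        - (∑ t ∈ Finset.Icc 1 T, g t ω (Y t ω)) / b)) := by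
    intro ω
    rw [Finset.sum_div, Finset.sum_div, ← Finset.sum_sub_distrib, Real.exp_sum,
      ENNReal.ofReal_prod_of_nonneg fun _ _ => Real.exp_nonneg _]
    refine Finset.prod_congr rfl fun t _ => ?_
    rw [hh]
    simp only
    rw [← ENNReal.ofReal_mul (Real.exp_nonneg _), ← Real.exp_add, sub_eq_add_neg]
  simp only [hprod_eq] at hprod
  have hmeasE : Measurable fun ω => ENNReal.ofReal
      (Real.exp ((∑ t ∈ Finset.Icc 1 T, W t ω) / (2 * b)
        - (∑ t ∈ Finset.Icc 1 T, g t ω (Y t ω)) / b)) := by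
    have h1 : Measurable fun ω => ∑ t ∈ Finset.Icc 1 T, W t ω :=
      Finset.measurable_sum _ fun t ht => (hWt t ht).mono (ℱ.le t) le_rfl
    have h2 : Measurable fun ω => ∑ t ∈ Finset.Icc 1 T, g t ω (Y t ω) :=
      Finset.measurable_sum _ fun t ht => (hgY t ht).mono (ℱ.le t) le_rfl
    exact ((h1.div_const _).sub (h2.div_const _)).exp.ennreal_ofReal
  have hmarkov := mul_meas_ge_le_lintegral hmeasE (ENNReal.ofReal (1 / δ)) (μ := μ)
  have h3 := hmarkov.trans hprod
  have h4 : μ {ω | ENNReal.ofReal (1 / δ) ≤ ENNReal.ofReal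
      (Real.exp ((∑ t ∈ Finset.Icc 1 T, W t ω) / (2 * b)
        - (∑ t ∈ Finset.Icc 1 T, g t ω (Y t ω)) / b))} ≤ ENNReal.ofReal δ := by
    rw [mul_comm] at h3
    have h5 := ENNReal.le_div_iff_mul_le (Or.inl (by simpa using hδ)) (Or.inl ENNReal.ofReal_ne_top)
      |>.2 h3
    have e : 1 / ENNReal.ofReal (1 / δ) = ENNReal.ofReal δ := by
      rw [one_div, one_div, ENNReal.ofReal_inv_of_pos hδ, inv_inv]
    rwa [e] at h5
  refine le_trans (measure_mono fun ω hω => ?_) h4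
  simp only [Set.mem_ofPred_eq] at hω ⊢
  refine ENNReal.ofReal_le_ofReal ?_
  rw [← Real.log_le_iff_le_exp (by positivity)]
  have e : (∑ t ∈ Finset.Icc 1 T, W t ω) / (2 * b) - (∑ t ∈ Finset.Icc 1 T, g t ω (Y t ω)) / b
      = (∑ t ∈ Finset.Icc 1 T, W t ω - 2 * ∑ t ∈ Finset.Icc 1 T, g t ω (Y t ω)) / (2 * b) := by
    field_simp
  rw [e, le_div_iff₀ (by positivity)]
  linarith

end Supermartingale

/-! ### Tails and anti-concentration of the Gaussian sample. -/

section Gaussian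

lemma gaussianReal_tail {r : ℝ} (hr : 0 ≤ r) :
    gaussianReal 0 1 {z | r ≤ |z|} ≤ ENNReal.ofReal (2 * Real.exp (-r ^ 2 / 2)) := by
  have hsub : HasSubgaussianMGF (id : ℝ → ℝ) 1 (gaussianReal 0 1) :=
    { integrable_exp_mul := fun t => integrable_exp_mul_gaussianReal t
      mgf_le := fun t => by rw [mgf_id_gaussianReal]; simp }
  have h1 := hsub.measure_ge_le hr
  have h2 := hsub.neg.measure_ge_le hr
  have hsubset : {z : ℝ | r ≤ |z|} ⊆ {z | r ≤ id z} ∪ {z | r ≤ (-id) z} := fun z hz => by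
    rcases le_abs.1 (show r ≤ |z| from hz) with h | h
    · exact Or.inl h
    · exact Or.inr h
  rw [← ofReal_measureReal]
  refine ENNReal.ofReal_le_ofReal ((measureReal_mono hsubset).trans
    ((measureReal_union_le _ _).trans ?_))
  simp only [NNReal.coe_one, mul_one] at h1 h2
  linarith

variable {d : ℕ}

lemma map_inner_multivariateGaussian {S : Matrix (Fin d) (Fin d) ℝ} (hS : S.PosSemidef)
    (m u : EuclideanSpace ℝ (Fin d)) :
    (multivariateGaussian m S).map (fun x => ⟪u, x⟫)
      = gaussianReal ⟪u, m⟫ (⟪u, Matrix.toEuclideanCLM (𝕜 := ℝ) S u⟫).toNNReal := by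
  have h := IsGaussian.map_eq_gaussianReal (μ := multivariateGaussian m S) (innerSL ℝ u)
  have h3 : ∫ x, innerSL ℝ u x ∂(multivariateGaussian m S) = ⟪u, m⟫ := by
    rw [ContinuousLinearMap.integral_comp_id_comm IsGaussian.integrable_id,
      integral_id_multivariateGaussian]
    rfl
  rw [h3] at h
  have h2 := covarianceBilin_multivariateGaussian (μ := m) hS u u
  rw [covarianceBilin_self IsGaussian.memLp_two_id] at h2
  rw [Matrix.inner_toEuclideanCLM, ← h2]
  simpa using h

/-- Along u the centred sample is a scalar Gaussian of standard deviation β‖u‖ in the norm of V⁻¹;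
this form also covers zero variance. -/
lemma map_inner_sub_multivariateGaussian {V : Matrix (Fin d) (Fin d) ℝ} (hV : V.PosDef)
    (β : ℝ) (m u : EuclideanSpace ℝ (Fin d)) :
    (multivariateGaussian m (β ^ 2 • V⁻¹)).map (fun x => ⟪u, x - m⟫)
      = (gaussianReal 0 1).map (fun z => β * qnorm V⁻¹ u * z) := by
  have hS : (β ^ 2 • V⁻¹).PosSemidef := hV.inv.posSemidef.smul (sq_nonneg β)
  have h1 := map_inner_multivariateGaussian hS m u
  have e : (fun x : EuclideanSpace ℝ (Fin d) => ⟪u, x - m⟫)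
      = (fun z : ℝ => z - ⟪u, m⟫) ∘ (fun x => ⟪u, x⟫) := by
    funext x; simp [inner_sub_right]
  rw [e, ← Measure.map_map (by fun_prop) (by fun_prop), h1, gaussianReal_map_sub_const,
    gaussianReal_map_const_mul, sub_self, mul_zero, mul_one]
  congr 1
  ext
  have h2 : ⟪u, Matrix.toEuclideanCLM (𝕜 := ℝ) (β ^ 2 • V⁻¹) u⟫ = (β * qnorm V⁻¹ u) ^ 2 := by
    rw [mul_pow, qnorm_inv_sq hV.inv, map_smul, smul_apply,
      real_inner_smul_right]
  rw [h2, Real.coe_toNNReal _ (sq_nonneg _)]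
  rfl

/-- The anti-concentration probability of a standard Gaussian at two standard deviations. -/
def antiProb : ℝ := (gaussianReal 0 1).real (Set.Ici 2)

lemma antiProb_pos : 0 < antiProb := by
  have h : 0 < gaussianReal 0 1 (Set.Ici 2) := by
    have h1 : volume ≪ gaussianReal 0 1 := gaussianReal_absolutelyContinuous' 0 (by simp)
    refine pos_iff_ne_zero.2 fun h => ?_
    have := h1 h
    simp at this
  exact ENNReal.toReal_pos h.ne' (measure_ne_top _ _)

lemma antiProb_le_one : antiProb ≤ 1 := measureReal_le_one

/-- Two standard deviations are asked for because the confidence radius is 2β, so such a sample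
outweighs the error of θh along u. -/
lemma multivariateGaussian_anticoncentration {V : Matrix (Fin d) (Fin d) ℝ} (hV : V.PosDef)
    {β : ℝ} (hβ : 0 ≤ β) (m u : EuclideanSpace ℝ (Fin d)) :
    ENNReal.ofReal antiProb ≤ multivariateGaussian m (β ^ 2 • V⁻¹)
      {θ | 2 * β * qnorm V⁻¹ u ≤ ⟪u, θ - m⟫} := by
  have h := map_inner_sub_multivariateGaussian hV β m u
  have h2 := congrArg (fun ν : Measure ℝ => ν (Set.Ici (2 * β * qnorm V⁻¹ u))) h
  beta_reduce at h2
  rw [Measure.map_apply (by fun_prop) measurableSet_Ici,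
    Measure.map_apply (by fun_prop) measurableSet_Ici] at h2
  have e : {θ | 2 * β * qnorm V⁻¹ u ≤ ⟪u, θ - m⟫}
    = (fun x => ⟪u, x - m⟫) ⁻¹' Set.Ici (2 * β * qnorm V⁻¹ u) := rfl
  rw [e, h2, antiProb, ofReal_measureReal]
  refine measure_mono fun z hz => ?_
  simp only [Set.mem_Ici, Set.mem_preimage] at hz ⊢
  have := mul_nonneg hβ (qnorm_nonneg V⁻¹ u)
  nlinarith

lemma multivariateGaussian_tail (hd : 1 ≤ d) {V : Matrix (Fin d) (Fin d) ℝ} (hV : V.PosDef)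
    {β η : ℝ} (hβ : 0 ≤ β) (hη : 0 < η) (hη1 : η ≤ 1) (m : EuclideanSpace ℝ (Fin d)) :
    multivariateGaussian m (β ^ 2 • V⁻¹)
      {θ | β * √(2 * d * Real.log (2 * d / η)) < qnorm V (θ - m)} ≤ ENNReal.ofReal η := by
  obtain ⟨R, hR, hRR, hdet⟩ := exists_symm_sqrt hV
  have hd0 : (0 : ℝ) < d := by exact_mod_cast hd
  have hd1 : (1 : ℝ) ≤ d := by exact_mod_cast hd
  -- Chosen so that 2 exp(-r²/2) = η/d, ready for a union bound over d coordinates.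
  set r := √(2 * Real.log (2 * d / η)) with hr
  have hlog : 0 ≤ Real.log (2 * d / η) := Real.log_nonneg (by
    rw [le_div_iff₀ hη]; linarith)
  have hr0 : 0 ≤ r := Real.sqrt_nonneg _
  have hr2 : r ^ 2 = 2 * Real.log (2 * d / η) := Real.sq_sqrt (by positivity)
  -- Coordinate i of R(θ - m) is ⟨R e_i, θ - m⟩, and R e_i has unit V⁻¹-norm, so each coordinate is
  -- N(0, β²).
  let v : Fin d → EuclideanSpace ℝ (Fin d) := fun i =>
    Matrix.toEuclideanCLM (𝕜 := ℝ) R (EuclideanSpace.single i 1)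
  have hv : ∀ i, qnorm V⁻¹ (v i) = 1 := fun i => by
    have : qnorm V⁻¹ (v i) ^ 2 = 1 := by
      rw [qnorm_inv_sq hV.inv, ← inner_toEuclideanCLM_of_symm hR, ← hRR, Matrix.mul_inv_rev,
        ← toEuclideanCLM_mul_apply, ← toEuclideanCLM_mul_apply, ← Matrix.mul_assoc R,
        Matrix.mul_nonsing_inv _ hdet, Matrix.one_mul, Matrix.nonsing_inv_mul _ hdet]
      simp
    exact (pow_eq_one_iff_of_nonneg (qnorm_nonneg _ _) two_ne_zero).1 this
  have hsub : {θ | β * √(2 * d * Real.log (2 * d / η)) < qnorm V (θ - m)}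
      ⊆ ⋃ i ∈ (Finset.univ : Finset (Fin d)), {θ | β * r < |⟪v i, θ - m⟫|} := by
    intro θ hθ
    simp only [Set.mem_iUnion, Finset.mem_univ, exists_prop, true_and]
    by_contra hcon
    push Not at hcon
    have h1 : qnorm V (θ - m) ^ 2 ≤ d * (β * r) ^ 2 := by
      rw [← hRR, qnorm_mul_self_eq hR, EuclideanSpace.real_norm_sq_eq]
      calc _ ≤ ∑ i : Fin d, (β * r) ^ 2 := by
            refine Finset.sum_le_sum fun i _ => ?_
            have h2 : (Matrix.toEuclideanCLM (𝕜 := ℝ) R (θ - m)) i = ⟪v i, θ - m⟫ := by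
              rw [← inner_toEuclideanCLM_of_symm hR, EuclideanSpace.inner_single_left]; simp
            rw [h2, ← sq_abs]
            have := hcon i
            simp only [Set.mem_ofPred_eq, not_lt] at this
            gcongr
        _ = _ := by simp
    have h3 : d * (β * r) ^ 2 = (β * √(2 * d * Real.log (2 * d / η))) ^ 2 := by
      rw [mul_pow, mul_pow, hr2, Real.sq_sqrt (by positivity)]; ring
    rw [h3] at h1
    exact absurd (abs_le_of_sq_le_sq' h1 (by positivity)).2 (not_le.2 hθ)
  refine (measure_mono hsub).trans ((measure_biUnion_finset_le _ _).trans ?_)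
  have heach : ∀ i, multivariateGaussian m (β ^ 2 • V⁻¹) {θ | β * r < |⟪v i, θ - m⟫|}
      ≤ ENNReal.ofReal (η / d) := fun i => by
    have h := map_inner_sub_multivariateGaussian hV β m (v i)
    have hms : MeasurableSet {z : ℝ | β * r < |z|} := measurableSet_lt (by fun_prop) (by fun_prop)
    have h2 := congrArg (fun ν => ν {z : ℝ | β * r < |z|}) h
    simp only [hv, mul_one] at h2
    rw [Measure.map_apply (by fun_prop) hms, Measure.map_apply (by fun_prop) hms] at h2
    have e : {θ | β * r < |⟪v i, θ - m⟫|} = (fun x => ⟪v i, x - m⟫) ⁻¹' {z : ℝ | β * r < |z|} := rfl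
    rw [e, h2]
    refine (measure_mono (t := {z | r ≤ |z|}) fun z hz => ?_).trans ((gaussianReal_tail hr0).trans ?_)
    · simp only [Set.mem_preimage, Set.mem_ofPred_eq, abs_mul, abs_of_nonneg hβ] at hz ⊢
      exact (lt_of_mul_lt_mul_left hz hβ).le
    · refine ENNReal.ofReal_le_ofReal (le_of_eq ?_)
      have e2 : -r ^ 2 / 2 = -Real.log (2 * d / η) := by rw [hr2]; ring
      rw [e2, Real.exp_neg, Real.exp_log (by positivity)]
      field_simp
  calc _ ≤ ∑ i : Fin d, ENNReal.ofReal (η / d) := Finset.sum_le_sum fun i _ => heach i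
    _ = ENNReal.ofReal η := by
      rw [Finset.sum_const, Finset.card_univ, Fintype.card_fin, nsmul_eq_mul,
        ← ENNReal.ofReal_natCast, ← ENNReal.ofReal_mul (by positivity)]
      congr 1
      field_simp

end Gaussian

/-! ### Values as linear functions of expected features. -/

section Values

variable {S A : Type*} [MeasurableSpace S] [MeasurableSpace A] {d : ℕ} (M : MDP S A d)

/-- The expected discounted feature sum of a policy. -/
def policyFeat (π : Policy M) : EuclideanSpace ℝ (Fin d) := ∫ τ, trajFeat M τ ∂(trajLaw M π)

lemma measurable_trajFeat : Measurable (trajFeat M) := by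
  unfold trajFeat
  have := M.feat_meas
  exact Measurable.tsum fun h => by fun_prop

lemma measurable_trajLaw : Measurable (trajLaw M) := comap_measurable _

/-- The trajectory law as a kernel from policies. -/
def trajKernel : Kernel (Policy M) (ℕ → S × A) := ⟨trajLaw M, measurable_trajLaw M⟩

instance : IsMarkovKernel (trajKernel M) := ⟨fun π => inferInstanceAs (IsProbabilityMeasure (trajLaw M π))⟩

lemma measurable_policyFeat : Measurable (policyFeat M) := by
  have h : StronglyMeasurable fun π => ∫ τ, trajFeat M τ ∂(trajKernel M π) :=
    StronglyMeasurable.integral_kernel (measurable_trajFeat M).stronglyMeasurable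
  exact h.measurable

lemma hasSum_disc : HasSum (fun h => M.disc ^ h) (horizon M) :=
  hasSum_geometric_of_lt_one M.disc_pos.le M.disc_lt_one

variable {M} {L : ℝ}

lemma norm_disc_smul_feat_le (hL : ∀ z, ‖M.feat z‖ ≤ L) (τ : ℕ → S × A) (h : ℕ) :
    ‖M.disc ^ h • M.feat (τ h)‖ ≤ M.disc ^ h * L := by
  have := M.disc_pos
  rw [norm_smul, Real.norm_of_nonneg (by positivity)]
  exact mul_le_mul_of_nonneg_left (hL _) (by positivity)

lemma summable_disc_feat (hL : ∀ z, ‖M.feat z‖ ≤ L) (τ : ℕ → S × A) :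
    Summable fun h => M.disc ^ h • M.feat (τ h) :=
  Summable.of_norm_bounded ((hasSum_disc M).mul_right L).summable (norm_disc_smul_feat_le hL τ)

lemma norm_trajFeat_le (hL : ∀ z, ‖M.feat z‖ ≤ L) (τ : ℕ → S × A) :
    ‖trajFeat M τ‖ ≤ L * horizon M := by
  rw [mul_comm]
  exact tsum_of_norm_bounded ((hasSum_disc M).mul_right L) (norm_disc_smul_feat_le hL τ)

lemma integrable_trajFeat (hL : ∀ z, ‖M.feat z‖ ≤ L) (π : Policy M) :
    Integrable (trajFeat M) (trajLaw M π) :=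
  Integrable.of_bound (measurable_trajFeat M).aestronglyMeasurable (L * horizon M)
    (Filter.Eventually.of_forall (norm_trajFeat_le hL))

lemma norm_policyFeat_le (hL : ∀ z, ‖M.feat z‖ ≤ L) (π : Policy M) :
    ‖policyFeat M π‖ ≤ L * horizon M := by
  refine (norm_integral_le_of_norm_le_const (C := L * horizon M)
    (Filter.Eventually.of_forall (norm_trajFeat_le hL))).trans ?_
  simp

lemma norm_policyFeat_sub_le (hL : ∀ z, ‖M.feat z‖ ≤ L) (π π' : Policy M) :
    ‖policyFeat M π - policyFeat M π'‖ ≤ 2 * L * horizon M := by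
  have h1 := norm_policyFeat_le hL π
  have h2 := norm_policyFeat_le hL π'
  have := norm_sub_le (policyFeat M π) (policyFeat M π')
  linarith

lemma norm_trajFeat_sub_le (hL : ∀ z, ‖M.feat z‖ ≤ L) (τ τ' : ℕ → S × A) :
    ‖trajFeat M τ - trajFeat M τ'‖ ≤ 2 * L * horizon M := by
  have h1 := norm_trajFeat_le hL τ
  have h2 := norm_trajFeat_le hL τ'
  have := norm_sub_le (trajFeat M τ) (trajFeat M τ')
  linarith

/-- The inner product passes through the discounted series and the expectation, both controlled by
the bound L. -/
lemma value_eq_inner (hL : ∀ z, ‖M.feat z‖ ≤ L) (θ : EuclideanSpace ℝ (Fin d)) (π : Policy M) :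
    value M θ π = ⟪θ, policyFeat M π⟫ := by
  have h1 : ∀ τ : ℕ → S × A, ∑' h, M.disc ^ h * reward M θ (τ h) = ⟪θ, trajFeat M τ⟫ := fun τ => by
    have h2 := (innerSL ℝ θ).map_tsum (summable_disc_feat hL τ)
    simp only [innerSL_apply_apply, real_inner_smul_right] at h2
    rw [trajFeat, h2]
    rfl
  rw [value, policyFeat]
  simp only [h1]
  exact integral_inner (integrable_trajFeat hL π) θ

lemma abs_value_le (hL : ∀ z, ‖M.feat z‖ ≤ L) (θ : EuclideanSpace ℝ (Fin d)) (π : Policy M) :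
    |value M θ π| ≤ ‖θ‖ * (L * horizon M) := by
  rw [value_eq_inner hL]
  refine (abs_real_inner_le_norm _ _).trans ?_
  gcongr
  exact norm_policyFeat_le hL π

lemma value_le_optValue (hL : ∀ z, ‖M.feat z‖ ≤ L) (θ : EuclideanSpace ℝ (Fin d)) (π : Policy M) :
    value M θ π ≤ optValue M θ :=
  le_ciSup (f := fun π => value M θ π) ⟨‖θ‖ * (L * horizon M), by
    rintro _ ⟨π, rfl⟩; exact (abs_le.1 (abs_value_le hL θ π)).2⟩ π

lemma optValue_le [Nonempty (Policy M)] (hL : ∀ z, ‖M.feat z‖ ≤ L)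
    (θ : EuclideanSpace ℝ (Fin d)) : optValue M θ ≤ ‖θ‖ * (L * horizon M) :=
  ciSup_le fun π => (abs_le.1 (abs_value_le hL θ π)).2

/-- The supremum over policies need not be attained, so a near-optimal comparator stands in for an
optimal one. -/
lemma exists_near_optimal [Nonempty (Policy M)] (θ : EuclideanSpace ℝ (Fin d)) {ε : ℝ} (hε : 0 < ε) :
    ∃ π : Policy M, optValue M θ - ε ≤ value M θ π := by
  obtain ⟨π, hπ⟩ := exists_lt_of_lt_ciSup (show optValue M θ - ε < ⨆ π : Policy M, value M θ π by
    rw [← optValue]; linarith)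
  exact ⟨π, hπ.le⟩

/-- A supremum of functions of θ with a common Lipschitz constant. Continuity is needed for the
measurability of the oracle's failure event. -/
lemma continuous_optValue [Nonempty (Policy M)] (hL : ∀ z, ‖M.feat z‖ ≤ L) :
    Continuous (optValue M) := by
  have hL0 : 0 ≤ L * horizon M := by
    obtain ⟨π⟩ := ‹Nonempty (Policy M)›
    exact (norm_nonneg _).trans (norm_policyFeat_le hL π)
  refine (LipschitzWith.of_le_add_mul (Real.toNNReal (L * horizon M)) fun θ θ' => ?_).continuous
  refine ciSup_le fun π => ?_
  have h1 := value_le_optValue hL θ' π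
  rw [Real.coe_toNNReal _ hL0]
  have h2 : value M θ π - value M θ' π ≤ L * horizon M * dist θ θ' := by
    rw [value_eq_inner hL, value_eq_inner hL, ← inner_sub_left, dist_eq_norm, mul_comm]
    refine (real_inner_le_norm _ _).trans ?_
    gcongr
    exact norm_policyFeat_le hL π
  linarith

lemma qnorm_integral_le {A' : Matrix (Fin d) (Fin d) ℝ} (hA : A'.PosDef) {X : Type*}
    [MeasurableSpace X] {ν : Measure X} {f : X → EuclideanSpace ℝ (Fin d)} (hf : Integrable f ν) :
    qnorm A' (∫ x, f x ∂ν) ≤ ∫ x, qnorm A' (f x) ∂ν := by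
  obtain ⟨R, hR⟩ := exists_qnorm_eq_norm hA
  simp only [hR]
  rw [← R.integral_comp_comm hf]
  exact norm_integral_le_integral_norm _

/-- Jensen's inequality for the feature gap of two independent trajectories. -/
lemma qnorm_policyFeat_sub_le (hL : ∀ z, ‖M.feat z‖ ≤ L) {A' : Matrix (Fin d) (Fin d) ℝ}
    (hA : A'.PosDef) (π π' : Policy M) :
    qnorm A' (policyFeat M π - policyFeat M π') ≤
      ∫ p, qnorm A' (trajFeat M p.1 - trajFeat M p.2) ∂((trajLaw M π).prod (trajLaw M π')) := by
  have h1 : Integrable (fun p : (ℕ → S × A) × (ℕ → S × A) => trajFeat M p.1)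
      ((trajLaw M π).prod (trajLaw M π')) := (integrable_trajFeat hL π).comp_fst _
  have h2 : Integrable (fun p : (ℕ → S × A) × (ℕ → S × A) => trajFeat M p.2)
      ((trajLaw M π).prod (trajLaw M π')) := (integrable_trajFeat hL π').comp_snd _
  refine le_trans (le_of_eq ?_) (qnorm_integral_le hA (h1.sub h2))
  congr 1
  rw [integral_sub h1 h2, integral_fun_fst (μ := trajLaw M π) (ν := trajLaw M π') (trajFeat M),
    integral_fun_snd (μ := trajLaw M π) (ν := trajLaw M π') (trajFeat M)]
  simp [policyFeat]

end Values

/-! ### Likelihood ratios and their mixture over the ball. -/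

section Likelihood

variable {d : ℕ}

/-- The likelihood ratio of the parameters `θ` and `θs` for the label `b` at the feature `x`. -/
def likRatio (θs : EuclideanSpace ℝ (Fin d)) (b : Bool) (x θ : EuclideanSpace ℝ (Fin d)) : ℝ≥0∞ :=
  ENNReal.ofReal (Real.exp (logLoss b ⟪θs, x⟫ - logLoss b ⟪θ, x⟫))

lemma measurable_likRatio (θs : EuclideanSpace ℝ (Fin d)) :
    Measurable fun p : Bool × EuclideanSpace ℝ (Fin d) × EuclideanSpace ℝ (Fin d) =>
      likRatio θs p.1 p.2.1 p.2.2 := by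
  refine measurable_from_prod_countable_right fun b => ?_
  have h := continuous_logLoss b
  unfold likRatio
  have : Continuous fun p : EuclideanSpace ℝ (Fin d) × EuclideanSpace ℝ (Fin d) =>
      Real.exp (logLoss b ⟪θs, p.1⟫ - logLoss b ⟪p.2, p.1⟫) := by fun_prop
  exact this.measurable.ennreal_ofReal

/-- Integrating p_θ/p_{θs} against p_{θs} gives the total mass of p_θ; this is the source of the
martingale property. -/
lemma lintegral_likRatio (θs x θ : EuclideanSpace ℝ (Fin d)) :
    ∫⁻ b, likRatio θs b x θ ∂(bernoulliMeasure true false (unitInterval.sigmoid ⟪θs, x⟫)) = 1 := by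
  have e1 : ∀ b : Bool, ∀ z : ℝ, Real.exp (logLoss b z)
      = (if b then Real.sigmoid z else Real.sigmoid (-z))⁻¹ := fun b z => by
    cases b
    · simp [logLoss, Real.exp_neg, Real.exp_log (Real.sigmoid_pos _)]
    · simp [logLoss, Real.exp_neg, Real.exp_log (Real.sigmoid_pos _)]
  have h0 := Real.sigmoid_pos ⟪θs, x⟫
  have h1 := Real.sigmoid_pos (-⟪θs, x⟫)
  rw [bernoulliMeasure_def, lintegral_add_measure, lintegral_smul_measure, lintegral_smul_measure,
    lintegral_dirac, lintegral_dirac, likRatio, likRatio, Real.exp_sub, Real.exp_sub, e1, e1, e1, e1]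
  have e2 : (unitInterval.toNNReal (unitInterval.sigmoid ⟪θs, x⟫) : ℝ≥0∞)
      = ENNReal.ofReal (Real.sigmoid ⟪θs, x⟫) := by
    rw [ENNReal.ofReal, ENNReal.coe_inj]; ext; rw [Real.coe_toNNReal _ h0.le]; rfl
  have e3 : (unitInterval.toNNReal (unitInterval.symm (unitInterval.sigmoid ⟪θs, x⟫)) : ℝ≥0∞)
      = ENNReal.ofReal (Real.sigmoid (-⟪θs, x⟫)) := by
    rw [ENNReal.ofReal, ENNReal.coe_inj]; ext; rw [Real.coe_toNNReal _ h1.le, Real.sigmoid_neg]; rfl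
  rw [ENNReal.smul_def, ENNReal.smul_def, smul_eq_mul, smul_eq_mul, e2, e3,
    ← ENNReal.ofReal_mul h0.le, ← ENNReal.ofReal_mul h1.le, ← ENNReal.ofReal_add
      (by have := Real.sigmoid_pos ⟪θ, x⟫; simp; positivity)
      (by have := Real.sigmoid_pos (-⟪θ, x⟫); simp; positivity)]
  have e4 : Real.sigmoid ⟪θs, x⟫ *
      ((if true = true then Real.sigmoid ⟪θs, x⟫ else Real.sigmoid (-⟪θs, x⟫))⁻¹ /
        (if true = true then Real.sigmoid ⟪θ, x⟫ else Real.sigmoid (-⟪θ, x⟫))⁻¹) +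
      Real.sigmoid (-⟪θs, x⟫) *
      ((if false = true then Real.sigmoid ⟪θs, x⟫ else Real.sigmoid (-⟪θs, x⟫))⁻¹ /
        (if false = true then Real.sigmoid ⟪θ, x⟫ else Real.sigmoid (-⟪θ, x⟫))⁻¹) = 1 := by
    simp only [if_true, Bool.false_eq_true, if_false]
    have e5 : Real.sigmoid (-⟪θ, x⟫) = 1 - Real.sigmoid ⟪θ, x⟫ := Real.sigmoid_neg _
    field_simp
    rw [e5]; ring
  rw [e4, ENNReal.ofReal_one]

lemma prod_likRatio_eq (θs θ : EuclideanSpace ℝ (Fin d)) (x : ℕ → EuclideanSpace ℝ (Fin d))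
    (y : ℕ → Bool) (t : ℕ) :
    ∏ k ∈ Finset.Ico 1 t, likRatio θs (y k) (x k) θ
      = ENNReal.ofReal (Real.exp (negLogLik x y t θs - negLogLik x y t θ)) := by
  rw [negLogLik_eq_sum, negLogLik_eq_sum, ← Finset.sum_sub_distrib, Real.exp_sum,
    ENNReal.ofReal_prod_of_nonneg fun _ _ => Real.exp_nonneg _]
  rfl

lemma measurable_prod_likRatio {Ω : Type*} {m : MeasurableSpace Ω}
    (θs : EuclideanSpace ℝ (Fin d)) {x : Ω → ℕ → EuclideanSpace ℝ (Fin d)} {y : Ω → ℕ → Bool} {t : ℕ}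
    (hx : ∀ k ∈ Finset.Ico 1 t, Measurable fun ω => x ω k)
    (hy : ∀ k ∈ Finset.Ico 1 t, Measurable fun ω => y ω k) :
    Measurable fun p : Ω × EuclideanSpace ℝ (Fin d) =>
      ∏ k ∈ Finset.Ico 1 t, likRatio θs (y p.1 k) (x p.1 k) p.2 := by
  refine Finset.measurable_prod _ fun k hk => ?_
  exact (measurable_likRatio θs).comp (((hy k hk).comp measurable_fst).prodMk
    (((hx k hk).comp measurable_fst).prodMk measurable_snd))

/-- The uniform distribution on the ball of radius `B`. -/
def ballPrior (d : ℕ) (B : ℝ) : Measure (EuclideanSpace ℝ (Fin d)) :=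
  cond volume (Metric.closedBall 0 B)

lemma isProbabilityMeasure_ballPrior {B : ℝ} (hB : 0 < B) : IsProbabilityMeasure (ballPrior d B) :=
  cond_isProbabilityMeasure_of_finite (Metric.measure_closedBall_pos volume _ hB).ne'
    measure_closedBall_lt_top.ne

-- The set is a translate of the ball scaled by η, and by convexity it stays inside the ball.
open scoped Pointwise in
lemma ballPrior_shrink {B η : ℝ} (hB : 0 < B) (hη : 0 < η) (hη1 : η ≤ 1)
    {θh : EuclideanSpace ℝ (Fin d)} (hθh : θh ∈ Metric.closedBall 0 B) :
    ballPrior d B ((fun θ => (1 - η) • θh + η • θ) '' Metric.closedBall 0 B)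
      = ENNReal.ofReal (η ^ d) := by
  set K := (fun θ => (1 - η) • θh + η • θ) '' Metric.closedBall 0 B with hK
  have hsub : K ⊆ Metric.closedBall 0 B := by
    rintro _ ⟨θ, hθ, rfl⟩
    exact (convex_closedBall 0 B) hθh hθ (by linarith) hη.le (by ring)
  have hvol : volume K = ENNReal.ofReal (η ^ d) * volume (Metric.closedBall (0 : EuclideanSpace ℝ (Fin d)) B) := by
    have e : K = (fun v => (1 - η) • θh + v) ''
        (η • Metric.closedBall (0 : EuclideanSpace ℝ (Fin d)) B) := by
      rw [hK, ← Set.image_smul, Set.image_image]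
    rw [e, Set.image_add_left, measure_preimage_add, Measure.addHaar_smul, finrank_euclideanSpace,
      Fintype.card_fin, abs_of_nonneg (by positivity)]
  have h0 : volume (Metric.closedBall (0 : EuclideanSpace ℝ (Fin d)) B) ≠ 0 :=
    (Metric.measure_closedBall_pos volume _ hB).ne'
  have h1 : volume (Metric.closedBall (0 : EuclideanSpace ℝ (Fin d)) B) ≠ ∞ :=
    measure_closedBall_lt_top.ne
  rw [ballPrior, cond_apply measurableSet_closedBall, Set.inter_eq_self_of_subset_right hsub, hvol,
    mul_comm, mul_assoc, ENNReal.mul_inv_cancel h0 h1, mul_one]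

/-- A bound on the mixture likelihood ratio bounds the excess risk of the true parameter. -/
lemma negLogLik_sub_le_of_mixture {x : ℕ → EuclideanSpace ℝ (Fin d)} {y : ℕ → Bool} {t : ℕ}
    (hd : 1 ≤ d) (ht : 1 ≤ t)
    {B b δ : ℝ} (hB : 0 < B) (hb : 0 ≤ b) (hδ : 0 < δ) (hx : ∀ k ∈ Finset.Ico 1 t, ‖x k‖ ≤ b)
    {θs θh : EuclideanSpace ℝ (Fin d)} (hθh : θh ∈ Metric.closedBall 0 B)
    (hmix : ∫⁻ θ, ∏ k ∈ Finset.Ico 1 t, likRatio θs (y k) (x k) θ ∂(ballPrior d B)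
      < ENNReal.ofReal (1 / δ)) :
    negLogLik x y t θs - negLogLik x y t θh ≤ Real.log (1 / δ)
      + d * Real.log (max (Real.exp 1) (2 * Real.exp 1 * B * b * ((t : ℝ) - 1) / d)) := by
  have hd0 : (0 : ℝ) < d := by exact_mod_cast hd
  have ht1 : (1 : ℝ) ≤ t := by exact_mod_cast ht
  -- The ball is shrunk towards θh by η = 1/z. Displacements are then at most 2B/z, so the loss,
  -- which is (t - 1)b-Lipschitz, changes by at most d; the maximum with 1 keeps η ≤ 1.
  set z : ℝ := max 1 (2 * B * b * ((t : ℝ) - 1) / d) with hz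
  have hz1 : 1 ≤ z := le_max_left _ _
  have hz0 : 0 < z := by linarith
  have hηle : z⁻¹ ≤ 1 := inv_le_one_of_one_le₀ hz1
  set Δ := negLogLik x y t θs - negLogLik x y t θh with hΔ
  have hlow : ENNReal.ofReal (z⁻¹ ^ d) * ENNReal.ofReal (Real.exp (Δ - d))
      ≤ ∫⁻ θ, ∏ k ∈ Finset.Ico 1 t, likRatio θs (y k) (x k) θ ∂(ballPrior d B) := by
    rw [← ballPrior_shrink hB (inv_pos.2 hz0) hηle hθh, mul_comm, ← setLIntegral_const]
    refine (setLIntegral_mono' ?_ fun θ hθ => ?_).trans (setLIntegral_le_lintegral _ _)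
    · refine ((isCompact_closedBall _ _).image ?_).measurableSet
      fun_prop
    · obtain ⟨ϑ, hϑ, rfl⟩ := hθ
      rw [prod_likRatio_eq]
      refine ENNReal.ofReal_le_ofReal (Real.exp_le_exp.2 ?_)
      have h1 := abs_negLogLik_sub_le (y := y) hx ((1 - z⁻¹) • θh + z⁻¹ • ϑ) θh
      have e1 : (1 - z⁻¹) • θh + z⁻¹ • ϑ - θh = z⁻¹ • (ϑ - θh) := by module
      have h2 : ‖ϑ - θh‖ ≤ 2 * B := by
        rw [mem_closedBall_zero_iff] at hϑ hθh
        linarith [norm_sub_le ϑ θh]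
      have h3 : ((t - 1 : ℕ) : ℝ) * b * ‖(1 - z⁻¹) • θh + z⁻¹ • ϑ - θh‖ ≤ d := by
        rw [e1, norm_smul, Real.norm_of_nonneg (inv_pos.2 hz0).le, Nat.cast_sub ht, Nat.cast_one]
        have h4 : 2 * B * b * ((t : ℝ) - 1) ≤ z * d := by
          rw [← div_le_iff₀ hd0]; exact le_max_right _ _
        have h5 : ((t : ℝ) - 1) * b * (z⁻¹ * ‖ϑ - θh‖) ≤ ((t : ℝ) - 1) * b * (z⁻¹ * (2 * B)) := by
          have : 0 ≤ (t : ℝ) - 1 := by linarith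
          gcongr
        refine h5.trans ?_
        have e2 : ((t : ℝ) - 1) * b * (z⁻¹ * (2 * B)) = 2 * B * b * ((t : ℝ) - 1) / z := by
          field_simp
        rw [e2, div_le_iff₀ hz0]
        linarith
      have h6 := (abs_le.1 (h1.trans h3)).2
      linarith
  have h7 := hlow.trans_lt hmix
  rw [← ENNReal.ofReal_mul (by positivity), ENNReal.ofReal_lt_ofReal_iff (by positivity)] at h7
  have h8 := Real.log_lt_log (by positivity) h7
  rw [Real.log_mul (by positivity) (Real.exp_ne_zero _), Real.log_pow, Real.log_inv,
    Real.log_exp] at h8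
  -- The change d of the loss is absorbed as d log z + d = d log(ez), which explains the e in
  -- `beta`.
  have e3 : max (Real.exp 1) (2 * Real.exp 1 * B * b * ((t : ℝ) - 1) / d) = Real.exp 1 * z := by
    rw [hz, mul_max_of_nonneg _ _ (Real.exp_nonneg 1), mul_one]
    congr 1; ring
  rw [e3, Real.log_mul (Real.exp_ne_zero _) hz0.ne', Real.log_exp]
  nlinarith

end Likelihood

lemma measurable_mul_likRatio {Ω : Type*} {m : MeasurableSpace Ω} {d : ℕ}
    (θs θ : EuclideanSpace ℝ (Fin d)) {G : Ω → ℝ≥0∞} {x : Ω → EuclideanSpace ℝ (Fin d)}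
    (hG : Measurable G) (hx : Measurable x) :
    Measurable (Function.uncurry fun ω b => G ω * likRatio θs b (x ω) θ) :=
  (hG.comp measurable_fst).mul ((measurable_likRatio θs).comp
    (measurable_snd.prodMk ((hx.comp measurable_fst).prodMk measurable_const)))

/-! ### Confidence ellipsoids along a run. -/

namespace RegretRun

variable {S A : Type*} [MeasurableSpace S] [MeasurableSpace A] {d : ℕ} {M : MDP S A d}
  {θs : EuclideanSpace ℝ (Fin d)} {B L : ℝ}
  {O : ℝ → ℝ → Kernel (EuclideanSpace ℝ (Fin d)) (Policy M)} {T : ℕ} {δ lam : ℝ}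
  {Ω : Type*} [mΩ : MeasurableSpace Ω] {μ : Measure Ω} (run : RegretRun M θs B L O T δ lam μ)

/-- The feature difference `x_k` of the two trajectories of round `k`. -/
def featDiff (ω : Ω) (k : ℕ) : EuclideanSpace ℝ (Fin d) :=
  trajFeat M (run.traj k ω).1 - trajFeat M (run.traj k ω).2

/-- The design matrix of round `t`. -/
def design (t : ℕ) (ω : Ω) : Matrix (Fin d) (Fin d) ℝ := designMatrix lam (run.featDiff ω) t

/-- The information available when the oracle is called in round `t`. -/
abbrev preOracle (t : ℕ) : MeasurableSpace Ω :=
  run.ℱ (t - 1) ⊔ MeasurableSpace.comap (run.θtil t) inferInstance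

/-- The information available when the trajectories of round `t` are drawn. -/
abbrev preTraj (t : ℕ) : MeasurableSpace Ω :=
  run.preOracle t ⊔ MeasurableSpace.comap (run.pol t) inferInstance

/-- The information available when the label of round `t` is drawn. -/
abbrev preLabel (t : ℕ) : MeasurableSpace Ω :=
  run.preTraj t ⊔ MeasurableSpace.comap (run.traj t) inferInstance

lemma le_preOracle (t : ℕ) : run.ℱ (t - 1) ≤ run.preOracle t := le_sup_left

lemma le_preTraj (t : ℕ) : run.ℱ (t - 1) ≤ run.preTraj t := (run.le_preOracle t).trans le_sup_left

lemma le_preLabel (t : ℕ) : run.ℱ (t - 1) ≤ run.preLabel t := (run.le_preTraj t).trans le_sup_left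

variable {run} {t : ℕ}

lemma preOracle_le (ht : t ∈ Finset.Icc 1 T) : run.preOracle t ≤ run.ℱ t :=
  sup_le (run.ℱ.mono (by omega)) (run.θtil_meas t ht).comap_le

lemma preTraj_le (ht : t ∈ Finset.Icc 1 T) : run.preTraj t ≤ run.ℱ t :=
  sup_le (preOracle_le ht) (run.pol_meas t ht).comap_le

lemma preLabel_le (ht : t ∈ Finset.Icc 1 T) : run.preLabel t ≤ run.ℱ t :=
  sup_le (preTraj_le ht) (run.traj_meas t ht).comap_le

lemma measurable_pairFeat :
    Measurable fun p : (ℕ → S × A) × (ℕ → S × A) => trajFeat M p.1 - trajFeat M p.2 := by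
  have := measurable_trajFeat M
  fun_prop

lemma measurable_featDiff (ht : t ∈ Finset.Icc 1 T) :
    Measurable[run.ℱ t] fun ω => run.featDiff ω t :=
  measurable_pairFeat.comp (run.traj_meas t ht)

lemma measurable_featDiff_preLabel (t : ℕ) :
    Measurable[run.preLabel t] fun ω => run.featDiff ω t :=
  measurable_pairFeat.comp ((comap_measurable (run.traj t)).mono le_sup_right le_rfl)

lemma norm_featDiff_le (hL : ∀ z, ‖M.feat z‖ ≤ L) (ω : Ω) (k : ℕ) :
    ‖run.featDiff ω k‖ ≤ 2 * L * horizon M := norm_trajFeat_sub_le hL _ _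

lemma design_posDef (hlam : 0 < lam) (t : ℕ) (ω : Ω) : (run.design t ω).PosDef :=
  designMatrix_posDef hlam _ _

lemma measurable_design (ht : t ∈ Finset.Icc 1 T) (i j : Fin d) :
    Measurable[run.ℱ (t - 1)] fun ω => run.design t ω i j := by
  refine @measurable_designMatrix d Ω (run.ℱ (t - 1)) lam (fun ω => run.featDiff ω) t
    (fun k hk => ?_) i j
  simp only [Finset.mem_Icc, Finset.mem_Ico] at ht hk
  exact (measurable_featDiff (by simp; omega)).mono (run.ℱ.mono (by omega)) le_rfl

lemma measurable_design_inv (ht : t ∈ Finset.Icc 1 T) (i j : Fin d) :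
    Measurable[run.ℱ (t - 1)] fun ω => (run.design t ω)⁻¹ i j :=
  @measurable_matrix_inv d Ω (run.ℱ (t - 1)) _ (fun i j => measurable_design ht i j) i j

/-- For fixed θ the new factor has conditional mean one given everything before the label. Tonelli
carries this over to the mixture, and Ville's inequality covers all rounds. After n completed rounds
the product runs over `Ico 1 (n + 1)`. -/
lemma mixture_le [IsProbabilityMeasure μ] (hB : 0 < B) (a : ℝ≥0∞) :
    a * μ {ω | ∃ n ≤ T, a ≤ ∫⁻ θ, ∏ k ∈ Finset.Ico 1 (n + 1),
      likRatio θs (run.lab k ω) (run.featDiff ω k) θ ∂(ballPrior d B)} ≤ 1 := by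
  have hq : IsProbabilityMeasure (ballPrior d B) := isProbabilityMeasure_ballPrior hB
  have hF : ∀ n ≤ T, Measurable[(run.ℱ n).prod inferInstance]
      fun p : Ω × EuclideanSpace ℝ (Fin d) => ∏ k ∈ Finset.Ico 1 (n + 1),
        likRatio θs (run.lab k p.1) (run.featDiff p.1 k) p.2 := fun n hn => by
    refine measurable_prod_likRatio (m := run.ℱ n) θs (x := fun ω => run.featDiff ω)
      (y := fun ω k => run.lab k ω) (fun k hk => ?_) (fun k hk => ?_)
    all_goals simp only [Finset.mem_Ico] at hk
    · exact (measurable_featDiff (by simp; omega)).mono (run.ℱ.mono (by omega)) le_rfl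
    · exact (run.lab_meas k (by simp; omega)).mono (run.ℱ.mono (by omega)) le_rfl
  have hΩ : ∀ n ≤ T, Measurable fun p : Ω × EuclideanSpace ℝ (Fin d) =>
      ∏ k ∈ Finset.Ico 1 (n + 1), likRatio θs (run.lab k p.1) (run.featDiff p.1 k) p.2 :=
    fun n hn => (hF n hn).mono (sup_le_sup (MeasurableSpace.comap_mono (run.ℱ.le n)) le_rfl) le_rfl
  refine ville_inequality run.ℱ (fun n hn => ?_) ?_ (fun n hn s hs => ?_) a
  · exact @Measurable.lintegral_prod_right' Ω _ (run.ℱ n) _ (ballPrior d B) _ _ (hF n hn)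
  · simp
  · have ht : n + 1 ∈ Finset.Icc 1 T := by simp; omega
    have hsΩ := run.ℱ.le n _ hs
    rw [lintegral_lintegral_swap (hΩ (n + 1) (by omega)).aemeasurable,
      lintegral_lintegral_swap (f := fun ω θ => ∏ k ∈ Finset.Ico 1 (n + 1),
        likRatio θs (run.lab k ω) (run.featDiff ω k) θ) (hΩ n (by omega)).aemeasurable]
    refine lintegral_mono fun θ => ?_
    rw [← lintegral_indicator hsΩ, ← lintegral_indicator hsΩ]
    set G : Ω → ℝ≥0∞ := s.indicator fun ω => ∏ k ∈ Finset.Ico 1 (n + 1),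
      likRatio θs (run.lab k ω) (run.featDiff ω k) θ with hG
    have hGm : Measurable[run.ℱ n] G := by
      refine Measurable.indicator (Finset.measurable_prod _ fun k hk => ?_) hs
      simp only [Finset.mem_Ico] at hk
      have hx : Measurable[run.ℱ n] fun ω => run.featDiff ω k :=
        (measurable_featDiff (by simp; omega)).mono (run.ℱ.mono (by omega)) le_rfl
      have hy : Measurable[run.ℱ n] (run.lab k) :=
        (run.lab_meas k (by simp; omega)).mono (run.ℱ.mono (by omega)) le_rfl
      exact (measurable_likRatio θs).comp (hy.prodMk (hx.prodMk measurable_const))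
    have e : ∀ ω, s.indicator (fun ω => ∏ k ∈ Finset.Ico 1 (n + 1 + 1),
        likRatio θs (run.lab k ω) (run.featDiff ω k) θ) ω
        = G ω * likRatio θs (run.lab (n + 1) ω) (run.featDiff ω (n + 1)) θ := fun ω => by
      by_cases h : ω ∈ s
      · simp only [hG, Set.indicator_of_mem h]
        exact Finset.prod_Ico_succ_top (by omega) _
      · simp only [hG, Set.indicator_of_notMem h, zero_mul]
    simp only [e]
    have hlaw : HasCondLaw μ (run.preLabel (n + 1)) (run.lab (n + 1)) _ := run.lab_law (n + 1) ht
    have hm := (preLabel_le ht).trans (run.ℱ.le _)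
    have hprob : ∀ ω, IsProbabilityMeasure (prefLaw M θs (run.traj (n + 1) ω)) := fun ω => by
      unfold prefLaw; infer_instance
    have h1 := hlaw.lintegral_eq hm ((run.lab_meas _ ht).mono (run.ℱ.le _) le_rfl) hprob
      (f := fun ω b => G ω * likRatio θs b (run.featDiff ω (n + 1)) θ) (measurable_mul_likRatio θs θ
        (hGm.mono (run.le_preLabel (n + 1)) le_rfl) (measurable_featDiff_preLabel (n + 1)))
    rw [h1]
    refine lintegral_mono fun ω => ?_
    rw [lintegral_const_mul _ (measurable_of_countable _)]
    have h2 := lintegral_likRatio θs (run.featDiff ω (n + 1)) θ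
    have h3 : ∫⁻ b, likRatio θs b (run.featDiff ω (n + 1)) θ ∂(prefLaw M θs (run.traj (n + 1) ω)) = 1 :=
      h2
    rw [h3, mul_one]

/-- The squared V-norm splits into λ‖θs - θ̂‖² ≤ 4λB² and a data term at most 4κ times the excess
loss; the 4 comes from `mle_quadratic_growth` and makes the radius 2β. The mixture bound is asked
for only when B > 0, where the prior is a probability measure; for B = 0 both parameters vanish. -/
lemma four_qnorm_sq_le_of_mixture (hd : 1 ≤ d) (hL : ∀ z, ‖M.feat z‖ ≤ L) (hL0 : 0 ≤ L)
    (hθs : ‖θs‖ ≤ B) (hlam : 0 < lam) {δ' : ℝ} (hδ' : 0 < δ') (hδ1 : δ' ≤ 1)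
    (ht : t ∈ Finset.Icc 1 T) {ω : Ω}
    (hmix : 0 < B → ∫⁻ θ, ∏ k ∈ Finset.Ico 1 t,
      likRatio θs (run.lab k ω) (run.featDiff ω k) θ ∂(ballPrior d B) < ENNReal.ofReal (1 / δ')) :
    qnorm (run.design t ω) (θs - run.θhat t ω) ≤ 2 * beta M B L lam δ' t := by
  have hB : 0 ≤ B := (norm_nonneg _).trans hθs
  have hH := one_le_horizon M
  have hκ := four_le_kappa M hB hL0
  simp only [Finset.mem_Icc] at ht
  have hlog : 0 ≤ Real.log (1 / δ') := Real.log_nonneg (by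
    rw [le_div_iff₀ hδ']; linarith)
  have hlog2 : 0 ≤ Real.log (max (Real.exp 1)
      (4 * Real.exp 1 * B * L * horizon M * ((t : ℝ) - 1) / d)) :=
    Real.log_nonneg ((Real.one_le_exp zero_le_one).trans (le_max_left _ _))
  have hβ : beta M B L lam δ' t ^ 2 = kappa M B L * (Real.log (1 / δ') + d * Real.log
      (max (Real.exp 1) (4 * Real.exp 1 * B * L * horizon M * ((t : ℝ) - 1) / d)))
      + 4 * lam * B ^ 2 := Real.sq_sqrt (by positivity)
  have hβ0 : 0 ≤ beta M B L lam δ' t := Real.sqrt_nonneg _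
  refine (abs_le_of_sq_le_sq' ?_ (by positivity)).2
  rw [mul_pow, hβ, design, qnorm_designMatrix_sq hlam]
  have hx : ∀ k ∈ Finset.Ico 1 t, ‖run.featDiff ω k‖ ≤ 2 * L * horizon M :=
    fun k _ => norm_featDiff_le hL ω k
  have hball : run.θhat t ω ∈ Metric.closedBall 0 B := by
    rcases Nat.eq_or_lt_of_le ht.1 with h | h
    · rw [← h, run.θhat_one]; simpa using hB
    · exact (run.θhat_mle t (by simp; omega) ω).1
  -- In round 1 the loss is an empty sum, so the prescribed value 0 is a minimizer.
  have hmin : IsMinOn (negLogLik (run.featDiff ω) (fun k => run.lab k ω) t) (Metric.closedBall 0 B)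
      (run.θhat t ω) := by
    rcases Nat.eq_or_lt_of_le ht.1 with h | h
    · intro θ _
      simp [← h, negLogLik]
    · exact (run.θhat_mle t (by simp; omega) ω).2
  have hθsb : θs ∈ Metric.closedBall 0 B := by simpa using hθs
  have hnorm : ‖θs - run.θhat t ω‖ ≤ 2 * B := by
    rw [mem_closedBall_zero_iff] at hball
    linarith [norm_sub_le θs (run.θhat t ω)]
  have hquad := mle_quadratic_growth hx
    (fun s hs => inv_kappa_le_deriv_sigmoid M hd hB hL0 hs) hθsb hball hmin
  have hΔ : negLogLik (run.featDiff ω) (fun k => run.lab k ω) t θs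
      - negLogLik (run.featDiff ω) (fun k => run.lab k ω) t (run.θhat t ω)
      ≤ Real.log (1 / δ') + d * Real.log (max (Real.exp 1)
        (4 * Real.exp 1 * B * L * horizon M * ((t : ℝ) - 1) / d)) := by
    rcases hB.eq_or_lt with h | h
    · have h1 : ‖θs - run.θhat t ω‖ ≤ 0 := by linarith
      have h2 : run.θhat t ω = θs := (sub_eq_zero.1 (norm_le_zero_iff.1 h1)).symm
      rw [h2, sub_self]
      positivity
    · have h1 := negLogLik_sub_le_of_mixture hd ht.1 h (by positivity) hδ' hx hball (hmix h)
      have e : 2 * Real.exp 1 * B * (2 * L * horizon M) * ((t : ℝ) - 1) / d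
          = 4 * Real.exp 1 * B * L * horizon M * ((t : ℝ) - 1) / d := by ring
      rwa [e] at h1
  have h2 : ∑ k ∈ Finset.Ico 1 t, ⟪θs - run.θhat t ω, run.featDiff ω k⟫ ^ 2
      ≤ 4 * (kappa M B L * (Real.log (1 / δ') + d * Real.log (max (Real.exp 1)
        (4 * Real.exp 1 * B * L * horizon M * ((t : ℝ) - 1) / d)))) := by
    have h3 := hquad.trans hΔ
    rw [div_mul_eq_mul_div, div_le_iff₀ (by norm_num), inv_mul_le_iff₀ (by linarith)] at h3
    linarith
  have h4 : lam * ‖θs - run.θhat t ω‖ ^ 2 ≤ lam * (2 * B) ^ 2 := by gcongr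
  nlinarith [mul_nonneg hlam.le (sq_nonneg B)]

/-- The confidence ellipsoids contain the true parameter simultaneously. -/
lemma measure_not_confident_le [IsProbabilityMeasure μ] (hd : 1 ≤ d) (hL : ∀ z, ‖M.feat z‖ ≤ L)
    (hL0 : 0 ≤ L) (hθs : ‖θs‖ ≤ B) (hlam : 0 < lam) {δ' : ℝ} (hδ' : 0 < δ') (hδ1 : δ' ≤ 1) :
    μ {ω | ∃ t ∈ Finset.Icc 1 T,
      2 * beta M B L lam δ' t < qnorm (run.design t ω) (θs - run.θhat t ω)}
      ≤ ENNReal.ofReal δ' := by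
  have hB : 0 ≤ B := (norm_nonneg _).trans hθs
  rcases hB.eq_or_lt with h | h
  · have : {ω | ∃ t ∈ Finset.Icc 1 T,
      2 * beta M B L lam δ' t < qnorm (run.design t ω) (θs - run.θhat t ω)} = ∅ := by
      refine Set.eq_empty_of_forall_notMem ?_
      rintro ω ⟨t, ht, h1⟩
      exact absurd (four_qnorm_sq_le_of_mixture hd hL hL0 hθs hlam hδ' hδ1 ht
        (fun h2 => absurd h2 (by linarith))) (not_le.2 h1)
    rw [this]; simp
  · have h1 := mixture_le (run := run) h (ENNReal.ofReal (1 / δ'))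
    rw [mul_comm] at h1
    have h2 := ENNReal.le_div_iff_mul_le (Or.inl (by simpa using hδ')) (Or.inl ENNReal.ofReal_ne_top)
      |>.2 h1
    have e : 1 / ENNReal.ofReal (1 / δ') = ENNReal.ofReal δ' := by
      rw [one_div, one_div, ENNReal.ofReal_inv_of_pos hδ', inv_inv]
    rw [e] at h2
    refine (measure_mono ?_).trans h2
    rintro ω ⟨t, ht, h3⟩
    have ht' := ht
    simp only [Finset.mem_Icc] at ht'
    -- The ellipsoid of round t uses the labels of the t - 1 earlier rounds.
    refine ⟨t - 1, by omega, ?_⟩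
    by_contra hcon
    rw [not_le, Nat.sub_add_cancel ht'.1] at hcon
    exact absurd (four_qnorm_sq_le_of_mixture hd hL hL0 hθs hlam hδ' hδ1 ht
        (fun _ => hcon)) (not_le.2 h3)

end RegretRun

/-! ### Conditional laws: random events, composition and sums. -/

section CondLawTools

variable {Ω X : Type*} {m m' : MeasurableSpace Ω} [mΩ : MeasurableSpace Ω] [MeasurableSpace X]
  {μ : Measure Ω}

lemma measurable_integral_of_measurable_measure {Ω X : Type*} {m : MeasurableSpace Ω}
    [MeasurableSpace X] {κ : Ω → Measure X} (hκm : Measurable κ)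
    (hκ : ∀ ω, IsProbabilityMeasure (κ ω)) {g : Ω → X → ℝ} (hg : Measurable (Function.uncurry g)) :
    Measurable fun ω => ∫ y, g ω y ∂(κ ω) := by
  let K : Kernel Ω X := ⟨κ, hκm⟩
  have : IsMarkovKernel K := ⟨hκ⟩
  exact (StronglyMeasurable.integral_kernel_prod_right (κ := K) hg.stronglyMeasurable).measurable

/-- Given m the target set D is frozen, so the conditional bound c may be integrated. This handles
both Gaussian deviations and oracle failures. -/
lemma HasCondLaw.measure_le [IsProbabilityMeasure μ] (hm : m ≤ mΩ)
    {Y : Ω → X} (hY : Measurable Y) {κ : Ω → Measure X} (hκ : ∀ ω, IsProbabilityMeasure (κ ω))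
    (h : HasCondLaw μ m Y κ) {D : Ω → Set X}
    (hD : MeasurableSet[m.prod inferInstance] {p : Ω × X | p.2 ∈ D p.1}) {c : ℝ≥0∞}
    (hc : ∀ ω, κ ω (D ω) ≤ c) : μ {ω | Y ω ∈ D ω} ≤ c := by
  have hDω : ∀ ω, MeasurableSet (D ω) := fun ω => (@measurable_prodMk_left Ω X m _ ω) hD
  have hDΩ : MeasurableSet {ω | Y ω ∈ D ω} :=
    (Measurable.prodMk (measurable_id'' hm) hY) hD
  have hf : Measurable[m.prod inferInstance]
      (Function.uncurry fun ω y => (D ω).indicator (1 : X → ℝ≥0∞) y) := by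
    have e : (Function.uncurry fun ω y => (D ω).indicator (1 : X → ℝ≥0∞) y)
        = Set.indicator {p : Ω × X | p.2 ∈ D p.1} 1 := by
      ext ⟨ω, y⟩
      by_cases hy : y ∈ D ω
      · simp [Function.uncurry, Set.indicator, hy]
      · simp [Function.uncurry, Set.indicator, hy]
    rw [e]
    refine Measurable.indicator ?_ hD
    exact measurable_const
  have h1 := h.lintegral_eq hm hY hκ hf
  have e1 : ∫⁻ ω, (D ω).indicator (1 : X → ℝ≥0∞) (Y ω) ∂μ = μ {ω | Y ω ∈ D ω} := by
    rw [← lintegral_indicator_one hDΩ]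
    refine lintegral_congr fun ω => ?_
    by_cases hy : Y ω ∈ D ω
    · simp [Set.indicator, hy]
    · simp [Set.indicator, hy]
  rw [← e1, h1]
  calc _ ≤ ∫⁻ _, c ∂μ := lintegral_mono fun ω => by
        rw [lintegral_indicator_one (hDω ω)]; exact hc ω
    _ = c := by simp

/-- The tower property: sampling `Z` from a kernel applied to `Y`. -/
lemma HasCondLaw.bind [IsProbabilityMeasure μ] {Z : Type*} [MeasurableSpace Z] (hm : m ≤ mΩ)
    (hmm' : m ≤ m')
    {Y : Ω → X} (hY : Measurable Y) {κ : Ω → Measure X} (hκ : ∀ ω, IsProbabilityMeasure (κ ω))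
    (h : HasCondLaw μ m Y κ) {U : Ω → Z} (K : Kernel X Z)
    (hU : HasCondLaw μ m' U (fun ω => K (Y ω))) :
    HasCondLaw μ m U (fun ω => (κ ω).bind K) := by
  refine ⟨(Measure.measurable_bind' K.measurable).comp h.1, fun s hs E hE => ?_⟩
  have hsΩ := hm _ hs
  rw [hU.2 s (hmm' _ hs) E hE, ← lintegral_indicator hsΩ, ← lintegral_indicator hsΩ]
  set f : Ω → X → ℝ≥0∞ := fun ω x => s.indicator 1 ω * K x E with hf
  have hsm : Measurable[m] (s.indicator (1 : Ω → ℝ≥0∞)) := by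
    refine Measurable.indicator ?_ hs
    exact measurable_const
  have hfm : Measurable[m.prod inferInstance] (Function.uncurry f) :=
    (hsm.comp (@measurable_fst Ω X m _)).mul
      ((K.measurable_coe hE).comp (@measurable_snd Ω X m _))
  have h1 := h.lintegral_eq hm hY hκ hfm
  calc _ = ∫⁻ ω, f ω (Y ω) ∂μ := lintegral_congr fun ω => by
        by_cases hω : ω ∈ s <;> simp [hf, Set.indicator, hω]
    _ = _ := h1
    _ = _ := lintegral_congr fun ω => by
        by_cases hω : ω ∈ s
        · simp [hf, Set.indicator, hω, Measure.bind_apply hE K.measurable.aemeasurable]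
        · simp [hf, Set.indicator, hω]

/-- With probability `1 - δ` the sum of conditional expectations of variables in `[0, b]` is at
most twice the realized sum plus `2 b log (1 / δ)`. -/
lemma measure_sum_integral_le [IsProbabilityMeasure μ] (ℱ : Filtration ℕ mΩ) {T : ℕ}
    {m : ℕ → MeasurableSpace Ω} {Y : ℕ → Ω → X}
    {κ : ℕ → Ω → Measure X} {g : ℕ → Ω → X → ℝ} {b δ : ℝ}
    (hle : ∀ t ∈ Finset.Icc 1 T, ℱ (t - 1) ≤ m t) (hle' : ∀ t ∈ Finset.Icc 1 T, m t ≤ ℱ t)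
    (hY : ∀ t ∈ Finset.Icc 1 T, Measurable[ℱ t] (Y t))
    (hκ : ∀ t ∈ Finset.Icc 1 T, ∀ ω, IsProbabilityMeasure (κ t ω))
    (hlaw : ∀ t ∈ Finset.Icc 1 T, HasCondLaw μ (m t) (Y t) (κ t))
    (hg : ∀ t ∈ Finset.Icc 1 T, Measurable[(m t).prod inferInstance] (Function.uncurry (g t)))
    (hg0 : ∀ t ∈ Finset.Icc 1 T, ∀ ω y, 0 ≤ g t ω y)
    (hgb : ∀ t ∈ Finset.Icc 1 T, ∀ ω y, g t ω y ≤ b) (hb : 0 < b) (hδ : 0 < δ) :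
    μ {ω | 2 * ∑ t ∈ Finset.Icc 1 T, g t ω (Y t ω) + 2 * b * Real.log (1 / δ)
        < ∑ t ∈ Finset.Icc 1 T, ∫ y, g t ω y ∂(κ t ω)} ≤ ENNReal.ofReal δ :=
  measure_sum_condExp_le ℱ hle hle' hY hκ hlaw hg hg0 hgb
    (fun t ht => measurable_integral_of_measurable_measure (m := m t) (hlaw t ht).1 (hκ t ht)
      (hg t ht))
    (fun _ _ _ => le_rfl) hb hδ

end CondLawTools

/-! ### Optimism through resampling. -/

section Optimism

variable {S A : Type*} [MeasurableSpace S] [MeasurableSpace A] {d : ℕ} {M : MDP S A d} {L : ℝ}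

/-- An optimistic sample, together with a near-optimal answer of the oracle, bounds the gap between
the true and any other plausible parameter. -/
lemma gap_le_of_optimistic [Nonempty (Policy M)] (hL : ∀ z, ‖M.feat z‖ ≤ L)
    {V : Matrix (Fin d) (Fin d) ℝ} (hV : V.PosDef) {θs θh θ θ' : EuclideanSpace ℝ (Fin d)}
    {β ρ ε : ℝ} {π₀ πs π' : Policy M} (hπs : optValue M θs - ε ≤ value M θs πs)
    (hconf : qnorm V (θs - θh) ≤ 2 * β)
    (hθ : qnorm V (θ - θh) ≤ ρ) (hθ' : qnorm V (θ' - θh) ≤ ρ)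
    (hopt : 2 * β * qnorm V⁻¹ (policyFeat M πs - policyFeat M π₀)
      ≤ ⟪policyFeat M πs - policyFeat M π₀, θ' - θh⟫)
    (hπ' : optValue M θ' - value M θ' π' ≤ ε) :
    (optValue M θs - value M θs π₀) - (optValue M θ - value M θ π₀) - 2 * ε
      ≤ 2 * ρ * qnorm V⁻¹ (policyFeat M π' - policyFeat M π₀) := by
  set u := policyFeat M πs - policyFeat M π₀ with hu
  set w := policyFeat M π' - policyFeat M π₀ with hw
  have h1 : ⟪θs - θh, u⟫ ≤ 2 * β * qnorm V⁻¹ u :=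
    (inner_le_qnorm_mul hV _ _).trans (mul_le_mul_of_nonneg_right hconf (qnorm_nonneg _ _))
  rw [real_inner_comm] at hopt
  have h2 : ⟪θs, u⟫ ≤ ⟪θ', u⟫ := by
    have := h1.trans hopt
    rw [inner_sub_left, inner_sub_left] at this
    linarith
  have h3 : qnorm V (θ' - θ) ≤ 2 * ρ := by
    have e : θ' - θ = (θ' - θh) - (θ - θh) := by abel
    rw [e]
    linarith [qnorm_sub_le hV (θ' - θh) (θ - θh)]
  have h4 : ⟪θ' - θ, w⟫ ≤ 2 * ρ * qnorm V⁻¹ w :=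
    (inner_le_qnorm_mul hV _ _).trans (mul_le_mul_of_nonneg_right h3 (qnorm_nonneg _ _))
  have h5 := value_le_optValue hL θ' πs
  have h6 := value_le_optValue hL θ π'
  -- With w = φ(π') - φ(π₀): the gap of π₀ under θs is at most ⟨θ', w⟩ + 2ε (near-optimality of πs,
  -- then of π'), while its gap under θ is at least ⟨θ, w⟩. Subtracting leaves ⟨θ' - θ, w⟩ + 2ε.
  simp only [value_eq_inner hL] at *
  simp only [hu, hw, inner_sub_left, inner_sub_right] at h2 h4 ⊢
  linarith

/-- Here θ is the realized sample, while the integral runs over a fresh sample and the oracle's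
answer to it. A fresh sample is optimistic and within ρ with probability at least `antiProb`/2, and
the oracle then succeeds with probability at least 4/5. On this event `gap_le_of_optimistic`
applies, and elsewhere the width is nonnegative; hence the factor 2/5. -/
lemma optimism_le_integral [Nonempty (Policy M)] (hL : ∀ z, ‖M.feat z‖ ≤ L)
    {V : Matrix (Fin d) (Fin d) ℝ} (hV : V.PosDef) {θs θh θ : EuclideanSpace ℝ (Fin d)}
    {β ρ ε δo : ℝ} (hβ : 0 ≤ β) (hρ : 0 ≤ ρ) (hε : 0 < ε) (hδo : δo ≤ 1 / 5) (π₀ : Policy M)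
    (K : Kernel (EuclideanSpace ℝ (Fin d)) (Policy M)) [IsMarkovKernel K]
    (hK : ∀ θ, ENNReal.ofReal (1 - δo) ≤ K θ {π | optValue M θ - value M θ π ≤ ε})
    (hconf : qnorm V (θs - θh) ≤ 2 * β)
    (htail : multivariateGaussian θh (β ^ 2 • V⁻¹) {θ | ρ < qnorm V (θ - θh)}
      ≤ ENNReal.ofReal (antiProb / 2))
    (hθ : qnorm V (θ - θh) ≤ ρ) :
    2 / 5 * antiProb *
      ((optValue M θs - value M θs π₀) - (optValue M θ - value M θ π₀) - 2 * ε)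
      ≤ 2 * ρ * ∫ π, qnorm V⁻¹ (policyFeat M π - policyFeat M π₀)
          ∂((multivariateGaussian θh (β ^ 2 • V⁻¹)).bind K) := by
  set N := multivariateGaussian θh (β ^ 2 • V⁻¹) with hN
  set D := (optValue M θs - value M θs π₀) - (optValue M θ - value M θ π₀) - 2 * ε with hD
  have hp := antiProb_pos
  have hFm : Measurable fun π => qnorm V⁻¹ (policyFeat M π - policyFeat M π₀) := by
    refine measurable_qnorm (A := fun _ => V⁻¹) (fun _ _ => measurable_const) ?_
    exact (measurable_policyFeat M).sub_const _
  have hI0 : 0 ≤ ∫ π, qnorm V⁻¹ (policyFeat M π - policyFeat M π₀) ∂(N.bind K) :=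
    integral_nonneg fun π => qnorm_nonneg _ _
  -- The case D ≤ 0 is trivial; D > 0 allows the averaging to be done in `ℝ≥0∞`.
  rcases le_or_gt D 0 with hD0 | hD0
  · exact (mul_nonpos_of_nonneg_of_nonpos (by positivity) hD0).trans (by positivity)
  obtain ⟨πs, hπs⟩ := exists_near_optimal (M := M) θs hε
  set u := policyFeat M πs - policyFeat M π₀ with hu
  set G : Set (EuclideanSpace ℝ (Fin d)) :=
    {θ' | 2 * β * qnorm V⁻¹ u ≤ ⟪u, θ' - θh⟫} ∩ {θ' | ρ < qnorm V (θ' - θh)}ᶜ with hG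
  have hGm : MeasurableSet G := by
    refine MeasurableSet.inter (measurableSet_le measurable_const (by fun_prop)) ?_
    refine (measurableSet_lt measurable_const ?_).compl
    exact measurable_qnorm (A := fun _ => V) (fun _ _ => measurable_const) (by fun_prop)
  have hGN : ENNReal.ofReal (antiProb / 2) ≤ N G := by
    have h1 := multivariateGaussian_anticoncentration hV hβ θh u
    have h2 : N {θ' | 2 * β * qnorm V⁻¹ u ≤ ⟪u, θ' - θh⟫}
        ≤ N G + N {θ' | ρ < qnorm V (θ' - θh)} := by
      refine (measure_mono fun x hx => ?_).trans (measure_union_le _ _)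
      by_cases hc : x ∈ {θ' | ρ < qnorm V (θ' - θh)}
      · exact Or.inr hc
      · exact Or.inl ⟨hx, hc⟩
    have h3 : ENNReal.ofReal (antiProb / 2) + ENNReal.ofReal (antiProb / 2)
        ≤ N G + ENNReal.ofReal (antiProb / 2) := by
      rw [← ENNReal.ofReal_add (by positivity) (by positivity), add_halves]
      exact h1.trans (h2.trans (add_le_add le_rfl htail))
    exact ENNReal.le_of_add_le_add_right ENNReal.ofReal_ne_top h3
  have hKm : ∀ θ', MeasurableSet {π | optValue M θ' - value M θ' π ≤ ε} := fun θ' => by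
    have h1 : Measurable fun π => value M θ' π := by
      simp only [value_eq_inner hL]
      have := measurable_policyFeat M
      fun_prop
    exact measurableSet_le (measurable_const.sub h1) measurable_const
  have hprob : IsProbabilityMeasure (N.bind K) := by
    refine ⟨?_⟩
    rw [Measure.bind_apply .univ K.measurable.aemeasurable]
    simp
  have hint : Integrable (fun π => 2 * ρ * qnorm V⁻¹ (policyFeat M π - policyFeat M π₀))
      (N.bind K) := by
    obtain ⟨R, hR⟩ := exists_qnorm_eq_norm hV.inv
    refine Integrable.of_bound (hFm.const_mul _).aestronglyMeasurable
      (2 * ρ * (‖R‖ * (2 * L * horizon M))) (Filter.Eventually.of_forall fun π => ?_)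
    rw [Real.norm_of_nonneg (mul_nonneg (by positivity) (qnorm_nonneg _ _)), hR]
    gcongr
    exact (R.le_opNorm _).trans (by gcongr; exact norm_policyFeat_sub_le hL _ _)
  have hmain : ENNReal.ofReal (2 / 5 * antiProb * D)
      ≤ ENNReal.ofReal (∫ π, 2 * ρ * qnorm V⁻¹ (policyFeat M π - policyFeat M π₀) ∂(N.bind K)) := by
    rw [ofReal_integral_eq_lintegral_ofReal hint (Filter.Eventually.of_forall fun π =>
      mul_nonneg (by positivity) (qnorm_nonneg _ _)),
      Measure.lintegral_bind K.measurable.aemeasurable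
        (hFm.const_mul _).ennreal_ofReal.aemeasurable]
    calc ENNReal.ofReal (2 / 5 * antiProb * D)
        = ENNReal.ofReal D * ENNReal.ofReal (4 / 5) * ENNReal.ofReal (antiProb / 2) := by
          rw [← ENNReal.ofReal_mul hD0.le, ← ENNReal.ofReal_mul (by positivity)]
          congr 1; ring
      _ ≤ ENNReal.ofReal D * ENNReal.ofReal (4 / 5) * N G := by gcongr
      _ = ∫⁻ _ in G, ENNReal.ofReal D * ENNReal.ofReal (4 / 5) ∂N := by rw [setLIntegral_const]
      _ ≤ ∫⁻ θ' in G, ∫⁻ π, ENNReal.ofReal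
            (2 * ρ * qnorm V⁻¹ (policyFeat M π - policyFeat M π₀)) ∂(K θ') ∂N := by
          refine setLIntegral_mono' hGm fun θ' hθ' => ?_
          calc ENNReal.ofReal D * ENNReal.ofReal (4 / 5)
              ≤ ENNReal.ofReal D * K θ' {π | optValue M θ' - value M θ' π ≤ ε} := by
                gcongr
                exact (ENNReal.ofReal_le_ofReal (by linarith)).trans (hK θ')
            _ = ∫⁻ _ in {π | optValue M θ' - value M θ' π ≤ ε}, ENNReal.ofReal D ∂(K θ') := by
                rw [setLIntegral_const]
            _ ≤ ∫⁻ π in {π | optValue M θ' - value M θ' π ≤ ε}, ENNReal.ofReal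
                  (2 * ρ * qnorm V⁻¹ (policyFeat M π - policyFeat M π₀)) ∂(K θ') := by
                refine setLIntegral_mono' (hKm θ') fun π hπ => ENNReal.ofReal_le_ofReal ?_
                exact gap_le_of_optimistic hL hV hπs hconf hθ (not_lt.1 hθ'.2) hθ'.1 hπ
            _ ≤ _ := setLIntegral_le_lintegral _ _
      _ ≤ _ := setLIntegral_le_lintegral _ _
  rw [integral_const_mul] at hmain
  exact (ENNReal.ofReal_le_ofReal_iff (by positivity)).1 hmain

/-- The instantaneous regret of a near-optimal policy for a plausible sampled parameter. -/
lemma instant_regret_le [Nonempty (Policy M)] (hL : ∀ z, ‖M.feat z‖ ≤ L)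
    {V : Matrix (Fin d) (Fin d) ℝ} (hV : V.PosDef) {θs θh θ : EuclideanSpace ℝ (Fin d)}
    {β ρ ε I : ℝ} {π₀ π : Policy M}
    (hgap : 2 / 5 * antiProb *
      ((optValue M θs - value M θs π₀) - (optValue M θ - value M θ π₀) - 2 * ε) ≤ 2 * ρ * I)
    (hconf : qnorm V (θs - θh) ≤ 2 * β) (hθ : qnorm V (θ - θh) ≤ ρ)
    (hπ : optValue M θ - value M θ π ≤ ε) :
    optValue M θs - value M θs π ≤ 3 * ε + 5 / antiProb * ρ * I
      + (ρ + 2 * β) * qnorm V⁻¹ (policyFeat M π - policyFeat M π₀) := by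
  have hp := antiProb_pos
  set w := policyFeat M π - policyFeat M π₀ with hw
  have h1 : qnorm V (θ - θs) ≤ ρ + 2 * β := by
    have e : θ - θs = (θ - θh) - (θs - θh) := by abel
    rw [e]
    linarith [qnorm_sub_le hV (θ - θh) (θs - θh)]
  have h2 : ⟪θ - θs, w⟫ ≤ (ρ + 2 * β) * qnorm V⁻¹ w :=
    (inner_le_qnorm_mul hV _ _).trans (mul_le_mul_of_nonneg_right h1 (qnorm_nonneg _ _))
  have h3 : (optValue M θs - value M θs π₀) - (optValue M θ - value M θ π₀) - 2 * ε
      ≤ 5 / antiProb * ρ * I := by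
    have e : 5 / antiProb * ρ * I = (2 * ρ * I) / (2 / 5 * antiProb) := by field_simp
    rw [e, le_div_iff₀ (by positivity)]
    linarith
  -- The regret of π under θs is the gap of π₀ under θs minus ⟨θs, w⟩, and the gap of π₀ under θ is
  -- at most ⟨θ, w⟩ + ε. The remaining 2ε comes from the optimism bound.
  simp only [value_eq_inner hL] at *
  simp only [hw, inner_sub_left, inner_sub_right] at h2 ⊢
  linarith

end Optimism

/-! ### Measurability and union bounds. -/

section Events

variable {d : ℕ}

lemma measurable_uncurry_qnorm {Ω X : Type*} {m : MeasurableSpace Ω} [MeasurableSpace X]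
    {A : Ω → Matrix (Fin d) (Fin d) ℝ} {v : Ω → EuclideanSpace ℝ (Fin d)}
    {f : X → EuclideanSpace ℝ (Fin d)}
    (hA : ∀ i j, Measurable fun ω => A ω i j) (hv : Measurable v) (hf : Measurable f) :
    Measurable (Function.uncurry fun ω x => qnorm (A ω) (f x - v ω)) :=
  measurable_qnorm (A := fun p : Ω × X => A p.1) (fun i j => (hA i j).comp measurable_fst)
    ((hf.comp measurable_snd).sub (hv.comp measurable_fst))

lemma measurableSet_uncurry_lt {Ω X : Type*} {m : MeasurableSpace Ω} [MeasurableSpace X] (c : ℝ)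
    {g : Ω → X → ℝ} (hg : Measurable (Function.uncurry g)) :
    MeasurableSet {p : Ω × X | p.2 ∈ {x | c < g p.1 x}} :=
  measurableSet_lt measurable_const hg

lemma measurable_suboptimality {S A : Type*} [MeasurableSpace S] [MeasurableSpace A]
    {M : MDP S A d} [Nonempty (Policy M)] {L : ℝ} (hL : ∀ z, ‖M.feat z‖ ≤ L) {Ω : Type*}
    {m : MeasurableSpace Ω} {θ : Ω → EuclideanSpace ℝ (Fin d)} (hθ : Measurable θ) :
    Measurable (Function.uncurry fun ω (π : Policy M) => optValue M (θ ω) - value M (θ ω) π) := by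
  have h1 : Measurable fun p : Ω × Policy M => optValue M (θ p.1) :=
    (continuous_optValue hL).measurable.comp (hθ.comp measurable_fst)
  have h2 : Measurable fun p : Ω × Policy M => ⟪θ p.1, policyFeat M p.2⟫ :=
    (hθ.comp measurable_fst).inner ((measurable_policyFeat M).comp measurable_snd)
  have e : (Function.uncurry fun ω (π : Policy M) => optValue M (θ ω) - value M (θ ω) π)
      = fun p => optValue M (θ p.1) - ⟪θ p.1, policyFeat M p.2⟫ := by
    funext p
    simp only [Function.uncurry, value_eq_inner hL]
  rw [e]
  exact h1.sub h2

lemma measure_exists_le {Ω : Type*} [MeasurableSpace Ω] {μ : Measure Ω} {T : ℕ} {s : ℕ → Set Ω}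
    {c : ℝ} (h : ∀ t ∈ Finset.Icc 1 T, μ (s t) ≤ ENNReal.ofReal c) :
    μ {ω | ∃ t ∈ Finset.Icc 1 T, ω ∈ s t} ≤ ENNReal.ofReal (T * c) := by
  have e : {ω | ∃ t ∈ Finset.Icc 1 T, ω ∈ s t} = ⋃ t ∈ Finset.Icc 1 T, s t := by
    ext ω; simp only [Set.mem_iUnion, exists_prop, Set.mem_ofPred_eq]
  rw [e]
  refine (measure_biUnion_finset_le _ _).trans ((Finset.sum_le_sum h).trans (le_of_eq ?_))
  rw [Finset.sum_const, Nat.card_Icc, Nat.add_sub_cancel, nsmul_eq_mul,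
    ENNReal.ofReal_mul (Nat.cast_nonneg T), ENNReal.ofReal_natCast]

end Events

/-! ### High-probability events of a run and the sum of instantaneous regrets. -/

namespace RegretRun

variable {S A : Type*} [MeasurableSpace S] [MeasurableSpace A] {d : ℕ} {M : MDP S A d}
  {θs : EuclideanSpace ℝ (Fin d)} {B L : ℝ}
  {O : ℝ → ℝ → Kernel (EuclideanSpace ℝ (Fin d)) (Policy M)} {T : ℕ} {δ lam : ℝ}
  {Ω : Type*} [mΩ : MeasurableSpace Ω] {μ : Measure Ω} {run : RegretRun M θs B L O T δ lam μ}
  {t : ℕ}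

lemma sampled_law (ht : t ∈ Finset.Icc 1 T) :
    HasCondLaw μ (run.ℱ (t - 1)) (run.θtil t) fun ω =>
      multivariateGaussian (run.θhat t ω) (beta M B L lam (δ / 5) t ^ 2 • (run.design t ω)⁻¹) :=
  run.θtil_law t ht

lemma measure_sample_far_le [IsProbabilityMeasure μ] (hd : 1 ≤ d) (hlam : 0 < lam) {η : ℝ}
    (hη : 0 < η) (hη1 : η ≤ 1) :
    μ {ω | ∃ t ∈ Finset.Icc 1 T, beta M B L lam (δ / 5) t * √(2 * d * Real.log (2 * d / η))
      < qnorm (run.design t ω) (run.θtil t ω - run.θhat t ω)} ≤ ENNReal.ofReal (T * η) := by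
  refine measure_exists_le fun t ht => ?_
  refine (sampled_law ht).measure_le (run.ℱ.le _) ((run.θtil_meas t ht).mono (run.ℱ.le _) le_rfl)
    (fun ω => inferInstance) (D := fun ω => {θ | beta M B L lam (δ / 5) t *
      √(2 * d * Real.log (2 * d / η)) < qnorm (run.design t ω) (θ - run.θhat t ω)}) ?_ fun ω => ?_
  · exact measurableSet_uncurry_lt (m := run.ℱ (t - 1)) _ (measurable_uncurry_qnorm
      (m := run.ℱ (t - 1)) (fun i j => measurable_design ht i j) (run.θhat_meas t ht) measurable_id)
  · exact multivariateGaussian_tail hd (design_posDef hlam t ω) (Real.sqrt_nonneg _) hη hη1 _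

lemma measurable_θtil_preOracle (t : ℕ) : Measurable[run.preOracle t] (run.θtil t) :=
  (comap_measurable (run.θtil t)).mono le_sup_right le_rfl

lemma measurable_pol_prev (ht : t ∈ Finset.Icc 1 T) : Measurable[run.ℱ (t - 1)] (run.pol (t - 1)) := by
  simp only [Finset.mem_Icc] at ht
  rcases Nat.eq_or_lt_of_le ht.1 with h | h
  · rw [← h]; exact run.pol_zero_meas
  · exact run.pol_meas (t - 1) (by simp; omega)

lemma measure_oracle_fails_le [IsProbabilityMeasure μ] [Nonempty (Policy M)]
    (hL : ∀ z, ‖M.feat z‖ ≤ L) {ε δo : ℝ} (hε : ε = 1 / √(T : ℝ)) (hδo : δo = δ / 5 / T)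
    [IsMarkovKernel (O ε δo)] (hO1 : δo ≤ 1)
    (hO : ∀ θ, ENNReal.ofReal (1 - δo) ≤ O ε δo θ {π | optValue M θ - value M θ π ≤ ε}) :
    μ {ω | ∃ t ∈ Finset.Icc 1 T,
      ε < optValue M (run.θtil t ω) - value M (run.θtil t ω) (run.pol t ω)}
      ≤ ENNReal.ofReal (T * δo) := by
  subst hε hδo
  refine measure_exists_le fun t ht => ?_
  have hlaw : HasCondLaw μ (run.preOracle t) (run.pol t) _ := run.pol_law t ht
  have hDm := measurableSet_uncurry_lt (m := run.preOracle t) (1 / √(T : ℝ))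
    (measurable_suboptimality (m := run.preOracle t) hL (measurable_θtil_preOracle (run := run) t))
  refine hlaw.measure_le ((preOracle_le ht).trans (run.ℱ.le _))
    ((run.pol_meas t ht).mono (run.ℱ.le _) le_rfl) (fun ω => inferInstance)
    (D := fun ω => {π | 1 / √(T : ℝ) < optValue M (run.θtil t ω) - value M (run.θtil t ω) π})
    hDm fun ω => ?_
  have hD : MeasurableSet
      {π | 1 / √(T : ℝ) < optValue M (run.θtil t ω) - value M (run.θtil t ω) π} :=
    (@measurable_prodMk_left Ω (Policy M) (run.preOracle t) _ ω) hDm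
  have e : {π | 1 / √(T : ℝ) < optValue M (run.θtil t ω) - value M (run.θtil t ω) π}
      = {π | optValue M (run.θtil t ω) - value M (run.θtil t ω) π ≤ 1 / √(T : ℝ)}ᶜ := by
    ext π; simp only [Set.mem_compl_iff, Set.mem_ofPred_eq, not_le]
  have hD' : MeasurableSet
      {π | optValue M (run.θtil t ω) - value M (run.θtil t ω) π ≤ 1 / √(T : ℝ)} := by
    rw [← compl_compl {π | optValue M (run.θtil t ω) - value M (run.θtil t ω) π ≤ 1 / √(T : ℝ)},
      ← e]
    exact hD.compl
  rw [e, prob_compl_eq_one_sub hD']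
  refine tsub_le_iff_right.2 ?_
  calc (1 : ℝ≥0∞) = ENNReal.ofReal (δ / 5 / T + (1 - δ / 5 / T)) := by simp
    _ ≤ ENNReal.ofReal (δ / 5 / T) + ENNReal.ofReal (1 - δ / 5 / T) := ENNReal.ofReal_add_le
    _ ≤ _ := by gcongr; exact hO _

/-- The conditional expectation of the exploration width of round `t`. -/
def meanWidth (run : RegretRun M θs B L O T δ lam μ) (t : ℕ) (ω : Ω) : ℝ :=
  ∫ π, qnorm (run.design t ω)⁻¹ (policyFeat M π - policyFeat M (run.pol (t - 1) ω))
    ∂((multivariateGaussian (run.θhat t ω)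
      (beta M B L lam (δ / 5) t ^ 2 • (run.design t ω)⁻¹)).bind (O (1 / √(T : ℝ)) (δ / 5 / T)))

/-- The exploration width of round `t`. -/
def width (run : RegretRun M θs B L O T δ lam μ) (t : ℕ) (ω : Ω) : ℝ :=
  qnorm (run.design t ω)⁻¹ (policyFeat M (run.pol t ω) - policyFeat M (run.pol (t - 1) ω))

/-- The added 1 keeps the bound positive when L = 0, as the concentration inequality requires b > 0.
-/
lemma width_le (hL : ∀ z, ‖M.feat z‖ ≤ L) (hlam : 0 < lam) (t : ℕ) (ω : Ω) (π π' : Policy M) :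
    qnorm (run.design t ω)⁻¹ (policyFeat M π - policyFeat M π')
      ≤ (2 * L * horizon M + 1) / √lam := by
  refine (qnorm_inv_designMatrix_le hlam _ t (norm_policyFeat_sub_le hL π π')).trans ?_
  gcongr
  linarith

/-- By the tower property π_t given `ℱ (t - 1)` has the law of the oracle's answer to a Gaussian
sample, so `meanWidth` is the conditional mean of `width`. -/
lemma measure_meanWidth_le [IsProbabilityMeasure μ] (hL : ∀ z, ‖M.feat z‖ ≤ L) (hL0 : 0 ≤ L)
    (hlam : 0 < lam) [IsMarkovKernel (O (1 / √(T : ℝ)) (δ / 5 / T))] {δ' : ℝ} (hδ' : 0 < δ') :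
    μ {ω | 2 * ∑ t ∈ Finset.Icc 1 T, run.width t ω
        + 2 * ((2 * L * horizon M + 1) / √lam) * Real.log (1 / δ')
        < ∑ t ∈ Finset.Icc 1 T, run.meanWidth t ω} ≤ ENNReal.ofReal δ' := by
  have hH := one_le_horizon M
  refine measure_sum_integral_le run.ℱ (m := fun t => run.ℱ (t - 1)) (Y := run.pol)
    (κ := fun t ω => (multivariateGaussian (run.θhat t ω)
      (beta M B L lam (δ / 5) t ^ 2 • (run.design t ω)⁻¹)).bind (O (1 / √(T : ℝ)) (δ / 5 / T)))
    (g := fun t ω π => qnorm (run.design t ω)⁻¹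
      (policyFeat M π - policyFeat M (run.pol (t - 1) ω)))
    (fun t ht => le_rfl) (fun t ht => run.ℱ.mono (by omega)) (fun t ht => run.pol_meas t ht)
    (fun t ht ω => ⟨?_⟩) (fun t ht => ?_) (fun t ht => ?_) (fun t ht ω π => qnorm_nonneg _ _)
    (fun t ht ω π => width_le hL hlam t ω _ _) (by positivity) hδ'
  · rw [Measure.bind_apply .univ (Kernel.measurable _).aemeasurable]
    simp only [measure_univ, lintegral_const, mul_one]
  · exact (sampled_law ht).bind (run.ℱ.le _) (run.le_preOracle t)
      ((run.θtil_meas t ht).mono (run.ℱ.le _) le_rfl) (fun ω => inferInstance)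
      (O (1 / √(T : ℝ)) (δ / 5 / T)) (run.pol_law t ht)
  · exact measurable_uncurry_qnorm (m := run.ℱ (t - 1)) (fun i j => measurable_design_inv ht i j)
      ((measurable_policyFeat M).comp (measurable_pol_prev ht)) (measurable_policyFeat M)

/-- Conditioning takes place after both policies are fixed. By Jensen the width is at most the
conditional mean of ‖x_t‖ in the norm of V_t⁻¹, where V_t is already determined. -/
lemma measure_width_le [IsProbabilityMeasure μ] (hL : ∀ z, ‖M.feat z‖ ≤ L) (hL0 : 0 ≤ L)
    (hlam : 0 < lam) {δ' : ℝ} (hδ' : 0 < δ') :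
    μ {ω | 2 * ∑ t ∈ Finset.Icc 1 T, qnorm (run.design t ω)⁻¹ (run.featDiff ω t)
        + 2 * ((2 * L * horizon M + 1) / √lam) * Real.log (1 / δ')
        < ∑ t ∈ Finset.Icc 1 T, run.width t ω} ≤ ENNReal.ofReal δ' := by
  have hH := one_le_horizon M
  have h := measure_sum_integral_le (μ := μ) run.ℱ (T := T) (m := fun t => run.preTraj t)
    (Y := run.traj)
    (κ := fun t ω => (trajLaw M (run.pol t ω)).prod (trajLaw M (run.pol (t - 1) ω)))
    (g := fun t ω p => qnorm (run.design t ω)⁻¹ (trajFeat M p.1 - trajFeat M p.2))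
    (b := (2 * L * horizon M + 1) / √lam) (δ := δ')
    (fun t ht => run.le_preTraj t) (fun t ht => preTraj_le ht) (fun t ht => run.traj_meas t ht)
    (fun t ht ω => inferInstance) (fun t ht => run.traj_law t ht) (fun t ht => ?_)
    (fun t ht ω π => qnorm_nonneg _ _)
    (fun t ht ω p => ?_) (by positivity) hδ'
  · refine (measure_mono fun ω hω => ?_).trans h
    simp only [Set.mem_ofPred_eq] at hω ⊢
    refine hω.trans_le (Finset.sum_le_sum fun t ht => ?_)
    exact qnorm_policyFeat_sub_le hL (design_posDef hlam t ω).inv _ _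
  · have h0 := measurable_uncurry_qnorm (m := run.preTraj t) (v := fun _ => 0)
      (fun i j => (measurable_design_inv (run := run) ht i j).mono (run.le_preTraj t) le_rfl)
      measurable_const (measurable_pairFeat (M := M))
    simpa only [sub_zero] using h0
  · refine (qnorm_inv_designMatrix_le hlam _ t (norm_trajFeat_sub_le hL p.1 p.2)).trans ?_
    gcongr
    linarith

/-- Cauchy–Schwarz over the rounds, followed by the elliptical potential lemma. -/
lemma sum_featDiff_le (hd : 1 ≤ d) (hL : ∀ z, ‖M.feat z‖ ≤ L) (hlam : 0 < lam) (ω : Ω) :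
    ∑ t ∈ Finset.Icc 1 T, qnorm (run.design t ω)⁻¹ (run.featDiff ω t)
      ≤ √(T * ((1 + (2 * L * horizon M) ^ 2 / lam) *
        (d * Real.log (d + T * (2 * L * horizon M) ^ 2 / lam)))) := by
  have h1 := sum_qnorm_inv_sq_le hlam hd (T := T) (x := run.featDiff ω)
    (fun t _ => norm_featDiff_le hL ω t)
  refine Real.le_sqrt_of_sq_le ?_
  refine (sq_sum_le_card_mul_sum_sq).trans ?_
  rw [Nat.card_Icc, Nat.add_sub_cancel]
  gcongr
  exact h1

/-- The high-probability bound on the regret of the policies `π_1, …, π_T`. -/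
lemma sum_instant_regret_le [IsProbabilityMeasure μ] (hd : 1 ≤ d) (hT : 1 ≤ T)
    (hθs : ‖θs‖ ≤ B) (hL : ∀ z, ‖M.feat z‖ ≤ L) (hL0 : 0 ≤ L) (hO : IsPACOracle M O)
    (hδ : 0 < δ) (hδ1 : δ < 1) (hlam : 0 < lam) {ρ : ℝ}
    (hρ : ∀ t ∈ Finset.Icc 1 T, beta M B L lam (δ / 5) t ≤ ρ)
    (hρ' : ∀ t ∈ Finset.Icc 1 T, beta M B L lam (δ / 5) t *
      √(2 * d * Real.log (2 * d / (δ / 5 * antiProb / (2 * T)))) ≤ ρ) :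
    ENNReal.ofReal (1 - δ) ≤ μ {ω | ∑ t ∈ Finset.Icc 1 T, (optValue M θs - value M θs (run.pol t ω))
      ≤ 3 * √T + (10 / antiProb + 3) * ρ * (2 * √(T * ((1 + (2 * L * horizon M) ^ 2 / lam) *
          (d * Real.log (d + T * (2 * L * horizon M) ^ 2 / lam))))
        + 4 * ((2 * L * horizon M + 1) / √lam) * Real.log (5 / δ))} := by
  have hp := antiProb_pos
  have hp1 := antiProb_le_one
  have hH := one_le_horizon M
  have hT0 : (0 : ℝ) < T := by exact_mod_cast hT
  have hT1 : (1 : ℝ) ≤ T := by exact_mod_cast hT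
  have hΩ : Nonempty Ω := nonempty_of_isProbabilityMeasure μ
  have hpol : Nonempty (Policy M) := ⟨run.pol 0 hΩ.some⟩
  set ε := 1 / √(T : ℝ) with hε
  set δo := δ / 5 / T with hδo
  -- One choice serves two purposes: Tη ≤ δ/5 for the union bound over samples, and η ≤ `antiProb`/2
  -- so that truncation leaves half of the optimistic probability.
  set η := δ / 5 * antiProb / (2 * T) with hη
  have hε0 : 0 < ε := by positivity
  have hδo0 : 0 < δo := by positivity
  have hδo1 : δo ≤ 1 / 5 := by
    rw [hδo, div_le_iff₀ hT0]; linarith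
  have hη0 : 0 < η := by positivity
  have hη1 : η ≤ antiProb / 2 := by
    rw [hη, div_le_iff₀ (by positivity)]
    have : δ / 5 ≤ T := by linarith
    nlinarith
  obtain ⟨hMarkov, hO'⟩ := hO ε δo hε0 hδo0 (by linarith)
  -- Five bad events of probability at most δ/5 each: θs leaves an ellipsoid, a sample is far from
  -- its mean, the oracle fails, and the two concentration inequalities fail.
  set E1 := {ω | ∃ t ∈ Finset.Icc 1 T,
    2 * beta M B L lam (δ / 5) t < qnorm (run.design t ω) (θs - run.θhat t ω)} with hE1
  set E2 := {ω | ∃ t ∈ Finset.Icc 1 T, beta M B L lam (δ / 5) t * √(2 * d * Real.log (2 * d / η))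
      < qnorm (run.design t ω) (run.θtil t ω - run.θhat t ω)} with hE2
  set E3 := {ω | ∃ t ∈ Finset.Icc 1 T,
      ε < optValue M (run.θtil t ω) - value M (run.θtil t ω) (run.pol t ω)} with hE3
  set E4 := {ω | 2 * ∑ t ∈ Finset.Icc 1 T, run.width t ω
        + 2 * ((2 * L * horizon M + 1) / √lam) * Real.log (1 / (δ / 5))
        < ∑ t ∈ Finset.Icc 1 T, run.meanWidth t ω} with hE4
  set E5 := {ω | 2 * ∑ t ∈ Finset.Icc 1 T, qnorm (run.design t ω)⁻¹ (run.featDiff ω t)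
        + 2 * ((2 * L * horizon M + 1) / √lam) * Real.log (1 / (δ / 5))
        < ∑ t ∈ Finset.Icc 1 T, run.width t ω} with hE5
  have hm1 : μ E1 ≤ ENNReal.ofReal (δ / 5) :=
    measure_not_confident_le hd hL hL0 hθs hlam (by positivity) (by linarith)
  have hm2 : μ E2 ≤ ENNReal.ofReal (δ / 5) := by
    refine (measure_sample_far_le hd hlam hη0 (by linarith)).trans (ENNReal.ofReal_le_ofReal ?_)
    have e : T * η = δ / 5 * (antiProb / 2) := by rw [hη]; field_simp
    rw [e]
    nlinarith
  have hm3 : μ E3 ≤ ENNReal.ofReal (δ / 5) := by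
    refine (measure_oracle_fails_le hL hε hδo (by linarith) hO').trans (ENNReal.ofReal_le_ofReal ?_)
    rw [hδo]
    exact le_of_eq (by field_simp)
  have hm4 : μ E4 ≤ ENNReal.ofReal (δ / 5) := measure_meanWidth_le hL hL0 hlam (by positivity)
  have hm5 : μ E5 ≤ ENNReal.ofReal (δ / 5) := measure_width_le hL hL0 hlam (by positivity)
  set Good := {ω | ∑ t ∈ Finset.Icc 1 T, (optValue M θs - value M θs (run.pol t ω))
      ≤ 3 * √T + (10 / antiProb + 3) * ρ * (2 * √(T * ((1 + (2 * L * horizon M) ^ 2 / lam) *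
          (d * Real.log (d + T * (2 * L * horizon M) ^ 2 / lam))))
        + 4 * ((2 * L * horizon M + 1) / √lam) * Real.log (5 / δ))} with hGood
  -- Covering the whole space and using subadditivity avoids any measurability of `Good`.
  have hcover : Set.univ ⊆ Good ∪ (E1 ∪ (E2 ∪ (E3 ∪ (E4 ∪ E5)))) := by
    intro ω _
    by_contra hcon
    simp only [Set.mem_union, not_or] at hcon
    obtain ⟨h0, h1, h2, h3, h4, h5⟩ := hcon
    refine h0 ?_
    simp only [hE1, hE2, hE3, hE4, hE5, Set.mem_ofPred_eq, not_exists, not_and, not_lt]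
      at h1 h2 h3 h4 h5
    have hβ0 : ∀ t, 0 ≤ beta M B L lam (δ / 5) t := fun t => Real.sqrt_nonneg _
    have hρ0 : 0 ≤ ρ := (hβ0 1).trans (hρ 1 (by simp; omega))
    have hround : ∀ t ∈ Finset.Icc 1 T, optValue M θs - value M θs (run.pol t ω)
        ≤ 3 * ε + 5 / antiProb * ρ * run.meanWidth t ω + 3 * ρ * run.width t ω := fun t ht => by
      have hV := design_posDef (run := run) hlam t ω
      have hr0 : 0 ≤ beta M B L lam (δ / 5) t * √(2 * d * Real.log (2 * d / η)) :=
        mul_nonneg (hβ0 t) (Real.sqrt_nonneg _)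
      have htail := (multivariateGaussian_tail hd hV (hβ0 t) hη0 (by linarith)
        (run.θhat t ω)).trans (ENNReal.ofReal_le_ofReal hη1)
      have hgap := optimism_le_integral hL hV (hβ0 t) hr0 hε0 hδo1 (run.pol (t - 1) ω)
        (O ε δo) hO' (h1 t ht) htail (h2 t ht)
      have hreg := instant_regret_le hL hV hgap (h1 t ht) (h2 t ht) (h3 t ht)
      have hW0 : 0 ≤ run.meanWidth t ω := integral_nonneg fun π => qnorm_nonneg _ _
      have hw0 : 0 ≤ run.width t ω := qnorm_nonneg _ _
      refine hreg.trans ?_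
      have hb := hρ t ht
      have hb' := hρ' t ht
      refine add_le_add (add_le_add le_rfl ?_) ?_
      · exact mul_le_mul_of_nonneg_right (mul_le_mul_of_nonneg_left hb' (by positivity)) hW0
      · exact mul_le_mul_of_nonneg_right (by linarith) hw0
    have hsum := Finset.sum_le_sum hround
    rw [Finset.sum_add_distrib, Finset.sum_add_distrib, ← Finset.mul_sum, ← Finset.mul_sum,
      ← Finset.mul_sum,      Finset.sum_const, Nat.card_Icc, Nat.add_sub_cancel, nsmul_eq_mul] at hsum
    have hεT : 3 * ((T : ℝ) * ε) = 3 * √T := by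
      rw [hε]
      have : √(T : ℝ) * √T = T := Real.mul_self_sqrt hT0.le
      field_simp
      linarith
    rw [hεT] at hsum
    have hX := sum_featDiff_le (run := run) hd hL hlam ω
    set Φ := √(T * ((1 + (2 * L * horizon M) ^ 2 / lam) *
        (d * Real.log (d + T * (2 * L * horizon M) ^ 2 / lam)))) with hΦ
    rw [one_div_div] at h4 h5
    have hlog : 0 ≤ Real.log (5 / δ) := Real.log_nonneg (by rw [le_div_iff₀ hδ]; linarith)
    set b := (2 * L * horizon M + 1) / √lam with hb
    have hb0 : 0 ≤ b := by positivity
    have hbl : 0 ≤ b * Real.log (5 / δ) := mul_nonneg hb0 hlog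
    have hY : ∑ t ∈ Finset.Icc 1 T, run.width t ω ≤ 2 * Φ + 4 * b * Real.log (5 / δ) := by
      linarith
    have hW : ∑ t ∈ Finset.Icc 1 T, run.meanWidth t ω ≤ 2 * (2 * Φ + 4 * b * Real.log (5 / δ)) := by
      linarith
    simp only [hGood, Set.mem_ofPred_eq]
    refine hsum.trans ?_
    have hA1 := mul_le_mul_of_nonneg_left hW (show 0 ≤ 5 / antiProb * ρ by positivity)
    have hA2 := mul_le_mul_of_nonneg_left hY (show 0 ≤ 3 * ρ by positivity)
    have e : (10 / antiProb + 3) * ρ * (2 * Φ + 4 * b * Real.log (5 / δ))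
        = 5 / antiProb * ρ * (2 * (2 * Φ + 4 * b * Real.log (5 / δ)))
          + 3 * ρ * (2 * Φ + 4 * b * Real.log (5 / δ)) := by ring
    linarith
  have hbad : μ (E1 ∪ (E2 ∪ (E3 ∪ (E4 ∪ E5)))) ≤ ENNReal.ofReal δ := by
    have e : δ = δ / 5 + (δ / 5 + (δ / 5 + (δ / 5 + δ / 5))) := by ring
    have hd5 : 0 ≤ δ / 5 := by positivity
    rw [e, ENNReal.ofReal_add hd5 (by positivity), ENNReal.ofReal_add hd5 (by positivity),
      ENNReal.ofReal_add hd5 (by positivity), ENNReal.ofReal_add hd5 hd5]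
    refine (measure_union_le _ _).trans (add_le_add hm1 ?_)
    refine (measure_union_le _ _).trans (add_le_add hm2 ?_)
    refine (measure_union_le _ _).trans (add_le_add hm3 ?_)
    exact (measure_union_le _ _).trans (add_le_add hm4 hm5)
  have h1 : (1 : ℝ≥0∞) ≤ μ Good + ENNReal.ofReal δ := by
    rw [← measure_univ (μ := μ)]
    exact (measure_mono hcover).trans ((measure_union_le _ _).trans (add_le_add le_rfl hbad))
  rw [ENNReal.ofReal_sub _ hδ.le, ENNReal.ofReal_one]
  exact tsub_le_iff_right.2 h1

end RegretRun

/-! ### From the regrets of π_1, …, π_T to the cumulative regret. -/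

section Regret

variable {S A : Type*} [MeasurableSpace S] [MeasurableSpace A] {d : ℕ} {M : MDP S A d} {L : ℝ}

lemma suboptimality_le [Nonempty (Policy M)] (hL : ∀ z, ‖M.feat z‖ ≤ L)
    (θ : EuclideanSpace ℝ (Fin d)) (π : Policy M) :
    optValue M θ - value M θ π ≤ 2 * (‖θ‖ * (L * horizon M)) := by
  have h1 := optValue_le hL θ
  have h2 := (abs_le.1 (abs_value_le hL θ π)).1
  linarith

/-- As π'_t = π_{t-1}, the second half of the regret is the same sum shifted by one round; the
excess is at most half the suboptimality of π_0. -/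
lemma regret_le_sum [Nonempty (Policy M)] (hL : ∀ z, ‖M.feat z‖ ≤ L)
    (θ : EuclideanSpace ℝ (Fin d)) (T : ℕ) (π : ℕ → Policy M) :
    regret M θ T π ≤ ∑ t ∈ Finset.Icc 1 T, (optValue M θ - value M θ (π t))
      + ‖θ‖ * (L * horizon M) := by
  set f : ℕ → ℝ := fun t => optValue M θ - value M θ (π t) with hf
  have hf0 : ∀ t, 0 ≤ f t := fun t => sub_nonneg.2 (value_le_optValue hL θ _)
  have htel : ∀ n : ℕ, ∑ t ∈ Finset.Icc 1 n, f (t - 1) + f n = f 0 + ∑ t ∈ Finset.Icc 1 n, f t := by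
    intro n
    induction n with
    | zero => simp
    | succ n ih =>
      rw [Finset.sum_Icc_succ_top (by omega), Finset.sum_Icc_succ_top (by omega),
        Nat.add_sub_cancel]
      linarith
  have e : regret M θ T π = 1 / 2 * (∑ t ∈ Finset.Icc 1 T, f t + ∑ t ∈ Finset.Icc 1 T, f (t - 1)) := by
    rw [regret, ← Finset.sum_add_distrib]
    congr 1
    refine Finset.sum_congr rfl fun t _ => ?_
    simp only [hf]; ring
  have h0 : f 0 ≤ 2 * (‖θ‖ * (L * horizon M)) := suboptimality_le hL θ (π 0)
  rw [e]
  linarith [htel T, hf0 T]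

lemma regret_le_trivial [Nonempty (Policy M)] (hL : ∀ z, ‖M.feat z‖ ≤ L)
    (θ : EuclideanSpace ℝ (Fin d)) (T : ℕ) (π : ℕ → Policy M) :
    regret M θ T π ≤ T * (2 * (‖θ‖ * (L * horizon M))) := by
  have h : ∑ t ∈ Finset.Icc 1 T, (2 * optValue M θ - value M θ (π t) - value M θ (π (t - 1)))
      ≤ ∑ t ∈ Finset.Icc 1 T, 4 * (‖θ‖ * (L * horizon M)) := by
    refine Finset.sum_le_sum fun t _ => ?_
    have h1 := suboptimality_le hL θ (π t)
    have h2 := suboptimality_le hL θ (π (t - 1))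
    linarith
  rw [Finset.sum_const, Nat.card_Icc, Nat.add_sub_cancel, nsmul_eq_mul] at h
  rw [regret]
  linarith

end Regret

/-! ### Explicit constants; P bounds all scale parameters and ℓ = log(dT/δ). -/

section Numerics

lemma log_le_self_of_one_le {x : ℝ} (hx : 1 ≤ x) : Real.log x ≤ x :=
  (Real.log_le_sub_one_of_pos (by linarith)).trans (by linarith)

lemma half_le_log {x : ℝ} (hx : 2 ≤ x) : 1 / 2 ≤ Real.log x := by
  have h1 := Real.log_le_log (by norm_num) hx
  linarith [Real.log_two_gt_d9]

lemma log_five_div_le {δ ℓ : ℝ} (hδ : 0 < δ) (hℓ : 1 / 2 ≤ ℓ) (hlog : Real.log (1 / δ) ≤ ℓ) :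
    Real.log (5 / δ) ≤ 5 * ℓ := by
  have h5 : Real.log 5 ≤ 2 := by
    rw [Real.log_le_iff_le_exp (by norm_num)]
    have h := Real.add_one_le_exp (1 : ℝ)
    have h2 : Real.exp 2 = Real.exp 1 * Real.exp 1 := by rw [← Real.exp_add]; norm_num
    rw [h2]
    nlinarith [Real.exp_one_gt_d9]
  have e : (5 : ℝ) / δ = 5 * (1 / δ) := by ring
  rw [e, Real.log_mul (by norm_num) (by positivity)]
  linarith

lemma log_mul_pow_le {c x P ℓ : ℝ} (n : ℕ) (hc : 0 < c) (hx : 0 < x) (hP : 1 ≤ P)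
    (hx' : Real.log x ≤ ℓ) : Real.log (c * x * P ^ n) ≤ Real.log c + ℓ + n * P := by
  rw [Real.log_mul (by positivity) (by positivity), Real.log_mul hc.ne' hx.ne', Real.log_pow]
  have := log_le_self_of_one_le hP
  gcongr

lemma log_capped_le {B L H D T t P ℓ : ℝ} (hB : 0 ≤ B) (hL : 0 ≤ L) (hH : 0 ≤ H) (hD : 1 ≤ D)
    (ht : 1 ≤ t) (htT : t ≤ T) (hP : 1 ≤ P) (hBP : B ≤ P) (hLP : L ≤ P) (hHP : H ≤ P)
    (hℓ : 1 / 2 ≤ ℓ) (hT : Real.log T ≤ ℓ) :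
    Real.log (max (Real.exp 1) (4 * Real.exp 1 * B * L * H * (t - 1) / D)) ≤ 14 * P * ℓ := by
  have he := Real.exp_pos 1
  have he3 : Real.exp 1 < 3 := Real.exp_one_lt_three
  have hT1 : 1 ≤ T := ht.trans htT
  have hP3 : 1 ≤ P ^ 3 := one_le_pow₀ hP
  have hBLH : B * L * H ≤ P ^ 3 := by
    calc B * L * H ≤ P * P * P := by gcongr
      _ = P ^ 3 := by ring
  have hmax : max (Real.exp 1) (4 * Real.exp 1 * B * L * H * (t - 1) / D)
      ≤ (4 * Real.exp 1) * T * P ^ 3 := by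
    have hTP : 1 ≤ T * P ^ 3 := one_le_mul_of_one_le_of_one_le hT1 hP3
    refine max_le (by nlinarith) ?_
    refine (div_le_self (mul_nonneg (by positivity) (by linarith)) hD).trans ?_
    calc 4 * Real.exp 1 * B * L * H * (t - 1) = 4 * Real.exp 1 * ((B * L * H) * (t - 1)) := by ring
      _ ≤ 4 * Real.exp 1 * (P ^ 3 * T) := by gcongr; linarith
      _ = _ := by ring
  have h1 := Real.log_le_log (lt_of_lt_of_le he (le_max_left _ _)) hmax
  have h2 := log_mul_pow_le 3 (c := 4 * Real.exp 1) (x := T) (by positivity) (by linarith) hP hT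
  have h3 : Real.log (4 * Real.exp 1) ≤ 3 := by
    rw [Real.log_mul (by norm_num) he.ne', Real.log_exp]
    have : Real.log 4 = 2 * Real.log 2 := by
      rw [show (4 : ℝ) = 2 ^ 2 by norm_num, Real.log_pow]; norm_num
    rw [this]
    linarith [Real.log_two_lt_d9]
  push_cast at h2
  nlinarith

/-- The 21 is 5 + 14 + 2: confidence level, capped logarithm, and regularization. The last is
absorbed by means of κ ≥ 4 and 2ℓ ≥ 1. -/
lemma beta_sq_le {S A : Type*} [MeasurableSpace S] [MeasurableSpace A] {d : ℕ} {M : MDP S A d}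
    {B L lam δ P ℓ : ℝ} {T t : ℕ} (hB : 0 ≤ B) (hL : 0 ≤ L) (hlam : 0 < lam) (hd : 1 ≤ d)
    (ht : t ∈ Finset.Icc 1 T) (hδ : 0 < δ) (hδ1 : δ < 1) (hP : 1 ≤ P) (hBP : B ≤ P) (hLP : L ≤ P)
    (hHP : horizon M ≤ P) (hlamP : lam ≤ P) (hℓ : 1 / 2 ≤ ℓ) (hT : Real.log T ≤ ℓ)
    (hlog : Real.log (1 / δ) ≤ ℓ) :
    beta M B L lam (δ / 5) t ^ 2 ≤ 21 * (kappa M B L * d * P ^ 3 * ℓ) := by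
  have hH := one_le_horizon M
  have hκ := four_le_kappa M hB hL
  simp only [Finset.mem_Icc] at ht
  have hd1 : (1 : ℝ) ≤ d := by exact_mod_cast hd
  have h5 : Real.log (1 / (δ / 5)) ≤ 5 * ℓ := by
    rw [one_div_div]; exact log_five_div_le hδ hℓ hlog
  have h50 : 0 ≤ Real.log (1 / (δ / 5)) := by
    rw [one_div_div]; exact Real.log_nonneg (by rw [le_div_iff₀ hδ]; linarith)
  have hcap := log_capped_le (B := B) (L := L) (H := horizon M) (D := d) (T := T) (t := t) (P := P)
    (ℓ := ℓ) hB hL (by linarith) hd1 (by exact_mod_cast ht.1) (by exact_mod_cast ht.2) hP hBP hLP hHP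
    hℓ hT
  have hcap0 : 0 ≤ Real.log (max (Real.exp 1)
      (4 * Real.exp 1 * B * L * horizon M * ((t : ℝ) - 1) / d)) :=
    Real.log_nonneg ((Real.one_le_exp zero_le_one).trans (le_max_left _ _))
  rw [beta, Real.sq_sqrt (by positivity)]
  have hPP : P ≤ P ^ 3 := le_self_pow₀ hP (by norm_num)
  have hP3 : 1 ≤ P ^ 3 := one_le_pow₀ hP
  have hX : 1 ≤ d * P ^ 3 := one_le_mul_of_one_le_of_one_le hd1 hP3
  have h1 : Real.log (1 / (δ / 5)) ≤ 5 * (d * P ^ 3 * ℓ) := by nlinarith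
  have h2 : d * Real.log (max (Real.exp 1)
      (4 * Real.exp 1 * B * L * horizon M * ((t : ℝ) - 1) / d)) ≤ 14 * (d * P ^ 3 * ℓ) := by
    calc _ ≤ (d : ℝ) * (14 * P * ℓ) := by gcongr
      _ ≤ (d : ℝ) * (14 * P ^ 3 * ℓ) := by gcongr
      _ = _ := by ring
  have h3 : 4 * lam * B ^ 2 ≤ 2 * (kappa M B L * (d * P ^ 3 * ℓ)) := by
    have h4 : lam * B ^ 2 ≤ P ^ 3 := by
      calc lam * B ^ 2 ≤ P * P ^ 2 := by gcongr
        _ = P ^ 3 := by ring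
    have h6 : P ^ 3 ≤ 2 * (d * P ^ 3 * ℓ) := by
      have : P ^ 3 * 1 ≤ P ^ 3 * (d * (2 * ℓ)) := by
        gcongr
        exact one_le_mul_of_one_le_of_one_le hd1 (by linarith)
      linarith
    have h7 : 4 * (d * P ^ 3 * ℓ) ≤ kappa M B L * (d * P ^ 3 * ℓ) := by gcongr
    linarith
  have h4 : kappa M B L * (Real.log (1 / (δ / 5)) + d * Real.log (max (Real.exp 1)
      (4 * Real.exp 1 * B * L * horizon M * ((t : ℝ) - 1) / d)))
      ≤ kappa M B L * (5 * (d * P ^ 3 * ℓ) + 14 * (d * P ^ 3 * ℓ)) := by gcongr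
  linarith

lemma potential_le {b lam D T P ℓ : ℝ} (hD : 1 ≤ D) (hT : 1 ≤ T) (hP : 1 ≤ P)
    (hb : b ^ 2 / lam ≤ 4 * P ^ 5) (hb0 : 0 ≤ b ^ 2 / lam) (hℓ : 1 / 2 ≤ ℓ)
    (hDT : Real.log (D * T) ≤ ℓ) :
    √(T * ((1 + b ^ 2 / lam) * (D * Real.log (D + T * b ^ 2 / lam)))) ≤ 9 * P ^ 3 * √(D * T * ℓ) := by
  have hP5 : 1 ≤ P ^ 5 := one_le_pow₀ hP
  have hTb : T * b ^ 2 / lam = T * (b ^ 2 / lam) := by ring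
  have harg : D + T * b ^ 2 / lam ≤ 5 * (D * T) * P ^ 5 := by
    rw [hTb]
    have h1 : T * (b ^ 2 / lam) ≤ T * (4 * P ^ 5) := by gcongr
    have h2 : T * (4 * P ^ 5) ≤ D * (T * (4 * P ^ 5)) := le_mul_of_one_le_left (by positivity) hD
    have h3 : D * 1 ≤ D * (T * P ^ 5) := by
      gcongr
      exact one_le_mul_of_one_le_of_one_le hT hP5
    linarith
  have hargpos : 0 < D + T * b ^ 2 / lam := by rw [hTb]; positivity
  have h1 := Real.log_le_log hargpos harg
  have h2 := log_mul_pow_le 5 (c := 5) (x := D * T) (by norm_num) (by positivity) hP hDT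
  have h5 : Real.log 5 ≤ 5 * ℓ := by
    have h := log_five_div_le (δ := 1) (ℓ := ℓ) one_pos hℓ (by simp; linarith)
    simpa using h
  have hlog : Real.log (D + T * b ^ 2 / lam) ≤ 16 * P * ℓ := by
    push_cast at h2
    nlinarith
  have hlog0 : 0 ≤ Real.log (D + T * b ^ 2 / lam) :=
    Real.log_nonneg (by rw [hTb]; nlinarith [mul_nonneg (by linarith : (0:ℝ) ≤ T) hb0])
  have e : 9 * P ^ 3 * √(D * T * ℓ) = √(81 * P ^ 6 * (D * T * ℓ)) := by
    rw [show 81 * P ^ 6 * (D * T * ℓ) = (9 * P ^ 3) ^ 2 * (D * T * ℓ) by ring,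
      Real.sqrt_mul (sq_nonneg _) (D * T * ℓ), Real.sqrt_sq (by positivity)]
  rw [e]
  refine Real.sqrt_le_sqrt ?_
  calc T * ((1 + b ^ 2 / lam) * (D * Real.log (D + T * b ^ 2 / lam)))
      ≤ T * ((5 * P ^ 5) * (D * (16 * P * ℓ))) := by
        gcongr
        linarith
    _ = 80 * P ^ 6 * (D * T * ℓ) := by ring
    _ ≤ _ := by gcongr; norm_num

/-- The argument is (20/p)(DT/δ), and ℓ ≥ 1/2 turns the additive constant log(20/p) into a multiple
of ℓ. -/
lemma log_union_bound {D T δ p ℓ : ℝ} (hD : 0 < D) (hT : 0 < T) (hδ : 0 < δ) (hp : 0 < p)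
    (hp1 : p ≤ 1) (hℓ : 1 / 2 ≤ ℓ) (hlog : Real.log (D * T / δ) = ℓ) :
    0 ≤ Real.log (2 * D / (δ / 5 * p / (2 * T))) ∧
      Real.log (2 * D / (δ / 5 * p / (2 * T))) ≤ (2 * Real.log (20 / p) + 1) * ℓ := by
  have e : 2 * D / (δ / 5 * p / (2 * T)) = 20 / p * (D * T / δ) := by
    field_simp
    norm_num
  have h20 : 0 ≤ Real.log (20 / p) := Real.log_nonneg (by rw [le_div_iff₀ hp]; linarith)
  rw [e, Real.log_mul (by positivity) (by positivity), hlog]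
  exact ⟨by linarith, by nlinarith⟩

lemma sqrt_mul_le_of_sq_le {κ D P ℓ c b x : ℝ} (hκ : 0 ≤ κ) (hD : 0 ≤ D) (hP : 1 ≤ P) (hℓ : 0 ≤ ℓ)
    (hc : 0 ≤ c) (hb : b ^ 2 ≤ 21 * (κ * D * P ^ 3 * ℓ)) (hx0 : 0 ≤ x) (hx : x ≤ c * ℓ) :
    b * √(2 * D * x) ≤ √(42 * c) * √κ * D * P ^ 2 * ℓ := by
  refine (abs_le_of_sq_le_sq' ?_ (by positivity)).2
  rw [mul_pow, Real.sq_sqrt (by positivity), mul_pow, mul_pow, mul_pow, mul_pow,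
    Real.sq_sqrt (by positivity), Real.sq_sqrt hκ]
  have hP34 : P ^ 3 ≤ P ^ 4 := pow_le_pow_right₀ hP (by norm_num)
  calc b ^ 2 * (2 * D * x) ≤ 21 * (κ * D * P ^ 3 * ℓ) * (2 * D * (c * ℓ)) := by gcongr
    _ = 42 * c * κ * D ^ 2 * P ^ 3 * ℓ ^ 2 := by ring
    _ ≤ 42 * c * κ * D ^ 2 * P ^ 4 * ℓ ^ 2 := by gcongr
    _ = _ := by ring

lemma le_of_sq_le_mul {κ D P ℓ c b : ℝ} (hκ : 0 ≤ κ) (hD : 1 ≤ D) (hP : 1 ≤ P) (hℓ : 1 / 2 ≤ ℓ)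
    (hc : 1 ≤ c) (hb : b ^ 2 ≤ 21 * (κ * D * P ^ 3 * ℓ)) :
    b ≤ √(42 * c) * √κ * D * P ^ 2 * ℓ := by
  -- With x = 1/2 the root is √D ≥ 1, so the bound for the sampling radius also bounds b itself.
  have h := sqrt_mul_le_of_sq_le (x := 1 / 2) (c := c) hκ (by linarith) hP (by linarith) (by linarith) hb
    (by norm_num) (by nlinarith)
  rcases le_or_gt b 0 with hb0 | hb0
  · exact hb0.trans (by positivity)
  · refine le_trans (le_mul_of_one_le_right hb0.le ?_) h
    rw [Real.one_le_sqrt]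
    linarith

/-- The radius √κ·D·ℓ times √(DTℓ) is exactly √(κD³Tℓ³). The condition ℓ ≤ T absorbs the
concentration term ℓ into √(DTℓ). The radius contributes P² and the widths P³, whence P⁵. -/
lemma regret_numeric {D T κ ℓ P c q Φ W E : ℝ} (hD : 1 ≤ D) (hT : 1 ≤ T) (hκ : 4 ≤ κ)
    (hℓ : 1 / 2 ≤ ℓ) (hℓT : ℓ ≤ T) (hP : 1 ≤ P) (hq : 0 ≤ q)
    (hΦ : Φ ≤ 9 * P ^ 3 * √(D * T * ℓ)) (hE : W * E ≤ 15 * P ^ 3 * ℓ) :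
    3 * √T + q * (√c * √κ * D * P ^ 2 * ℓ) * (2 * Φ + 4 * W * E) + P ^ 3
      ≤ (8 + q * (78 * √c)) * P ^ 5 * √(κ * D ^ 3 * T * ℓ ^ 3) := by
  have hℓ0 : 0 < ℓ := by linarith
  have hℓD : ℓ ≤ √(D * T * ℓ) := by
    refine Real.le_sqrt_of_sq_le ?_
    calc ℓ ^ 2 = 1 * ℓ * ℓ := by ring
      _ ≤ D * T * ℓ := by gcongr
  have hbr : 2 * Φ + 4 * W * E ≤ 78 * P ^ 3 * √(D * T * ℓ) := by
    have : 15 * P ^ 3 * ℓ ≤ 15 * P ^ 3 * √(D * T * ℓ) := by gcongr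
    linarith
  have hR : √(κ * D ^ 3 * T * ℓ ^ 3) = √κ * D * ℓ * √(D * T * ℓ) := by
    rw [show κ * D ^ 3 * T * ℓ ^ 3 = (D * ℓ) ^ 2 * (κ * (D * T * ℓ)) by ring,
      Real.sqrt_mul (sq_nonneg _), Real.sqrt_sq (by positivity), Real.sqrt_mul (by linarith)]
    ring
  have hRT : T / 2 ≤ κ * D ^ 3 * T * ℓ ^ 3 := by
    have hD3 : 1 ≤ D ^ 3 := one_le_pow₀ hD
    calc T / 2 = 4 * 1 * T * (1 / 2) ^ 3 := by ring
      _ ≤ κ * D ^ 3 * T * ℓ ^ 3 := by gcongr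
  have h1 : √T ≤ 2 * √(κ * D ^ 3 * T * ℓ ^ 3) := by
    rw [show (2 : ℝ) = √(2 ^ 2) by simp, ← Real.sqrt_mul (by positivity)]
    exact Real.sqrt_le_sqrt (by linarith)
  have h2 : 1 ≤ 2 * √(κ * D ^ 3 * T * ℓ ^ 3) := (Real.one_le_sqrt.2 hT).trans h1
  set r := √(κ * D ^ 3 * T * ℓ ^ 3)
  have hr : 0 ≤ r := Real.sqrt_nonneg _
  have hP5 : 1 ≤ P ^ 5 := one_le_pow₀ hP
  have hP35 : P ^ 3 ≤ P ^ 5 := pow_le_pow_right₀ hP (by norm_num)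
  have h3 : q * (√c * √κ * D * P ^ 2 * ℓ) * (2 * Φ + 4 * W * E) ≤ q * (78 * √c) * P ^ 5 * r := by
    calc _ ≤ q * (√c * √κ * D * P ^ 2 * ℓ) * (78 * P ^ 3 * √(D * T * ℓ)) := by gcongr
      _ = _ := by rw [hR]; ring
  have h4 : 3 * √T ≤ 6 * (P ^ 5 * r) := by
    have : r ≤ P ^ 5 * r := le_mul_of_one_le_left hr hP5
    linarith
  have h5 : P ^ 3 ≤ 2 * (P ^ 5 * r) := by
    calc P ^ 3 = P ^ 3 * 1 := by ring
      _ ≤ P ^ 5 * (2 * r) := by gcongr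
      _ = _ := by ring
  linarith

lemma scale_bounds {H L P lam : ℝ} (hL : 0 ≤ L) (hH : 0 ≤ H) (hlam : 0 < lam) (hP : 1 ≤ P)
    (hLP : L ≤ P) (hHP : H ≤ P) (hlamP : lam⁻¹ ≤ P) :
    (2 * L * H) ^ 2 / lam ≤ 4 * P ^ 5 ∧ (2 * L * H + 1) / √lam ≤ 3 * P ^ 3 := by
  have hLH : 2 * L * H ≤ 2 * P ^ 2 := by
    calc 2 * L * H ≤ 2 * P * P := by gcongr
      _ = 2 * P ^ 2 := by ring
  have hP2 : 1 ≤ P ^ 2 := one_le_pow₀ hP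
  have hlam0 : 0 < lam⁻¹ := inv_pos.2 hlam
  have hsq : (√lam)⁻¹ ≤ P := by
    rw [← Real.sqrt_inv]
    refine Real.sqrt_le_iff.2 ⟨by linarith, hlamP.trans (le_self_pow₀ hP (by norm_num))⟩
  rw [div_eq_mul_inv, div_eq_mul_inv]
  constructor
  · calc (2 * L * H) ^ 2 * lam⁻¹ ≤ (2 * P ^ 2) ^ 2 * P := by gcongr
      _ = 4 * P ^ 5 := by ring
  · calc (2 * L * H + 1) * (√lam)⁻¹ ≤ (3 * P ^ 2) * P := by gcongr; linarith
      _ = 3 * P ^ 3 := by ring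

end Numerics

/-- The absolute constant of the regret bound. -/
def regretConst : ℝ :=
  8 + (10 / antiProb + 3) * (78 * √(42 * (2 * Real.log (20 / antiProb) + 1)))

lemma regretConst_pos : 0 < regretConst := by
  have := antiProb_pos
  unfold regretConst
  positivity

end RPO

end

/-! ### Assembly of the regret bound. -/

theorem theorem1 :
    -- `C` and `k` are absolute constants
    ∃ (C : ℝ) (k : ℕ), 0 < C ∧
      ∀ (S A : Type*) [MeasurableSpace S] [MeasurableSpace A] (d : ℕ)
        (M : RPO.MDP S A d) (θs : EuclideanSpace ℝ (Fin d)) (B L : ℝ)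
        (O : ℝ → ℝ → ProbabilityTheory.Kernel (EuclideanSpace ℝ (Fin d)) (RPO.Policy M))
        (T : ℕ) (δ lam : ℝ)
        (Ω : Type*) [MeasurableSpace Ω] (μ : MeasureTheory.Measure Ω)
        [MeasureTheory.IsProbabilityMeasure μ]
        (run : RPO.RegretRun M θs B L O T δ lam μ),
        ‖θs‖ ≤ B → (∀ z, ‖M.feat z‖ ≤ L) → RPO.IsPACOracle M O →
        0 < δ → δ < 1 → 0 < lam →
        -- this only excludes `T = 0`, `d = 0`, and the case `d = T = 1`, `δ > 1/2`
        2 * δ ≤ d * T →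
        ENNReal.ofReal (1 - δ) ≤ μ {ω | RPO.regret M θs T (fun t => run.pol t ω) ≤
          C * (1 + B + L + RPO.horizon M + lam + lam⁻¹) ^ k *
            √(RPO.kappa M B L * d ^ 3 * T * Real.log (d * T / δ) ^ 3)} := by
  refine ⟨RPO.regretConst, 5, RPO.regretConst_pos, ?_⟩
  intro S A _ _ d M θs B L O T δ lam Ω _ μ _ run hθs hL hO hδ hδ1 hlam hdT
  have hdT0 : (0 : ℝ) < d * T := by linarith
  have hd : 1 ≤ d := by
    rcases Nat.eq_zero_or_pos d with h | h
    · simp [h] at hdT0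
    · exact h
  have hT : 1 ≤ T := by
    rcases Nat.eq_zero_or_pos T with h | h
    · simp [h] at hdT0
    · exact h
  have hd1 : (1 : ℝ) ≤ d := by exact_mod_cast hd
  have hT1 : (1 : ℝ) ≤ T := by exact_mod_cast hT
  have hp := RPO.antiProb_pos
  have hp1 := RPO.antiProb_le_one
  have hΩ : Nonempty Ω := MeasureTheory.nonempty_of_isProbabilityMeasure μ
  have hpol : Nonempty (RPO.Policy M) := ⟨run.pol 0 hΩ.some⟩
  have hB : 0 ≤ B := (norm_nonneg _).trans hθs
  -- Any state-action pair gives L ≥ 0; an entry of an arbitrary recorded trajectory supplies one,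
  -- just as `pol 0` shows that policies exist.
  have hL0 : 0 ≤ L := (norm_nonneg _).trans (hL ((run.traj 0 hΩ.some).1 0))
  have hH := RPO.one_le_horizon M
  have hκ := RPO.four_le_kappa M hB hL0
  have hlam' : 0 < lam⁻¹ := inv_pos.2 hlam
  set P := 1 + B + L + RPO.horizon M + lam + lam⁻¹ with hPdef
  set ℓ := Real.log (d * T / δ) with hℓdef
  set κ := RPO.kappa M B L with hκdef
  set R := κ * d ^ 3 * T * ℓ ^ 3 with hR
  have hP : 1 ≤ P := by linarith
  have hℓ : 1 / 2 ≤ ℓ := RPO.half_le_log (by rw [le_div_iff₀ hδ]; linarith)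
  have hlogmono : ∀ x : ℝ, 0 < x → x ≤ d * T / δ → Real.log x ≤ ℓ := fun x hx h =>
    Real.log_le_log hx h
  have hDTδ : (d : ℝ) * T ≤ d * T / δ := by rw [le_div_iff₀ hδ]; nlinarith
  have hTℓ : Real.log T ≤ ℓ := hlogmono _ (by linarith) (le_trans (by nlinarith) hDTδ)
  have hDTℓ : Real.log (d * T) ≤ ℓ := hlogmono _ hdT0 hDTδ
  have hδℓ : Real.log (1 / δ) ≤ ℓ := hlogmono _ (by positivity) (by gcongr; nlinarith)
  have hd3 : (1 : ℝ) ≤ (d : ℝ) ^ 3 := one_le_pow₀ hd1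
  have hκd : 4 ≤ κ * (d : ℝ) ^ 3 := by nlinarith
  have hBLH : ‖θs‖ * (L * RPO.horizon M) ≤ P ^ 3 := by
    calc ‖θs‖ * (L * RPO.horizon M) ≤ P * (P * P) := by
          gcongr
          · linarith
          · linarith
          · linarith
      _ = P ^ 3 := by ring
  have hP35 : P ^ 3 ≤ P ^ 5 := pow_le_pow_right₀ hP (by norm_num)
  have hP5 : 1 ≤ P ^ 5 := one_le_pow₀ hP
  have hR0 : 0 ≤ √R := Real.sqrt_nonneg _
  have hC8 : 8 ≤ RPO.regretConst := by
    unfold RPO.regretConst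
    have : 0 ≤ (10 / RPO.antiProb + 3) * (78 * √(42 * (2 * Real.log (20 / RPO.antiProb) + 1))) := by
      positivity
    linarith
  -- If T < ℓ then T ≤ T³ ≤ ℓ³, hence T² ≤ Tℓ³ ≤ R, and the bound linear in T holds surely.
  -- Otherwise ℓ ≤ T, as `regret_numeric` requires.
  rcases lt_or_ge (T : ℝ) ℓ with hcase | hcase
  · have hall : {ω | RPO.regret M θs T (fun t => run.pol t ω) ≤ RPO.regretConst * P ^ 5 * √R}
        = Set.univ := by
      refine Set.eq_univ_of_forall fun ω => ?_
      have h1 := RPO.regret_le_trivial hL θs T (fun t => run.pol t ω)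
      have hTR : (T : ℝ) ≤ √R := by
        refine Real.le_sqrt_of_sq_le ?_
        have hTℓ3 : (T : ℝ) ≤ ℓ ^ 3 := by
          have : (T : ℝ) ^ 3 ≤ ℓ ^ 3 := by gcongr
          exact (le_self_pow₀ hT1 (by norm_num)).trans this
        calc (T : ℝ) ^ 2 = 1 * T * T := by ring
          _ ≤ κ * d ^ 3 * T * ℓ ^ 3 := by gcongr; linarith
      have h2 : T * (2 * (‖θs‖ * (L * RPO.horizon M))) ≤ √R * (2 * P ^ 5) := by
        gcongr
        exact hBLH.trans hP35
      have h3 : √R * (2 * P ^ 5) ≤ RPO.regretConst * P ^ 5 * √R := by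
        have : 2 * (P ^ 5 * √R) ≤ RPO.regretConst * (P ^ 5 * √R) := by gcongr; linarith
        linarith
      exact h1.trans (h2.trans h3)
    rw [hall, MeasureTheory.measure_univ]
    exact ENNReal.ofReal_le_one.2 (by linarith)
  · have hlog20 : 0 ≤ Real.log (20 / RPO.antiProb) := Real.log_nonneg (by
      rw [le_div_iff₀ hp]; linarith)
    have hβ : ∀ t ∈ Finset.Icc 1 T, RPO.beta M B L lam (δ / 5) t ^ 2
        ≤ 21 * (κ * d * P ^ 3 * ℓ) := fun t ht =>
      RPO.beta_sq_le hB hL0 hlam hd ht hδ hδ1 hP (by linarith) (by linarith) (by linarith)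
        (by linarith) hℓ hTℓ hδℓ
    have hun := RPO.log_union_bound (D := d) (T := T) (by linarith) (by linarith) hδ hp hp1 hℓ
      hℓdef.symm
    refine (RPO.RegretRun.sum_instant_regret_le (run := run) hd hT hθs hL hL0 hO hδ hδ1 hlam
      (fun t ht => RPO.le_of_sq_le_mul (by linarith) hd1 hP hℓ (by linarith) (hβ t ht))
      (fun t ht => RPO.sqrt_mul_le_of_sq_le (by linarith) (by linarith) hP (by linarith)
        (by linarith) (hβ t ht) hun.1 hun.2)).trans
      (MeasureTheory.measure_mono fun ω hω => ?_)
    obtain ⟨hb, hb'⟩ := RPO.scale_bounds hL0 (by linarith) hlam hP (by linarith : L ≤ P)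
      (by linarith : RPO.horizon M ≤ P) (by linarith)
    have hΦ := RPO.potential_le hd1 hT1 hP hb (by positivity) hℓ hDTℓ
    have h5 := RPO.log_five_div_le hδ hℓ hδℓ
    have h50 : 0 ≤ Real.log (5 / δ) := Real.log_nonneg (by rw [le_div_iff₀ hδ]; linarith)
    have hE : (2 * L * RPO.horizon M + 1) / √lam * Real.log (5 / δ) ≤ 15 * P ^ 3 * ℓ := by
      calc _ ≤ 3 * P ^ 3 * (5 * ℓ) := by gcongr
        _ = _ := by ring
    have hsum := RPO.regret_le_sum hL θs T (fun t => run.pol t ω)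
    have hnum := RPO.regret_numeric (c := 42 * (2 * Real.log (20 / RPO.antiProb) + 1))
      (q := 10 / RPO.antiProb + 3) hd1 hT1 hκ hℓ hcase hP (by positivity) hΦ hE
    exact (hsum.trans (add_le_add hω hBLH)).trans hnum
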